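/- Let $G=(V,E,F)$ be a finite cell decomposition of an oriented torus $S$ whose lift $(\tilde V,\tilde E,\tilde F)$ to the universal cover has a simple, 3-connected graph (no loops, no multiple edges, and connected after deleting any two vertices). Let $\gamma_1,\gamma_2$ be a positively oriented pair of generators of $\pi_1(S)$, and let $c:E\to\mathbb{R}_{>0}$ be positive edge weights, $c_{ij}=c_{ji}$. For $\tau\in\mathbb{H}$ let $S_\tau$ be the unit-area Euclidean torus with holonomy $\rho_{\gamma_1}(z)=z+\frac{1}{\sqrt{\operatorname{Im}\tau}}$, $\rho_{\gamma_2}(z)=z+\frac{\tau}{\sqrt{\operatorname{Im}\tau}}$. A straight-line map $h:(V,E)\to S_\tau$ in the homotopy class given by the marking is described by its lift $\tilde h:\tilde V\to\mathbb{C}$, which satisfies $\tilde h\circ\gamma_r=\rho_{\gamma_r}\circ\tilde h$ for $r=1,2$. Its energy is $E_c(h)=\frac12\sum_{ij\in E}c_{ij}|\tilde h_j-\tilde h_i|^2$; $h_\tau$ denotes a minimizer of $E_c$ among such maps for fixed $\tau$ (it is unique up to translation), and $\mathcal{E}_c(\tau,h)=E_c(h)$ is the energy on all pairs $(\tau,h)$.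 A conjugate map of $h_\tau$ is a map $\tilde h^*:\tilde F\to\mathbb{C}$ with $\tilde h^*_{\mathrm{left}(ij)}-\tilde h^*_{\mathrm{right}(ij)}=\sqrt{-1}\,c_{ij}(\tilde h_j-\tilde h_i)$ for every oriented edge $ij$ of the universal cover, where $\mathrm{left}(ij)$ and $\mathrm{right}(ij)$ are its left and right faces; it is determined up to translation. Given vertex weights $w:V\to\mathbb{R}$, lifted to $\tilde V$, the power cell of $v\in\tilde V$ is the set of $x\in\mathbb{C}$ at which $|x-\tilde h_v|^2-w_v\le|x-\tilde h_u|^2-w_u$ for all $u\in\tilde V$. The realization of $(V,E,F)$ under $h$ is the weighted Delaunay decomposition for $w$ if the sets of vertices whose power cells contain a common point $x$, as $x$ runs over $\mathbb{C}$, are exactly the vertex sets of the vertices, edges and faces of the universal cover, every edge is non-degenerate, and every face is realized as a strictly convex polygon with its sides in counterclockwise order. A map $\tilde h^\dagger:\tilde F\to\mathbb{C}$ is its dual Voronoi decomposition if it is injective, $\tilde h^\dagger_f$ lies in exactly the power cells of the vertices of $f$, the power cells of the two ends of each edge $ij$ meet exactly in the segment from $\tilde h^\dagger_{\mathrm{left}(ij)}$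 to $\tilde h^\dagger_{\mathrm{right}(ij)}$, and the power cell of each vertex is the convex hull of the points $\tilde h^\dagger_f$ of the faces $f$ around it. Then for every $\tau\in\mathbb{H}$, every $h_\tau$ and every $k\in\mathbb{R}$, the following are equivalent: 1. $(\tau,h_\tau)$ is a minimizer of $\mathcal{E}_c$, and its value is $k$. 2. $k>0$, and there are a conjugate map $\tilde h^*$ of $h_\tau$ and vertex weights $w:V\to\mathbb{R}$ such that the realization of $(V,E,F)$ under $h_\tau$ is the weighted Delaunay decomposition for $w$ and $\tilde h^\dagger:=\tilde h^*/k$ is its dual Voronoi decomposition. In that case, for $\tilde h^\dagger=\tilde h^*/k$ with any conjugate map $\tilde h^*$ of $h_\tau$ and for every oriented edge $ij$ of the universal cover, $\tilde h_j\neq\tilde h_i$ and $$c_{ij}=\frac{k}{\sqrt{-1}}\,\frac{\tilde h^\dagger_{\mathrm{left}(ij)}-\tilde h^\dagger_{\mathrm{right}(ij)}}{\tilde h_j-\tilde h_i}>0.$$ -/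

import Mathlib

/-- A combinatorial map (rotation system) with set of darts (oriented edges) `D`. The involution
`flip` reverses a dart, and `rot` sends a dart to the next dart in counterclockwise order around
its tail. Combinatorial maps encode the cell decompositions of oriented surfaces without
boundary. -/
structure CombinatorialMap (D : Type*) where
  flip : Equiv.Perm D
  rot : Equiv.Perm D
  flip_flip : ∀ d, flip (flip d) = d
  flip_ne : ∀ d, flip d ≠ d

namespace CombinatorialMap

variable {D : Type*} (M : CombinatorialMap D)

/-- The next dart along the boundary of the face on the left of a dart. -/
def next : Equiv.Perm D := M.flip.trans M.rot.symm

/-- The vertices are the cycles of `rot`. -/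
def Vertex : Type _ := Quotient (Equiv.Perm.SameCycle.setoid M.rot)

/-- The (unoriented) edges are the cycles of `flip`. -/
def Edge : Type _ := Quotient (Equiv.Perm.SameCycle.setoid M.flip)

/-- The faces are the cycles of `next`. -/
def Face : Type _ := Quotient (Equiv.Perm.SameCycle.setoid M.next)

def tail (d : D) : M.Vertex := Quotient.mk (Equiv.Perm.SameCycle.setoid M.rot) d

def head (d : D) : M.Vertex := M.tail (M.flip d)

/-- The face on the left of a dart. -/
def left (d : D) : M.Face := Quotient.mk (Equiv.Perm.SameCycle.setoid M.next) d

/-- The face on the right of a dart. -/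
def right (d : D) : M.Face := M.left (M.flip d)

/-- The vertices of a face. -/
def faceVertices (f : M.Face) : Set M.Vertex := {v | ∃ d, M.tail d = v ∧ M.left d = f}

/-- The faces around a vertex. -/
def vertexFaces (v : M.Vertex) : Set M.Face := {f | ∃ d, M.tail d = v ∧ M.left d = f}

/-- The underlying surface is connected. -/
def IsConnected : Prop :=
  ∀ d d' : D, ∃ g ∈ Subgroup.closure ({M.flip, M.rot} : Set (Equiv.Perm D)), g d = d'

/-- No loops and no multiple edges. -/
def IsSimple : Prop :=
  (∀ d, M.tail d ≠ M.head d) ∧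
    ∀ d d', M.tail d = M.tail d' → M.head d = M.head d' → d = d'

/-- The graph formed by the vertices and the edges, forgetting loops and multiplicities. -/
def graph : SimpleGraph M.Vertex where
  Adj u v := u ≠ v ∧ ∃ d, M.tail d = u ∧ M.head d = v
  symm := ⟨by
    rintro u v ⟨huv, d, hu, hv⟩
    refine ⟨huv.symm, M.flip d, hv, ?_⟩
    rw [head, M.flip_flip, hu]⟩
  loopless := ⟨fun _ h => h.1 rfl⟩

/-- Deleting at most two vertices leaves a connected graph. -/
def IsThreeConnected : Prop :=
  ∀ u v : M.Vertex, (M.graph.induce ({u, v}ᶜ : Set M.Vertex)).Connected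

end CombinatorialMap

/-- A finite cell decomposition of an oriented torus together with a marking, that is, an
oriented pair `γ₁, γ₂` of generators of the fundamental group `ℤ × ℤ`.

The marking is recorded by a cocycle `shift`, after the choice of one lift of each vertex to the
universal cover: if `shift d = (a, b)`, then the lift of `d` that starts at the chosen lift of the
tail ends at the image of the chosen lift of the head under `γ₁ ^ a * γ₂ ^ b`. The cocycle is a
map to the standard torus, and `degree_one` says that this map has degree one (so that it is
an isomorphism on fundamental groups that preserves the orientation): the signed areas of the
faces, drawn in the plane with sides given by `shift`, add up to one. -/
structure MarkedTorus (D : Type*) [Fintype D] extends CombinatorialMap D where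
  connected : toCombinatorialMap.IsConnected
  euler : (Nat.card toCombinatorialMap.Vertex : ℤ) - Nat.card toCombinatorialMap.Edge
    + Nat.card toCombinatorialMap.Face = 0
  shift : D → ℤ × ℤ
  shift_flip : ∀ d, shift (flip d) = -shift d
  shift_face : ∀ d, ∑ i ∈ Finset.range (Function.minimalPeriod toCombinatorialMap.next d),
    shift (toCombinatorialMap.next^[i] d) = 0
  degree_one : ∑ᶠ f : toCombinatorialMap.Face,
    (∑ j ∈ Finset.range (Function.minimalPeriod toCombinatorialMap.next (Quotient.out f)),
      ∑ i ∈ Finset.range j,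
        ((shift (toCombinatorialMap.next^[i] (Quotient.out f))).1
            * (shift (toCombinatorialMap.next^[j] (Quotient.out f))).2
          - (shift (toCombinatorialMap.next^[i] (Quotient.out f))).2
            * (shift (toCombinatorialMap.next^[j] (Quotient.out f))).1)) = 2

namespace MarkedTorus

variable {D : Type*} [Fintype D] (T : MarkedTorus D)

/-- The universal cover of the cell decomposition. The deck transformation
`γ₁ ^ a * γ₂ ^ b` is `(d, n) ↦ (d, n + (a, b))`. -/
def cover : CombinatorialMap (D × (ℤ × ℤ)) where
  flip :=
    { toFun := fun x => (T.flip x.1, x.2 + T.shift x.1)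
      invFun := fun x => (T.flip x.1, x.2 + T.shift x.1)
      left_inv := fun x => by simp [T.flip_flip, T.shift_flip]
      right_inv := fun x => by simp [T.flip_flip, T.shift_flip] }
  rot := T.rot.prodCongr (Equiv.refl _)
  flip_flip := fun x => by simp [T.flip_flip, T.shift_flip]
  flip_ne := fun x hx => T.flip_ne x.1 (congrArg Prod.fst hx)

/-- The translation of the plane that is the holonomy of `γ₁ ^ n.1 * γ₂ ^ n.2` for the unit-area
Euclidean torus `S_τ`. -/
noncomputable def holonomy (τ : UpperHalfPlane) (n : ℤ × ℤ) : ℂ :=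
  ((n.1 : ℂ) + (n.2 : ℂ) * (τ : ℂ)) / ((Real.sqrt τ.im : ℝ) : ℂ)

/-- `h` is the lift to the universal cover of a straight-line map from the graph to `S_τ` in the
homotopy class given by the marking. -/
def IsLift (τ : UpperHalfPlane) (h : T.cover.Vertex → ℂ) : Prop :=
  ∀ (d : D) (m n : ℤ × ℤ),
    h (T.cover.tail (d, m + n)) = h (T.cover.tail (d, m)) + holonomy τ n

/-- The Dirichlet energy, half of the sum over the edges of `c` times the squared length. Each
edge consists of two darts, whence the second factor `1 / 2`. -/
noncomputable def energy (c : D → ℝ) (h : T.cover.Vertex → ℂ) : ℝ :=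
  1 / 2 * (1 / 2 * ∑ d : D, c d * ‖h (T.cover.head (d, 0)) - h (T.cover.tail (d, 0))‖ ^ 2)

/-- `h` is (the lift of) the map `h_τ` that minimizes the energy among the maps to the fixed torus
`S_τ` in the given homotopy class. -/
def IsMinimizerAt (c : D → ℝ) (τ : UpperHalfPlane) (h : T.cover.Vertex → ℂ) : Prop :=
  T.IsLift τ h ∧ ∀ h' : T.cover.Vertex → ℂ, T.IsLift τ h' → T.energy c h ≤ T.energy c h'

/-- `(τ, h)` minimizes the energy among all pairs of a marked unit-area Euclidean torus and a map
to it in the given homotopy class. -/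
def IsMinimizer (c : D → ℝ) (τ : UpperHalfPlane) (h : T.cover.Vertex → ℂ) : Prop :=
  T.IsLift τ h ∧ ∀ (τ' : UpperHalfPlane) (h' : T.cover.Vertex → ℂ),
    T.IsLift τ' h' → T.energy c h ≤ T.energy c h'

/-- `hs` is a conjugate map of `h`. -/
def IsConjugate (c : D → ℝ) (h : T.cover.Vertex → ℂ) (hs : T.cover.Face → ℂ) : Prop :=
  ∀ x : D × (ℤ × ℤ), hs (T.cover.left x) - hs (T.cover.right x)
    = Complex.I * (c x.1 : ℂ) * (h (T.cover.head x) - h (T.cover.tail x))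

/-- The vertex weights on the universal cover come from vertex weights on the torus. -/
def IsPeriodicWeight (w : T.cover.Vertex → ℝ) : Prop :=
  ∀ (d : D) (m n : ℤ × ℤ), w (T.cover.tail (d, m + n)) = w (T.cover.tail (d, m))

end MarkedTorus

namespace CombinatorialMap

variable {D : Type*} (M : CombinatorialMap D)

/-- The power distance of `x` from the site `h v` with weight `w v`. -/
noncomputable def power (h : M.Vertex → ℂ) (w : M.Vertex → ℝ) (v : M.Vertex) (x : ℂ) : ℝ :=
  ‖x - h v‖ ^ 2 - w v

/-- The cell of `v` in the weighted Voronoi decomposition. -/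
def powerCell (h : M.Vertex → ℂ) (w : M.Vertex → ℝ) (v : M.Vertex) : Set ℂ :=
  {x | ∀ u, M.power h w v x ≤ M.power h w u x}

/-- The sites nearest to `x` for the power distance. The cells of the weighted Delaunay
decomposition are the convex hulls of the sets of this form. -/
def nearest (h : M.Vertex → ℂ) (w : M.Vertex → ℝ) (x : ℂ) : Set M.Vertex :=
  {v | x ∈ M.powerCell h w v}

/-- The straight-line realization `h` of the cell decomposition `M` in the plane is the weighted
Delaunay decomposition of the sites `h v` with weights `w v`: the cells of the latter are exactly
the vertices, edges and faces of `M`, and each face is realized as a strictly convex polygon with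
its sides in counterclockwise order. -/
structure IsWeightedDelaunay (h : M.Vertex → ℂ) (w : M.Vertex → ℝ) : Prop where
  vertex : ∀ v, ∃ x, M.nearest h w x = {v}
  edge : ∀ d, ∃ x, M.nearest h w x = {M.tail d, M.head d}
  face : ∀ f, ∃ x, M.nearest h w x = M.faceVertices f
  exhaust : ∀ x, (∃ v, M.nearest h w x = {v}) ∨ (∃ d, M.nearest h w x = {M.tail d, M.head d}) ∨
    ∃ f, M.nearest h w x = M.faceVertices f
  convex : ∀ d, h (M.head d) ≠ h (M.tail d) ∧
    ∀ v ∈ M.faceVertices (M.left d), v ≠ M.tail d → v ≠ M.head d →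
      0 < ((h v - h (M.tail d)) * (starRingEnd ℂ) (h (M.head d) - h (M.tail d))).im

/-- The realization `hd` of the dual of `M` is the weighted Voronoi decomposition of the sites
`h v` with weights `w v`: distinct dual vertices are distinct points, `hd f` is the common point
of exactly the cells of the vertices of `f`, the cells of the two ends of an edge meet along the
dual edge, and the cell of a vertex is the polygon spanned by the faces around it. -/
structure IsDualVoronoi (h : M.Vertex → ℂ) (w : M.Vertex → ℝ) (hd : M.Face → ℂ) : Prop where
  injective : Function.Injective hd
  face : ∀ f, M.nearest h w (hd f) = M.faceVertices f
  edge : ∀ d, M.powerCell h w (M.tail d) ∩ M.powerCell h w (M.head d)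
    = segment ℝ (hd (M.left d)) (hd (M.right d))
  vertex : ∀ v, M.powerCell h w v = convexHull ℝ (hd '' M.vertexFaces v)

end CombinatorialMap

/-! A minimizer `h` for fixed periods `W` is in equilibrium: the fluxes `c * e`, with `e` the edge
vectors, sum to zero around each vertex (`coclosed_of_forall_le`). By the Hodge decomposition
(`Coclosed.exists_eq_complex`), `I * c * e` is then the coboundary of a conjugate map with a
well-defined pair of periods `P`. The Riemann bilinear relation (`sum_cograd_mul_grad`) evaluates `I
* ∑ c * e * e'`, for any second map with edge vectors `e'` and periods `W'`, as `-2 * (P.1 * W'.2 -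
P.2 * W'.1)`, so only the periods of the second map matter.

Stationarity under area-preserving linear maps forces the discrete Hopf differential `∑ c * e ^ 2`
to vanish (`sum_sq_eq_zero_of_forall_le`). By the bilinear relation this makes `P` proportional to
`W`, and pairing with the complex conjugate map identifies the factor as the energy `k`
(`periods_eq_of_sum_sq_eq_zero`). Thus the conjugate map divided by `k` has the same periods as `h`
and its edges are orthogonal to those of `h`. Conversely, if `P = k * W`, the same pairing with the
conjugate of an arbitrary competitor, together with the inequality of arithmetic and geometric
means, shows that `h` is a minimizer of energy `k` (`le_of_periods`). For a dual Voronoi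
decomposition, `P = k * W` holds because the compact power cells move by `W` while their dual
vertices move by `P / k` (`periods_eq_of_isDualVoronoi`).

It remains to produce a weighted Delaunay decomposition from orthogonality and equal periods. Two
ingredients enter. The first is Tutte's theorem on the torus: edges of a harmonic map do not
degenerate and all corners turn the same way. It rests on an index count: since the Euler
characteristic is zero, a generic component of `h` changes sign exactly twice around every vertex
and every face (`CombinatorialMap.not_alternates`). Degenerate configurations are excluded by
perturbing the component so that the pattern `+ - + -` would appear; three-connectedness supplies
the perturbations (`exists_boundary`, `exists_barrier`, `not_flat`, `vec_ne_zero`,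
`cross_rot_ne_zero`).

The second ingredient is an area count. Orthogonality lets the dual graph be translated and vertex
weights be chosen so that the two ends of each edge have equal power at the adjacent faces
(`exists_isDual`). Each power cell is then contained in the convex polygon of dual vertices around
its vertex. The polygons have total area at most one per period, whereas the power cells cover the
plane, so the two families agree and tile (`sum_volume_localCell_le`, `siteCell_eq`). The incidences
at vertices, edges and faces are read off from the tiling. -/

/-! ### Cycles of permutations and combinatorial maps. -/

theorem sameCycle_invariant {X Y : Type*} {π : Equiv.Perm X} {f : X → Y}
    (hf : ∀ x, f (π x) = f x) {x y : X} (h : π.SameCycle x y) : f x = f y := by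
  obtain ⟨i, rfl⟩ := h
  induction i using Int.induction_on with
  | zero => simp
  | succ i ih => rw [add_comm, zpow_add, zpow_one, Equiv.Perm.mul_apply, hf, ih]
  | pred i ih =>
    rw [ih, ← hf ((π ^ (-(i : ℤ) - 1)) x), ← Equiv.Perm.mul_apply, ← zpow_one_add]
    congr 3
    ring

theorem exists_iterate_lt_minimalPeriod {X : Type*} [Finite X] {π : Equiv.Perm X} {x y : X}
    (h : π.SameCycle x y) : ∃ i < Function.minimalPeriod π x, π^[i] x = y := by
  obtain ⟨i, hi⟩ := h.exists_nat_pow_eq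
  have hx : x ∈ Function.periodicPts π := Function.Injective.mem_periodicPts π.injective x
  refine ⟨i % Function.minimalPeriod π x,
    Nat.mod_lt _ (Function.minimalPeriod_pos_of_mem_periodicPts hx), ?_⟩
  rw [Function.iterate_mod_minimalPeriod_eq, ← hi, Equiv.Perm.iterate_eq_pow]

theorem iterate_injOn_minimalPeriod {X : Type*} {f : X → X} {x : X} {i j : ℕ}
    (hi : i < Function.minimalPeriod f x) (hj : j < Function.minimalPeriod f x)
    (h : f^[i] x = f^[j] x) : i = j :=
  Function.iterate_injOn_Iio_minimalPeriod (f := f) (x := x) hi hj h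

namespace CombinatorialMap

variable {D : Type*} (M : CombinatorialMap D)

theorem tail_rot (d : D) : M.tail (M.rot d) = M.tail d :=
  Quotient.sound (s := Equiv.Perm.SameCycle.setoid M.rot)
    ((Equiv.Perm.sameCycle_apply_left (f := M.rot)).2 (Equiv.Perm.SameCycle.refl _ d))

theorem left_next (d : D) : M.left (M.next d) = M.left d :=
  Quotient.sound (s := Equiv.Perm.SameCycle.setoid M.next)
    ((Equiv.Perm.sameCycle_apply_left (f := M.next)).2 (Equiv.Perm.SameCycle.refl _ d))

theorem tail_eq_iff {d d' : D} : M.tail d = M.tail d' ↔ M.rot.SameCycle d d' :=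
  ⟨fun h => Quotient.exact (s := Equiv.Perm.SameCycle.setoid M.rot) h,
    fun h => Quotient.sound (s := Equiv.Perm.SameCycle.setoid M.rot) h⟩

theorem left_eq_iff {d d' : D} : M.left d = M.left d' ↔ M.next.SameCycle d d' :=
  ⟨fun h => Quotient.exact (s := Equiv.Perm.SameCycle.setoid M.next) h,
    fun h => Quotient.sound (s := Equiv.Perm.SameCycle.setoid M.next) h⟩

theorem rot_next (d : D) : M.rot (M.next d) = M.flip d := by
  simp [next]

theorem tail_next (d : D) : M.tail (M.next d) = M.head d := by
  rw [← tail_rot, rot_next, head]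

theorem next_flip_rot (d : D) : M.next (M.flip (M.rot d)) = d := by
  simp [next, M.flip_flip]

theorem head_flip (d : D) : M.head (M.flip d) = M.tail d := by
  rw [head, M.flip_flip]

theorem left_flip_rot (d : D) : M.left (M.flip (M.rot d)) = M.left d := by
  rw [← left_next, next_flip_rot]

theorem tail_surjective : Function.Surjective M.tail := Quotient.mk_surjective

theorem left_surjective : Function.Surjective M.left := Quotient.mk_surjective

theorem tail_iterate (d : D) (i : ℕ) : M.tail (M.rot^[i] d) = M.tail d := by
  induction i with
  | zero => rfl
  | succ i ih => rw [Function.iterate_succ_apply', tail_rot, ih]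

theorem left_iterate (d : D) (i : ℕ) : M.left (M.next^[i] d) = M.left d := by
  induction i with
  | zero => rfl
  | succ i ih => rw [Function.iterate_succ_apply', left_next, ih]

instance [Finite D] : Finite M.Vertex := Finite.of_surjective _ M.tail_surjective

instance [Finite D] : Finite M.Face := Finite.of_surjective _ M.left_surjective

instance [Finite D] : Finite M.Edge := Finite.of_surjective _ (Quotient.mk_surjective
  (s := Equiv.Perm.SameCycle.setoid M.flip))

/-- The edge of a dart. -/
def edge (d : D) : M.Edge := Quotient.mk (Equiv.Perm.SameCycle.setoid M.flip) d

theorem edge_eq_iff {d d' : D} : M.edge d = M.edge d' ↔ d' = d ∨ d' = M.flip d := by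
  constructor
  · intro h
    have h1 : M.flip.SameCycle d d' := Quotient.exact (s := Equiv.Perm.SameCycle.setoid M.flip) h
    have h2 := sameCycle_invariant (f := fun x => ({x, M.flip x} : Set D)) (fun x => by
      simp only [M.flip_flip]; exact Set.pair_comm _ _) h1
    have h3 : d' ∈ ({d', M.flip d'} : Set D) := Or.inl rfl
    rw [← h2] at h3
    exact h3
  · rintro (rfl | rfl)
    · rfl
    · exact Quotient.sound (s := Equiv.Perm.SameCycle.setoid M.flip)
        ((Equiv.Perm.sameCycle_apply_right (f := M.flip)).2 (Equiv.Perm.SameCycle.refl _ d))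

theorem card_eq_two_mul_card_edge [Fintype D] : Fintype.card D = 2 * Nat.card M.Edge := by
  classical
  have := Fintype.ofFinite M.Edge
  rw [← Finset.card_univ, Finset.card_eq_sum_card_fiberwise (f := M.edge) (t := Finset.univ)
    (fun _ _ => Finset.mem_univ _)]
  rw [Finset.sum_congr rfl (g := fun _ => 2), Finset.sum_const, Nat.card_eq_fintype_card,
    smul_eq_mul, mul_comm, Finset.card_univ]
  intro e _
  obtain ⟨d, rfl⟩ := Quotient.mk_surjective (s := Equiv.Perm.SameCycle.setoid M.flip) e
  have : Finset.univ.filter (fun x => M.edge x = M.edge d) = {d, M.flip d} := by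
    ext x
    simp only [Finset.mem_filter, Finset.mem_univ, true_and, Finset.mem_insert,
      Finset.mem_singleton]
    rw [eq_comm, edge_eq_iff]
  change (Finset.univ.filter (fun x => M.edge x = M.edge d)).card = 2
  rw [this, Finset.card_pair (M.flip_ne d).symm]

theorem sum_eq_sum_faces [Fintype D] [Fintype M.Face] {A : Type*} [AddCommMonoid A] (F : D → A) :
    ∑ d, F d = ∑ f : M.Face, ∑ j ∈ Finset.range (Function.minimalPeriod M.next (Quotient.out f)),
      F (M.next^[j] (Quotient.out f)) := by
  classical
  rw [← Finset.sum_fiberwise (g := M.left)]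
  refine Finset.sum_congr rfl fun f _ => ?_
  have hf : M.left (Quotient.out f) = f := Quotient.out_eq f
  have : Finset.univ.filter (fun d => M.left d = f) =
      (Finset.range (Function.minimalPeriod M.next (Quotient.out f))).image
        (fun j => M.next^[j] (Quotient.out f)) := by
    ext d
    simp only [Finset.mem_filter, Finset.mem_univ, true_and, Finset.mem_image, Finset.mem_range]
    constructor
    · intro h
      rw [← hf, eq_comm, left_eq_iff] at h
      exact exists_iterate_lt_minimalPeriod h
    · rintro ⟨j, -, rfl⟩
      rw [left_iterate, hf]
  rw [this, Finset.sum_image]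
  intro i hi j hj h
  exact iterate_injOn_minimalPeriod (by simpa using hi) (by simpa using hj) h

theorem sum_iterate_rot [Fintype D] {A : Type*} [AddCommMonoid A] (F : D → A) (d : D)
    [DecidablePred fun x => M.tail x = M.tail d] :
    ∑ i ∈ Finset.range (Function.minimalPeriod M.rot d), F (M.rot^[i] d) =
      ∑ x ∈ Finset.univ.filter (fun x => M.tail x = M.tail d), F x := by
  classical
  have : Finset.univ.filter (fun x => M.tail x = M.tail d) =
      (Finset.range (Function.minimalPeriod M.rot d)).image (fun j => M.rot^[j] d) := by
    ext x
    simp only [Finset.mem_filter, Finset.mem_univ, true_and, Finset.mem_image, Finset.mem_range]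
    constructor
    · intro h
      rw [eq_comm, tail_eq_iff] at h
      exact exists_iterate_lt_minimalPeriod h
    · rintro ⟨j, -, rfl⟩
      rw [tail_iterate]
  rw [this, Finset.sum_image]
  intro i hi j hj h
  exact iterate_injOn_minimalPeriod (by simpa using hi) (by simpa using hj) h

end CombinatorialMap

/-! ### Cells of the universal cover as cells of the torus with a label in ℤ × ℤ. -/

namespace MarkedTorus

variable {D : Type*} [Fintype D] (T : MarkedTorus D)

theorem cover_flip (d : D) (n : ℤ × ℤ) : T.cover.flip (d, n) = (T.flip d, n + T.shift d) := rfl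

theorem cover_rot (d : D) (n : ℤ × ℤ) : T.cover.rot (d, n) = (T.rot d, n) := rfl

theorem cover_next (d : D) (n : ℤ × ℤ) : T.cover.next (d, n) = (T.next d, n + T.shift d) := by
  apply T.cover.rot.injective
  rw [CombinatorialMap.rot_next, cover_rot, cover_flip, CombinatorialMap.rot_next]

theorem exists_index (d : D) : ∃ j, j < Function.minimalPeriod T.next (Quotient.out (T.left d)) ∧
    T.next^[j] (Quotient.out (T.left d)) = d :=
  exists_iterate_lt_minimalPeriod (T.left_eq_iff.1 (Quotient.out_eq (T.left d)))

/-- The position of a dart on the boundary of its face. -/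
noncomputable def index (d : D) : ℕ := (T.exists_index d).choose

theorem index_lt (d : D) :
    T.index d < Function.minimalPeriod T.next (Quotient.out (T.left d)) :=
  (T.exists_index d).choose_spec.1

theorem iterate_index (d : D) : T.next^[T.index d] (Quotient.out (T.left d)) = d :=
  (T.exists_index d).choose_spec.2

theorem index_iterate_out (f : T.Face) {j : ℕ}
    (hj : j < Function.minimalPeriod T.next (Quotient.out f)) :
    T.index (T.next^[j] (Quotient.out f)) = j := by
  have hf : T.left (T.next^[j] (Quotient.out f)) = f := by
    rw [CombinatorialMap.left_iterate]
    exact Quotient.out_eq f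
  have h1 := T.index_lt (T.next^[j] (Quotient.out f))
  have h2 := T.iterate_index (T.next^[j] (Quotient.out f))
  rw [hf] at h1 h2
  exact iterate_injOn_minimalPeriod h1 hj h2

/-- The displacement of the tail of a dart from the base point of the boundary of its face. -/
noncomputable def off (d : D) : ℤ × ℤ :=
  ∑ i ∈ Finset.range (T.index d), T.shift (T.next^[i] (Quotient.out (T.left d)))

/-- There is no correction at the dart that closes the boundary, because `shift` sums to zero around
the face. Hence `n - off d` is constant along a lifted boundary and labels the lifts of the face. -/
theorem off_next (d : D) : T.off (T.next d) = T.off d + T.shift d := by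
  have hl : T.left (T.next d) = T.left d := T.left_next d
  set o := Quotient.out (T.left d) with ho
  have h1 := T.index_lt d
  have h2 := T.iterate_index d
  rw [← ho] at h1 h2
  have h3 : T.next^[T.index d + 1] o = T.next d := by
    rw [Function.iterate_succ_apply', h2]
  have h4 : T.off d + T.shift d = ∑ i ∈ Finset.range (T.index d + 1), T.shift (T.next^[i] o) := by
    rw [Finset.sum_range_succ, h2, off]
  rw [h4]
  rcases Nat.lt_or_ge (T.index d + 1) (Function.minimalPeriod T.next o) with h | h
  · have h5 := T.index_iterate_out (T.left d) h
    rw [← ho, h3] at h5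
    rw [off, hl, h5, ← ho]
  · have h6 : T.index d + 1 = Function.minimalPeriod T.next o := by omega
    have h7 : T.next d = o := by
      rw [← h3, h6, Function.iterate_minimalPeriod]
    have h8 : T.index (T.next d) = 0 := by
      have := T.index_iterate_out (T.left d) (j := 0) (by rw [← ho]; omega)
      rw [← ho] at this
      rw [h7]
      exact this
    rw [off, h8, h6, T.shift_face o]
    simp

/-- A vertex of the cover is a vertex of the torus together with a deck transformation. -/
def vtx : T.cover.Vertex → T.Vertex × (ℤ × ℤ) :=
  Quotient.lift (s := Equiv.Perm.SameCycle.setoid T.cover.rot) (fun x => (T.tail x.1, x.2))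
    fun x y h => sameCycle_invariant (f := fun x : D × (ℤ × ℤ) => (T.tail x.1, x.2))
      (fun x => by
        obtain ⟨d, n⟩ := x
        change (T.tail (T.rot d), n) = _
        rw [T.tail_rot]) h

theorem vtx_tail (d : D) (n : ℤ × ℤ) : T.vtx (T.cover.tail (d, n)) = (T.tail d, n) := rfl

theorem vtx_head (d : D) (n : ℤ × ℤ) :
    T.vtx (T.cover.head (d, n)) = (T.head d, n + T.shift d) := rfl

theorem vtx_injective : Function.Injective T.vtx := by
  intro v w h
  obtain ⟨⟨d, n⟩, rfl⟩ := T.cover.tail_surjective v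
  obtain ⟨⟨d', n'⟩, rfl⟩ := T.cover.tail_surjective w
  rw [vtx_tail, vtx_tail, Prod.mk.injEq, T.tail_eq_iff] at h
  obtain ⟨h, rfl⟩ := h
  exact sameCycle_invariant (f := fun x => T.cover.tail (x, n))
    (fun x => by rw [← T.cover.tail_rot (x, n), cover_rot]) h

theorem vtx_surjective : Function.Surjective T.vtx := by
  rintro ⟨v, n⟩
  obtain ⟨d, rfl⟩ := T.tail_surjective v
  exact ⟨T.cover.tail (d, n), rfl⟩

/-- A face of the cover is a face of the torus together with a deck transformation. -/
noncomputable def fce : T.cover.Face → T.Face × (ℤ × ℤ) :=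
  Quotient.lift (s := Equiv.Perm.SameCycle.setoid T.cover.next)
    (fun x => (T.left x.1, x.2 - T.off x.1))
    fun x y h => sameCycle_invariant (f := fun x : D × (ℤ × ℤ) => (T.left x.1, x.2 - T.off x.1))
      (fun x => by
        obtain ⟨d, n⟩ := x
        rw [cover_next]
        simp only [T.left_next, off_next]
        rw [add_sub_add_right_eq_sub]) h

theorem fce_left (d : D) (n : ℤ × ℤ) : T.fce (T.cover.left (d, n)) = (T.left d, n - T.off d) :=
  rfl

/-- Euler characteristic zero, in the form that makes the sign count of the index theorem sharp. -/
theorem card_dart [Fintype T.Vertex] [Fintype T.Face] :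
    Fintype.card D = 2 * (Fintype.card T.Vertex + Fintype.card T.Face) := by
  have h1 := T.card_eq_two_mul_card_edge
  have h2 := T.euler
  rw [Nat.card_eq_fintype_card (α := T.Vertex), Nat.card_eq_fintype_card (α := T.Face)] at h2
  omega

theorem nonempty_dart {D : Type*} [Fintype D] (T : MarkedTorus D) : Nonempty D := by
  by_contra h
  rw [not_nonempty_iff] at h
  have : IsEmpty T.Face := ⟨fun f => h.elim (Quotient.out f)⟩
  have := T.degree_one
  rw [finsum_of_isEmpty] at this
  norm_num at this

/-- Faces around a vertex, and all faces, are connected through `flip` and `rot`. -/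
theorem eq_of_invariant {Y : Type*} {f : D → Y} (h1 : ∀ d, f (T.flip d) = f d)
    (h2 : ∀ d, f (T.rot d) = f d) (d d' : D) : f d = f d' := by
  obtain ⟨g, hg, rfl⟩ := T.connected d d'
  induction hg using Subgroup.closure_induction generalizing d with
  | mem g hg =>
    rcases hg with rfl | rfl
    · exact (h1 d).symm
    · exact (h2 d).symm
  | one => rfl
  | mul a b _ _ ha hb => rw [Equiv.Perm.mul_apply, ← ha, ← hb]
  | inv a _ ha =>
    rw [ha (a⁻¹ d)]
    simp

theorem simple_darts (hsimple : T.cover.IsSimple) {d d' : D} (h1 : T.tail d = T.tail d')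
    (h2 : T.head d = T.head d') (h3 : T.shift d = T.shift d') : d = d' := by
  have := hsimple.2 (d, 0) (d', 0) (T.vtx_injective (by simp [vtx_tail, h1]))
    (T.vtx_injective (by simp [vtx_head, h2, h3]))
  exact congrArg Prod.fst this

theorem no_loop (hsimple : T.cover.IsSimple) (d : D) : ¬ (T.tail d = T.head d ∧ T.shift d = 0) := by
  rintro ⟨h1, h2⟩
  exact hsimple.1 (d, 0) (T.vtx_injective (by simp [vtx_tail, vtx_head, h1, h2]))

/-- Three-connectedness as an induction principle. -/
theorem mem_of_closed (hconn : T.cover.IsThreeConnected) (p q : T.Vertex × (ℤ × ℤ))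
    (S : Set (T.Vertex × (ℤ × ℤ))) (hS : ∃ s ∈ S, s ≠ p ∧ s ≠ q)
    (hcl : ∀ d n, (T.tail d, n) ∈ S → (T.tail d, n) ≠ p → (T.tail d, n) ≠ q →
      (T.head d, n + T.shift d) ≠ p → (T.head d, n + T.shift d) ≠ q →
      (T.head d, n + T.shift d) ∈ S) (w : T.Vertex × (ℤ × ℤ)) (hp : w ≠ p) (hq : w ≠ q) :
    w ∈ S := by
  obtain ⟨s, hs, hsp, hsq⟩ := hS
  obtain ⟨p, rfl⟩ := T.vtx_surjective p
  obtain ⟨q, rfl⟩ := T.vtx_surjective q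
  obtain ⟨w, rfl⟩ := T.vtx_surjective w
  obtain ⟨s, rfl⟩ := T.vtx_surjective s
  have hw' : w ∈ ({p, q}ᶜ : Set T.cover.Vertex) := by
    rintro (rfl | rfl)
    · exact hp rfl
    · exact hq rfl
  have hs' : s ∈ ({p, q}ᶜ : Set T.cover.Vertex) := by
    rintro (rfl | rfl)
    · exact hsp rfl
    · exact hsq rfl
  obtain ⟨walk⟩ := (hconn p q).preconnected ⟨s, hs'⟩ ⟨w, hw'⟩
  have key : ∀ a b : ({p, q}ᶜ : Set T.cover.Vertex),
      (T.cover.graph.induce ({p, q}ᶜ : Set T.cover.Vertex)).Walk a b →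
      T.vtx a.1 ∈ S → T.vtx b.1 ∈ S := by
    intro a b W
    induction W with
    | nil => exact id
    | @cons a b c hab W ih =>
      intro ha
      apply ih
      obtain ⟨-, ⟨d, n⟩, h1, h2⟩ := (SimpleGraph.induce_adj.1 hab)
      have hne : ∀ x : ({p, q}ᶜ : Set T.cover.Vertex), T.vtx x.1 ≠ T.vtx p ∧ T.vtx x.1 ≠ T.vtx q :=
        fun x => ⟨fun h => x.2 (Or.inl (T.vtx_injective h)),
          fun h => x.2 (Or.inr (T.vtx_injective h))⟩
      have h3 := hne a
      have h4 := hne b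
      rw [← h1, vtx_tail] at ha h3
      rw [← h2, vtx_head] at h4 ⊢
      exact hcl d n ha h3.1 h3.2 h4.1 h4.2
  exact key _ _ walk hs

theorem mem_of_closed' (hconn : T.cover.IsThreeConnected)
    (S : Set (T.Vertex × (ℤ × ℤ))) (hS : S.Nonempty)
    (hcl : ∀ d n, (T.tail d, n) ∈ S → (T.head d, n + T.shift d) ∈ S)
    (w : T.Vertex × (ℤ × ℤ)) : w ∈ S := by
  obtain ⟨s, hs⟩ := hS
  -- A vertex other than `w` and `s` that can be deleted, so that three-connectedness yields plain
  -- connectedness.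
  obtain ⟨n, hn⟩ : ∃ n : ℤ × ℤ, n ≠ w.2 ∧ n ≠ s.2 := by
    by_cases h : w.2.1 + 1 = s.2.1
    · refine ⟨(w.2.1 + 2, 0), fun h' => ?_, fun h' => ?_⟩
      all_goals
        have := congrArg Prod.fst h'
        simp at this
        try omega
    · refine ⟨(w.2.1 + 1, 0), fun h' => ?_, fun h' => ?_⟩
      all_goals
        have := congrArg Prod.fst h'
        simp at this
        try omega
  have h1 : w ≠ (w.1, n) := fun h => hn.1 (congrArg Prod.snd h).symm
  have h2 : s ≠ (w.1, n) := fun h => hn.2 (congrArg Prod.snd h).symm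
  exact T.mem_of_closed hconn (w.1, n) (w.1, n) S ⟨s, hs, h2, h2⟩
    (fun d n h _ _ _ _ => hcl d n h) w h1 h1

end MarkedTorus

/-! ### Sign changes along cycles and the index theorem. -/

/-- The values of `s` along some cycle of `π` have the signs `+ - + -` at four places in cyclic
order. -/
def Alternates {X : Type*} (π : Equiv.Perm X) (s : X → ℝ) : Prop :=
  ∃ x, ∃ i j k : ℕ, 0 < i ∧ i < j ∧ j < k ∧ k < Function.minimalPeriod π x ∧
    0 < s x ∧ s (π^[i] x) < 0 ∧ 0 < s (π^[j] x) ∧ s (π^[k] x) < 0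

theorem exists_sign_change {P : ℕ → Prop} {i j : ℕ} (hij : i ≤ j) (hi : P i) (hj : ¬ P j) :
    ∃ u, i ≤ u ∧ u < j ∧ P u ∧ ¬ P (u + 1) := by
  induction j, hij using Nat.le_induction with
  | base => exact absurd hi hj
  | succ j hij ih =>
    by_cases h : P j
    · exact ⟨j, hij, Nat.lt_succ_self j, h, hj⟩
    · obtain ⟨u, h1, h2, h3⟩ := ih h
      exact ⟨u, h1, by omega, h3⟩

theorem iterate_invariant {X Y : Type*} {π : X → X} {f : X → Y} (hf : ∀ x, f (π x) = f x)
    (x : X) (i : ℕ) : f (π^[i] x) = f x := by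
  induction i with
  | zero => rfl
  | succ i ih => rw [Function.iterate_succ_apply', hf, ih]

section SignChanges

open Classical in
/-- The places at which the sign of `s` changes along the cycles of `π`. -/
noncomputable def signChanges {X : Type*} [Fintype X] (π : Equiv.Perm X) (s : X → ℝ) : Finset X :=
  Finset.univ.filter fun x => ¬ (0 < s x ↔ 0 < s (π x))

variable {X A : Type*} [Fintype X] {π : Equiv.Perm X} {a : X → A} {s : X → ℝ}

open Classical in
-- Going from a positive value to a negative one and back to a positive one meets a change in each
-- direction, at distinct places.
theorem two_le_card_signChanges_fiber (ha : ∀ x, a (π x) = a x)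
    (hpos : ∀ x, ∃ i, 0 < s (π^[i] x)) (hneg : ∀ x, ∃ i, s (π^[i] x) < 0) (x : X) :
    2 ≤ ((signChanges π s).filter fun y => a y = a x).card := by
  obtain ⟨i, hi⟩ := hpos x
  obtain ⟨j, hj⟩ := hneg (π^[i] x)
  obtain ⟨k, hk⟩ := hpos (π^[j] (π^[i] x))
  set y := π^[i] x with hy
  set z := π^[j] y with hz
  obtain ⟨u, -, -, hu1, hu2⟩ := exists_sign_change (P := fun u => 0 < s (π^[u] y))
    (Nat.zero_le j) hi (not_lt.2 hj.le)
  obtain ⟨v, -, -, hv1, hv2⟩ := exists_sign_change (P := fun u => ¬ 0 < s (π^[u] z))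
    (Nat.zero_le k) (not_lt.2 hj.le) (not_not.2 hk)
  have hay : a y = a x := iterate_invariant ha x i
  have haz : a z = a x := (iterate_invariant ha y j).trans hay
  rw [Function.iterate_succ_apply'] at hu2 hv2
  rw [← Finset.card_pair (a := π^[u] y) (b := π^[v] z)
    (fun h => by rw [h] at hu1; exact hv1 hu1)]
  refine Finset.card_le_card fun w hw => ?_
  rw [Finset.mem_insert, Finset.mem_singleton] at hw
  rw [Finset.mem_filter, signChanges, Finset.mem_filter]
  rcases hw with rfl | rfl
  · exact ⟨⟨Finset.mem_univ _, fun h => hu2 (h.1 hu1)⟩, (iterate_invariant ha y u).trans hay⟩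
  · exact ⟨⟨Finset.mem_univ _, fun h => hv1 (h.2 (not_not.1 hv2))⟩,
      (iterate_invariant ha z v).trans haz⟩

open Classical in
-- The fourth change lies between `k` and the return to `x`. All four indices are below the minimal
-- period, so they give distinct elements.
theorem four_le_card_signChanges_fiber (ha : ∀ x, a (π x) = a x) {x : X} {i j k : ℕ} (hi : 0 < i)
    (hij : i < j) (hjk : j < k) (hk : k < Function.minimalPeriod π x) (h0 : 0 < s x)
    (h1 : s (π^[i] x) < 0) (h2 : 0 < s (π^[j] x)) (h3 : s (π^[k] x) < 0) :
    4 ≤ ((signChanges π s).filter fun y => a y = a x).card := by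
  set p := Function.minimalPeriod π x with hp
  have h4 : 0 < s (π^[p] x) := by rw [hp, Function.iterate_minimalPeriod]; exact h0
  obtain ⟨u1, l1, r1, p1, q1⟩ := exists_sign_change (P := fun u => 0 < s (π^[u] x))
    hi.le h0 (not_lt.2 h1.le)
  obtain ⟨u2, l2, r2, p2, q2⟩ := exists_sign_change (P := fun u => ¬ 0 < s (π^[u] x))
    hij.le (not_lt.2 h1.le) (not_not.2 h2)
  obtain ⟨u3, l3, r3, p3, q3⟩ := exists_sign_change (P := fun u => 0 < s (π^[u] x))
    hjk.le h2 (not_lt.2 h3.le)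
  obtain ⟨u4, l4, r4, p4, q4⟩ := exists_sign_change (P := fun u => ¬ 0 < s (π^[u] x))
    hk.le (not_lt.2 h3.le) (not_not.2 h4)
  rw [not_not] at q2 q4
  simp only [Function.iterate_succ_apply'] at q1 q2 q3 q4
  have hinj : Set.InjOn (fun u => π^[u] x) (({u1, u2, u3, u4} : Finset ℕ) : Set ℕ) := by
    intro v hv w hw h
    simp only [Finset.coe_insert, Finset.coe_singleton, Set.mem_insert_iff,
      Set.mem_singleton_iff] at hv hw
    exact iterate_injOn_minimalPeriod (f := π) (x := x) (by omega) (by omega) h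
  have hcard : ({u1, u2, u3, u4} : Finset ℕ).card = 4 := by
    rw [Finset.card_insert_of_notMem, Finset.card_insert_of_notMem, Finset.card_pair]
    all_goals simp only [Finset.mem_insert, Finset.mem_singleton, ne_eq]; omega
  rw [← hcard, ← Finset.card_image_of_injOn hinj]
  refine Finset.card_le_card fun w hw => ?_
  rw [Finset.mem_image] at hw
  obtain ⟨u, hu, rfl⟩ := hw
  rw [Finset.mem_filter, signChanges, Finset.mem_filter]
  refine ⟨⟨Finset.mem_univ _, ?_⟩, iterate_invariant ha x u⟩
  simp only [Finset.mem_insert, Finset.mem_singleton] at hu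
  rcases hu with rfl | rfl | rfl | rfl
  · exact fun h => q1 (h.1 p1)
  · exact fun h => p2 (h.2 q2)
  · exact fun h => q3 (h.1 p3)
  · exact fun h => p4 (h.2 q4)

theorem two_mul_card_le_card_signChanges [Fintype A] (ha : ∀ x, a (π x) = a x)
    (hsurj : Function.Surjective a) (hpos : ∀ x, ∃ i, 0 < s (π^[i] x)) (hneg : ∀ x, ∃ i, s (π^[i] x) < 0) :
    2 * Fintype.card A ≤ (signChanges π s).card ∧
      (Alternates π s → 2 * Fintype.card A < (signChanges π s).card) := by
  classical
  have h2 : ∀ y : A, 2 ≤ ((signChanges π s).filter fun z => a z = y).card := by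
    intro y
    obtain ⟨x, rfl⟩ := hsurj y
    exact two_le_card_signChanges_fiber ha hpos hneg x
  have h3 : 2 * Fintype.card A = ∑ _y : A, 2 := by simp [mul_comm]
  rw [h3, Finset.card_eq_sum_card_fiberwise (f := a) (t := Finset.univ)
    (fun _ _ => Finset.mem_univ _)]
  refine ⟨Finset.sum_le_sum fun y _ => h2 y, ?_⟩
  rintro ⟨x, i, j, k, hi, hij, hjk, hk, p0, p1, p2, p3⟩
  refine Finset.sum_lt_sum (fun y _ => h2 y) ⟨a x, Finset.mem_univ _, ?_⟩
  have := four_le_card_signChanges_fiber ha hi hij hjk hk p0 p1 p2 p3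
  omega

end SignChanges

/-- The index theorem for a nowhere vanishing discrete one-form on a torus: if its sign changes
around every vertex and around every face, then it changes exactly twice. -/
theorem CombinatorialMap.not_alternates {X A B : Type*} [Fintype X] [Fintype A] [Fintype B]
    (M : CombinatorialMap X) {a : X → A} {b : X → B} {s : X → ℝ}
    (ha : ∀ x, a (M.rot x) = a x) (hb : ∀ x, b (M.next x) = b x)
    (ha' : Function.Surjective a) (hb' : Function.Surjective b)
    (hcard : Fintype.card X = 2 * (Fintype.card A + Fintype.card B))
    (hs : ∀ x, s x ≠ 0) (hflip : ∀ x, s (M.flip x) = - s x)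
    (hpos : ∀ x, ∃ i, 0 < s (M.rot^[i] x)) (hneg : ∀ x, ∃ i, s (M.rot^[i] x) < 0)
    (hpos' : ∀ x, ∃ i, 0 < s (M.next^[i] x)) (hneg' : ∀ x, ∃ i, s (M.next^[i] x) < 0) :
    ¬ Alternates M.rot s ∧ ¬ Alternates M.next s := by
  classical
  obtain ⟨h1, h2⟩ := two_mul_card_le_card_signChanges ha ha' hpos hneg
  obtain ⟨h3, h4⟩ := two_mul_card_le_card_signChanges hb hb' hpos' hneg'
  -- The corner between `x` and `rot x` at a vertex is the corner between `flip (rot x)` and `x` of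
  -- a face. As `s` is odd under `flip`, exactly one of the two pairs is a sign change. The total
  -- therefore equals the sum of the lower bounds of two per vertex and per face, and no cycle has
  -- room for four.
  have h5 : (signChanges M.rot s).card + (signChanges M.next s).card = Fintype.card X := by
    rw [← Finset.card_add_card_compl (signChanges M.rot s)]
    congr 1
    symm
    refine Finset.card_bij (fun x _ => M.flip (M.rot x)) ?_ ?_ ?_
    · intro x hx
      simp only [signChanges, Finset.mem_compl, Finset.mem_filter, Finset.mem_univ, true_and,
        not_not] at hx ⊢
      rw [M.next_flip_rot, hflip, hx]
      have := hs (M.rot x)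
      intro h
      rcases lt_or_gt_of_ne this with h' | h'
      · exact absurd (h.1 (by linarith)) (by linarith)
      · exact absurd (h.2 h') (by linarith)
    · intro x _ y _ h
      exact M.rot.injective (M.flip.injective h)
    · intro y hy
      refine ⟨M.next y, ?_, by rw [M.rot_next, M.flip_flip]⟩
      simp only [signChanges, Finset.mem_compl, Finset.mem_filter, Finset.mem_univ, true_and,
        not_not] at hy ⊢
      rw [M.rot_next, hflip]
      by_contra h'
      apply hy
      have := hs y
      constructor
      · intro h
        by_contra h''
        apply h'
        constructor
        · intro h3; exact absurd h3 h''
        · intro h3; linarith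
      · intro h
        by_contra h''
        apply h'
        have : s y < 0 := lt_of_le_of_ne (not_lt.1 h'') this
        exact ⟨fun _ => by linarith, fun _ => h⟩
  constructor
  · intro h
    have := h2 h
    omega
  · intro h
    have := h4 h
    omega

/-! ### Finite covers of the torus and functions with periodic differences. -/

namespace MarkedTorus

variable {D : Type*} [Fintype D] (T : MarkedTorus D)

/-- The difference of a function on the vertices of the cover along a dart. -/
def dif {A : Type*} [AddGroup A] (H : T.Vertex → ℤ × ℤ → A) (x : D × (ℤ × ℤ)) : A :=
  H (T.head x.1) (x.2 + T.shift x.1) - H (T.tail x.1) x.2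

theorem dif_flip {A : Type*} [AddCommGroup A] (H : T.Vertex → ℤ × ℤ → A) (x : D × (ℤ × ℤ)) :
    T.dif H (T.cover.flip x) = - T.dif H x := by
  obtain ⟨d, n⟩ := x
  rw [cover_flip]
  simp only [dif, T.shift_flip, CombinatorialMap.head_flip, add_neg_cancel_right]
  rw [CombinatorialMap.head, neg_sub]

theorem cover_rot_iterate (d : D) (n : ℤ × ℤ) (i : ℕ) :
    T.cover.rot^[i] (d, n) = (T.rot^[i] d, n) := by
  induction i with
  | zero => rfl
  | succ i ih => rw [Function.iterate_succ_apply', ih, cover_rot, Function.iterate_succ_apply']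

theorem cover_next_iterate (d : D) (n : ℤ × ℤ) (i : ℕ) : T.cover.next^[i] (d, n) =
    (T.next^[i] d, n + ∑ j ∈ Finset.range i, T.shift (T.next^[j] d)) := by
  induction i with
  | zero => simp
  | succ i ih => rw [Function.iterate_succ_apply', ih, cover_next, Function.iterate_succ_apply',
      Finset.sum_range_succ, add_assoc]

theorem cover_rot_minimalPeriod (d : D) (n : ℤ × ℤ) :
    Function.minimalPeriod T.cover.rot (d, n) = Function.minimalPeriod T.rot d := by
  refine Function.minimalPeriod_eq_minimalPeriod_iff.2 fun i => ?_
  simp [Function.IsPeriodicPt, Function.IsFixedPt, cover_rot_iterate]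

theorem cover_next_minimalPeriod (d : D) (n : ℤ × ℤ) :
    Function.minimalPeriod T.cover.next (d, n) = Function.minimalPeriod T.next d := by
  apply Nat.dvd_antisymm
  · refine Function.IsPeriodicPt.minimalPeriod_dvd ?_
    rw [Function.IsPeriodicPt, Function.IsFixedPt, cover_next_iterate, T.shift_face,
      Function.iterate_minimalPeriod, add_zero]
  · refine Function.IsPeriodicPt.minimalPeriod_dvd ?_
    have h := Function.iterate_minimalPeriod (f := T.cover.next) (x := (d, n))
    rw [cover_next_iterate] at h
    exact congrArg Prod.fst h

theorem sum_dif_next {A : Type*} [AddCommGroup A] (H : T.Vertex → ℤ × ℤ → A) (x : D × (ℤ × ℤ))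
    (i : ℕ) : ∑ j ∈ Finset.range i, T.dif H (T.cover.next^[j] x) =
      H (T.tail (T.cover.next^[i] x).1) (T.cover.next^[i] x).2 - H (T.tail x.1) x.2 := by
  induction i with
  | zero => simp
  | succ i ih =>
    rw [Finset.sum_range_succ, ih, Function.iterate_succ_apply']
    obtain ⟨d, n⟩ := T.cover.next^[i] x
    rw [cover_next]
    simp only [dif, CombinatorialMap.tail_next]
    abel

theorem sum_dif_face {A : Type*} [AddCommGroup A] (H : T.Vertex → ℤ × ℤ → A) (x : D × (ℤ × ℤ)) :
    ∑ j ∈ Finset.range (Function.minimalPeriod T.cover.next x), T.dif H (T.cover.next^[j] x) = 0 :=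
  by rw [sum_dif_next, Function.iterate_minimalPeriod, sub_self]

/-- Reduction modulo `m` of deck transformations. -/
def red (m : ℕ) (n : ℤ × ℤ) : ZMod m × ZMod m := (n.1, n.2)

theorem red_add (m : ℕ) (n n' : ℤ × ℤ) : red m (n + n') = red m n + red m n' := by
  simp [red]

theorem red_neg (m : ℕ) (n : ℤ × ℤ) : red m (-n) = -red m n := by
  simp [red]

theorem red_eq_red_iff {m : ℕ} {n n' : ℤ × ℤ} :
    red m n = red m n' ↔ ∃ k : ℤ × ℤ, n' = n + (m : ℤ) • k := by
  rw [red, red, Prod.mk.injEq, ZMod.intCast_eq_intCast_iff_dvd_sub,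
    ZMod.intCast_eq_intCast_iff_dvd_sub]
  constructor
  · rintro ⟨⟨a, ha⟩, ⟨b, hb⟩⟩
    exact ⟨(a, b), Prod.ext (by simp; linarith) (by simp; linarith)⟩
  · rintro ⟨k, rfl⟩
    exact ⟨⟨k.1, by simp⟩, ⟨k.2, by simp⟩⟩

theorem red_surjective (m : ℕ) : Function.Surjective (red m) := by
  rintro ⟨a, b⟩
  obtain ⟨a, rfl⟩ := ZMod.intCast_surjective a
  obtain ⟨b, rfl⟩ := ZMod.intCast_surjective b
  exact ⟨(a, b), rfl⟩

/-- The quotient of the universal cover by the deck transformations divisible by `m`. -/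
def modCover (m : ℕ) : CombinatorialMap (D × (ZMod m × ZMod m)) where
  flip :=
    { toFun := fun x => (T.flip x.1, x.2 + red m (T.shift x.1))
      invFun := fun x => (T.flip x.1, x.2 + red m (T.shift x.1))
      left_inv := fun x => by simp [T.flip_flip, T.shift_flip, red_neg]
      right_inv := fun x => by simp [T.flip_flip, T.shift_flip, red_neg] }
  rot := T.rot.prodCongr (Equiv.refl _)
  flip_flip := fun x => by simp [T.flip_flip, T.shift_flip, red_neg]
  flip_ne := fun x hx => T.flip_ne x.1 (congrArg Prod.fst hx)

/-- The projection of the universal cover to its quotient. -/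
def toMod (m : ℕ) (x : D × (ℤ × ℤ)) : D × (ZMod m × ZMod m) := (x.1, red m x.2)

theorem toMod_rot (m : ℕ) : Function.Semiconj (toMod m) T.cover.rot (T.modCover m).rot :=
  fun _ => rfl

theorem toMod_flip (m : ℕ) : Function.Semiconj (toMod m) T.cover.flip (T.modCover m).flip :=
  fun x => by
    obtain ⟨d, n⟩ := x
    rw [cover_flip]
    simp [toMod, modCover, red_add]

theorem toMod_next (m : ℕ) : Function.Semiconj (toMod m) T.cover.next (T.modCover m).next :=
  fun x => by
    apply (T.modCover m).rot.injective
    rw [CombinatorialMap.rot_next, ← toMod_rot, CombinatorialMap.rot_next, toMod_flip]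

/-- This direction suffices: it keeps the indices of an alternation below the period after
projection to the quotient. -/
theorem minimalPeriod_rot_le (m : ℕ) [NeZero m] (x : D × (ℤ × ℤ)) :
    Function.minimalPeriod T.cover.rot x ≤
      Function.minimalPeriod (T.modCover m).rot (toMod m x) := by
  obtain ⟨d, n⟩ := x
  rw [cover_rot_minimalPeriod]
  apply Function.IsPeriodicPt.minimalPeriod_le
  · exact Function.minimalPeriod_pos_of_mem_periodicPts
      (Function.Injective.mem_periodicPts (T.modCover m).rot.injective _)
  · have h := Function.iterate_minimalPeriod (f := (T.modCover m).rot) (x := toMod m (d, n))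
    rw [← (T.toMod_rot m).iterate_right, cover_rot_iterate] at h
    exact congrArg Prod.fst h

theorem minimalPeriod_next_le (m : ℕ) [NeZero m] (x : D × (ℤ × ℤ)) :
    Function.minimalPeriod T.cover.next x ≤
      Function.minimalPeriod (T.modCover m).next (toMod m x) := by
  obtain ⟨d, n⟩ := x
  rw [cover_next_minimalPeriod]
  apply Function.IsPeriodicPt.minimalPeriod_le
  · exact Function.minimalPeriod_pos_of_mem_periodicPts
      (Function.Injective.mem_periodicPts (T.modCover m).next.injective _)
  · have h := Function.iterate_minimalPeriod (f := (T.modCover m).next) (x := toMod m (d, n))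
    rw [← (T.toMod_next m).iterate_right, cover_next_iterate] at h
    exact congrArg Prod.fst h

theorem toMod_surjective {D : Type*} (m : ℕ) :
    Function.Surjective (toMod m : D × (ℤ × ℤ) → D × (ZMod m × ZMod m)) := by
  rintro ⟨d, r⟩
  obtain ⟨n, rfl⟩ := red_surjective m r
  exact ⟨(d, n), rfl⟩

/-- The function `f` on the darts of the cover is invariant under the deck transformations that
are divisible by `m`. -/
def DartPeriodic {D A : Type*} (m : ℕ) (f : D × (ℤ × ℤ) → A) : Prop :=
  ∀ (d : D) (n k : ℤ × ℤ), f (d, n + (m : ℤ) • k) = f (d, n)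

theorem DartPeriodic.exists_factor {D A : Type*} {m : ℕ} {f : D × (ℤ × ℤ) → A}
    (hf : DartPeriodic m f) :
    ∃ s : D × (ZMod m × ZMod m) → A, ∀ x, s (toMod m x) = f x := by
  choose σ hσ using red_surjective m
  refine ⟨fun y => f (y.1, σ y.2), ?_⟩
  rintro ⟨d, n⟩
  obtain ⟨k, hk⟩ := red_eq_red_iff.1 (hσ (red m n))
  change f (d, σ (red m n)) = _
  conv_rhs => rw [hk, hf]

theorem exists_sign_of_sum_eq_zero {ι : Type*} {s : Finset ι} {f : ι → ℝ}
    (hs : ∑ i ∈ s, f i = 0) (h : ∃ i ∈ s, f i ≠ 0) :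
    (∃ i ∈ s, 0 < f i) ∧ ∃ i ∈ s, f i < 0 := by
  obtain ⟨i, hi, hne⟩ := h
  constructor
  · by_contra! hc
    exact hne ((Finset.sum_eq_zero_iff_of_nonpos hc).1 hs i hi)
  · by_contra! hc
    exact hne ((Finset.sum_eq_zero_iff_of_nonneg hc).1 hs i hi)

/-- Every vertex has a neighbor at which `H` is greater and one at which `H` is less. -/
theorem not_alternates_of_ne_zero {m : ℕ} [NeZero m] {H : T.Vertex → ℤ × ℤ → ℝ}
    (hper : DartPeriodic m (T.dif H)) (hne : ∀ x, T.dif H x ≠ 0)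
    (hres : ∀ d n, (∃ d', T.tail d' = T.tail d ∧ 0 < T.dif H (d', n)) ∧
      ∃ d', T.tail d' = T.tail d ∧ T.dif H (d', n) < 0) :
    ¬ Alternates T.cover.rot (T.dif H) ∧ ¬ Alternates T.cover.next (T.dif H) := by
  classical
  have := Fintype.ofFinite T.Vertex
  have := Fintype.ofFinite T.Face
  obtain ⟨s, hs⟩ := hper.exists_factor
  have hiter : ∀ d n d', T.tail d' = T.tail d → ∃ i, s ((T.modCover m).rot^[i] (toMod m (d, n))) =
      T.dif H (d', n) := by
    intro d n d' h
    obtain ⟨i, -, hi⟩ := exists_iterate_lt_minimalPeriod (T.tail_eq_iff.1 h.symm)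
    exact ⟨i, by rw [← (T.toMod_rot m).iterate_right, cover_rot_iterate, hi, hs]⟩
  have hface : ∀ x, (∃ i, 0 < s ((T.modCover m).next^[i] (toMod m x))) ∧
      ∃ i, s ((T.modCover m).next^[i] (toMod m x)) < 0 := by
    intro x
    have h0 : 0 < Function.minimalPeriod T.cover.next x := by
      rw [← Prod.mk.eta (p := x), cover_next_minimalPeriod]
      exact Function.minimalPeriod_pos_of_mem_periodicPts
        (Function.Injective.mem_periodicPts T.next.injective _)
    obtain ⟨⟨i, -, hi⟩, ⟨j, -, hj⟩⟩ := exists_sign_of_sum_eq_zero (T.sum_dif_face H x)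
      ⟨0, Finset.mem_range.2 h0, hne _⟩
    exact ⟨⟨i, by rwa [← (T.toMod_next m).iterate_right, hs]⟩,
      ⟨j, by rwa [← (T.toMod_next m).iterate_right, hs]⟩⟩
  -- The quotient by deck transformations divisible by `m` still satisfies the Euler count, every
  -- number of cells being multiplied by `m ^ 2`. Its faces are labelled by a face of the torus and
  -- the reduction of `n - off d`.
  have key := (T.modCover m).not_alternates (s := s)
    (a := fun x => (T.tail x.1, x.2)) (b := fun x => (T.left x.1, x.2 - red m (T.off x.1)))
    (fun x => by
      change (T.tail (T.rot x.1), x.2) = _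
      rw [T.tail_rot])
    (fun x => by
      obtain ⟨⟨d, n⟩, rfl⟩ := toMod_surjective m x
      rw [← toMod_next, cover_next]
      simp only [toMod, T.left_next, T.off_next, red_add]
      rw [add_sub_add_right_eq_sub])
    (by
      rintro ⟨v, r⟩
      obtain ⟨d, rfl⟩ := T.tail_surjective v
      exact ⟨(d, r), rfl⟩)
    (by
      rintro ⟨f, r⟩
      obtain ⟨d, rfl⟩ := T.left_surjective f
      exact ⟨(d, r + red m (T.off d)), by simp⟩)
    (by
      simp only [Fintype.card_prod]
      rw [T.card_dart]
      ring)
    (fun x => by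
      obtain ⟨x, rfl⟩ := toMod_surjective m x
      rw [hs]
      exact hne x)
    (fun x => by
      obtain ⟨x, rfl⟩ := toMod_surjective m x
      rw [← toMod_flip, hs, hs, dif_flip])
    (fun x => by
      obtain ⟨⟨d, n⟩, rfl⟩ := toMod_surjective m x
      obtain ⟨d', h1, h2⟩ := (hres d n).1
      obtain ⟨i, hi⟩ := hiter d n d' h1
      exact ⟨i, by rwa [hi]⟩)
    (fun x => by
      obtain ⟨⟨d, n⟩, rfl⟩ := toMod_surjective m x
      obtain ⟨d', h1, h2⟩ := (hres d n).2
      obtain ⟨i, hi⟩ := hiter d n d' h1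
      exact ⟨i, by rwa [hi]⟩)
    (fun x => by
      obtain ⟨x, rfl⟩ := toMod_surjective m x
      exact (hface x).1)
    (fun x => by
      obtain ⟨x, rfl⟩ := toMod_surjective m x
      exact (hface x).2)
  refine ⟨fun h => key.1 ?_, fun h => key.2 ?_⟩
  · obtain ⟨x, i, j, k, hi, hij, hjk, hk, p0, p1, p2, p3⟩ := h
    refine ⟨toMod m x, i, j, k, hi, hij, hjk, hk.trans_le (T.minimalPeriod_rot_le m x), ?_⟩
    simp only [← ((T.toMod_rot m).iterate_right _).eq, hs]
    exact ⟨p0, p1, p2, p3⟩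
  · obtain ⟨x, i, j, k, hi, hij, hjk, hk, p0, p1, p2, p3⟩ := h
    refine ⟨toMod m x, i, j, k, hi, hij, hjk, hk.trans_le (T.minimalPeriod_next_le m x), ?_⟩
    simp only [← ((T.toMod_next m).iterate_right _).eq, hs]
    exact ⟨p0, p1, p2, p3⟩

end MarkedTorus

/-! ### Perturbations, the Dirichlet problem and flat vertices. -/

theorem Alternates.mono {X : Type*} {π : Equiv.Perm X} {s s' : X → ℝ} (h : Alternates π s)
    (h1 : ∀ x, 0 < s x → 0 < s' x) (h2 : ∀ x, s x < 0 → s' x < 0) : Alternates π s' := by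
  obtain ⟨x, i, j, k, hi, hij, hjk, hk, p0, p1, p2, p3⟩ := h
  exact ⟨x, i, j, k, hi, hij, hjk, hk, h1 _ p0, h2 _ p1, h1 _ p2, h2 _ p3⟩

/-- Finitely many strict inequalities survive one common small `ε`. Ties can thus be broken without
disturbing the signs already decided. -/
theorem exists_small_perturbation {X : Type*} [Finite X] (a b : X → ℝ) :
    ∃ ε > 0, ∀ x, (0 < a x → 0 < a x + ε * b x) ∧ (a x < 0 → a x + ε * b x < 0) := by
  have key : ∀ x, ∀ᶠ ε in nhdsWithin (0 : ℝ) (Set.Ioi 0),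
      (0 < a x → 0 < a x + ε * b x) ∧ (a x < 0 → a x + ε * b x < 0) := by
    intro x
    have hc : Filter.Tendsto (fun ε : ℝ => a x + ε * b x) (nhdsWithin 0 (Set.Ioi 0))
        (nhds (a x)) := by
      have : Filter.Tendsto (fun ε : ℝ => a x + ε * b x) (nhds 0) (nhds (a x + 0 * b x)) :=
        (by fun_prop : Continuous fun ε : ℝ => a x + ε * b x).tendsto 0
      rw [zero_mul, add_zero] at this
      exact this.mono_left nhdsWithin_le_nhds
    rcases lt_trichotomy (a x) 0 with h | h | h
    · filter_upwards [hc.eventually (gt_mem_nhds h)] with ε hε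
      exact ⟨fun h' => absurd h h'.not_gt, fun _ => hε⟩
    · exact Filter.Eventually.of_forall fun ε => ⟨fun h' => absurd h h'.ne', fun h' => absurd h h'.ne⟩
    · filter_upwards [hc.eventually (lt_mem_nhds h)] with ε hε
      exact ⟨fun _ => hε, fun h' => absurd h h'.not_gt⟩
  obtain ⟨ε, h1, h2⟩ := ((Filter.eventually_all.2 key).and self_mem_nhdsWithin).exists
  exact ⟨ε, h2, h1⟩

namespace MarkedTorus

variable {D : Type*} [Fintype D] (T : MarkedTorus D)

/-- The function `g` on the vertices of the cover is invariant under the deck transformations that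
are divisible by `m`. -/
def VertexPeriodic {V A : Type*} (m : ℕ) (g : V → ℤ × ℤ → A) : Prop :=
  ∀ (v : V) (n k : ℤ × ℤ), g v (n + (m : ℤ) • k) = g v n

theorem VertexPeriodic.dif {m : ℕ} {g : T.Vertex → ℤ × ℤ → ℝ} (hg : VertexPeriodic m g) :
    DartPeriodic m (T.dif g) := by
  intro d n k
  simp only [MarkedTorus.dif]
  rw [add_right_comm, hg, hg]

theorem VertexPeriodic.exists_factor {V A : Type*} {m : ℕ} {g : V → ℤ × ℤ → A}
    (hg : VertexPeriodic m g) :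
    ∃ p : V × (ZMod m × ZMod m) → A, ∀ v n, p (v, red m n) = g v n := by
  choose σ hσ using red_surjective m
  refine ⟨fun y => g y.1 (σ y.2), fun v n => ?_⟩
  obtain ⟨k, hk⟩ := red_eq_red_iff.1 (hσ (red m n))
  change g v (σ (red m n)) = _
  conv_rhs => rw [hk, hg]

theorem red_add_smul (m : ℕ) (n k : ℤ × ℤ) : red m (n + (m : ℤ) • k) = red m n :=
  (red_eq_red_iff.2 ⟨k, rfl⟩).symm

theorem dif_add_smul (H G : T.Vertex → ℤ × ℤ → ℝ) (ε : ℝ) (x : D × (ℤ × ℤ)) :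
    T.dif (fun v n => H v n + ε * G v n) x = T.dif H x + ε * T.dif G x := by
  simp only [dif]
  ring

theorem dif_neg' (H : T.Vertex → ℤ × ℤ → ℝ) (x : D × (ℤ × ℤ)) :
    T.dif (fun v n => - H v n) x = - T.dif H x := by
  simp only [dif]
  ring

/-- A lexicographic combination of two functions on the vertices of the cover. -/
theorem exists_lex {m : ℕ} [NeZero m] {H G : T.Vertex → ℤ × ℤ → ℝ}
    (hH : DartPeriodic m (T.dif H)) (hG : DartPeriodic m (T.dif G)) :
    ∃ K : T.Vertex → ℤ × ℤ → ℝ, DartPeriodic m (T.dif K) ∧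
      (∀ x, 0 < T.dif H x → 0 < T.dif K x) ∧ (∀ x, T.dif H x < 0 → T.dif K x < 0) ∧
      ∃ ε > 0, ∀ x, T.dif H x = 0 → T.dif K x = ε * T.dif G x := by
  obtain ⟨a, ha⟩ := hH.exists_factor
  obtain ⟨b, hb⟩ := hG.exists_factor
  obtain ⟨ε, hε, h⟩ := exists_small_perturbation a b
  refine ⟨fun v n => H v n + ε * G v n, ?_, ?_, ?_, ε, hε, ?_⟩
  · intro d n k
    rw [dif_add_smul, dif_add_smul, hH, hG]
  · intro x hx
    rw [dif_add_smul, ← ha, ← hb]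
    exact (h _).1 (by rwa [ha])
  · intro x hx
    rw [dif_add_smul, ← ha, ← hb]
    exact (h _).2 (by rwa [ha])
  · intro x hx
    rw [dif_add_smul, hx, zero_add]

open Classical in
/-- The graph Laplacian on the cover. -/
noncomputable def laplacian (g : T.Vertex → ℤ × ℤ → ℝ) (v : T.Vertex) (n : ℤ × ℤ) : ℝ :=
  ∑ d ∈ Finset.univ.filter (fun d => T.tail d = v), T.dif g (d, n)

theorem exists_sign_or_dif_eq_zero {g : T.Vertex → ℤ × ℤ → ℝ} {v : T.Vertex} {n : ℤ × ℤ}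
    (hg : T.laplacian g v n = 0) :
    ((∃ d, T.tail d = v ∧ 0 < T.dif g (d, n)) ∧ ∃ d, T.tail d = v ∧ T.dif g (d, n) < 0) ∨
      ∀ d, T.tail d = v → T.dif g (d, n) = 0 := by
  classical
  by_cases h : ∃ d, T.tail d = v ∧ T.dif g (d, n) ≠ 0
  · left
    obtain ⟨d, hd, hne⟩ := h
    obtain ⟨⟨i, hi, hi'⟩, ⟨j, hj, hj'⟩⟩ := exists_sign_of_sum_eq_zero hg ⟨d, by simp [hd], hne⟩
    exact ⟨⟨i, by simpa using hi, hi'⟩, ⟨j, by simpa using hj, hj'⟩⟩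
  · right
    push Not at h
    exact h

/-- The maximum principle: a maximum above `c` is attained only off `R`, where harmonicity passes it
on to all neighbors; connectedness then carries it into `R`. -/
theorem le_of_harmonic (hconn : T.cover.IsThreeConnected) {m : ℕ} [NeZero m]
    {R : T.Vertex → ℤ × ℤ → Prop} (hR : ∃ v n, R v n) {g : T.Vertex → ℤ × ℤ → ℝ}
    (hg : VertexPeriodic m g) (hharm : ∀ v n, ¬ R v n → T.laplacian g v n = 0) {c : ℝ}
    (hc : ∀ v n, R v n → g v n ≤ c) (v : T.Vertex) (n : ℤ × ℤ) : g v n ≤ c := by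
  obtain ⟨p, hp⟩ := hg.exists_factor
  obtain ⟨v1, n1, h1⟩ := hR
  have : Nonempty (T.Vertex × (ZMod m × ZMod m)) := ⟨(v, 0)⟩
  obtain ⟨x0, hx0⟩ := Finite.exists_max p
  obtain ⟨v0, r0⟩ := x0
  obtain ⟨n0, rfl⟩ := red_surjective m r0
  have hmax : ∀ v n, g v n ≤ g v0 n0 := fun v n => by rw [← hp, ← hp]; exact hx0 _
  by_contra! hcon
  have hM : c < g v0 n0 := hcon.trans_le (hmax v n)
  have := T.mem_of_closed' hconn {w | g w.1 w.2 = g v0 n0} ⟨(v0, n0), rfl⟩ (by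
    intro d n hd
    simp only [Set.mem_ofPred_eq] at hd ⊢
    have hnR : ¬ R (T.tail d) n := fun h => by
      have := hc _ _ h
      linarith
    rcases T.exists_sign_or_dif_eq_zero (hharm _ _ hnR) with ⟨⟨d', hd', h'⟩, -⟩ | h
    · have := hmax (T.head d') (n + T.shift d')
      simp only [dif, hd', hd] at h'
      linarith
    · have := h d rfl
      simp only [dif] at this
      linarith) (v1, n1)
  simp only [Set.mem_ofPred_eq] at this
  have := hc _ _ h1
  linarith

theorem laplacian_neg (g : T.Vertex → ℤ × ℤ → ℝ) (v : T.Vertex) (n : ℤ × ℤ) :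
    T.laplacian (fun v n => - g v n) v n = - T.laplacian g v n := by
  simp only [laplacian, dif_neg', Finset.sum_neg_distrib]

/-- The Dirichlet problem for functions that are periodic modulo `m`. -/
theorem exists_harmonic (hconn : T.cover.IsThreeConnected) {m : ℕ} [NeZero m]
    {R : T.Vertex → ℤ × ℤ → Prop} (hR : ∃ v n, R v n)
    (hRper : ∀ v n k, R v (n + (m : ℤ) • k) ↔ R v n) {b : T.Vertex → ℤ × ℤ → ℝ}
    (hb : VertexPeriodic m b) :
    ∃ g : T.Vertex → ℤ × ℤ → ℝ, VertexPeriodic m g ∧ (∀ v n, R v n → g v n = b v n) ∧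
      ∀ v n, ¬ R v n → T.laplacian g v n = 0 := by
  classical
  obtain ⟨R', hR'⟩ := VertexPeriodic.exists_factor (m := m) (g := R)
    (fun v n k => propext (hRper v n k))
  obtain ⟨b', hb'⟩ := hb.exists_factor
  let X := T.Vertex × (ZMod m × ZMod m)
  let Φ : (X → ℝ) →ₗ[ℝ] (X → ℝ) :=
    { toFun := fun p x => if R' x then p x else
        ∑ d ∈ Finset.univ.filter (fun d => T.tail d = x.1),
          (p (T.head d, x.2 + red m (T.shift d)) - p (T.tail d, x.2))
      map_add' := fun p q => by
        ext x
        simp only [Pi.add_apply]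
        split_ifs
        · rfl
        · rw [← Finset.sum_add_distrib]
          exact Finset.sum_congr rfl fun d _ => by ring
      map_smul' := fun c p => by
        ext x
        simp only [Pi.smul_apply, smul_eq_mul, RingHom.id_apply]
        split_ifs
        · rfl
        · rw [Finset.mul_sum]
          exact Finset.sum_congr rfl fun d _ => by ring }
  have hΦ : ∀ (p : X → ℝ) v n, Φ p (v, red m n) = if R v n then p (v, red m n) else
      T.laplacian (fun v n => p (v, red m n)) v n := by
    intro p v n
    change (if R' (v, red m n) then _ else _) = _
    simp only [hR']
    congr 1
    simp only [laplacian, dif, red_add]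
  have hper : ∀ p : X → ℝ, VertexPeriodic m (fun v n => p (v, red m n)) := by
    intro p v n k
    simp only [red_add_smul]
  -- Uniqueness follows from the maximum principle, and in finite dimension it gives existence.
  have hinj : Function.Injective Φ := by
    rw [← LinearMap.ker_eq_bot, LinearMap.ker_eq_bot']
    intro p hp
    have h1 : ∀ v n, R v n → p (v, red m n) = 0 := by
      intro v n h
      have := congrFun hp (v, red m n)
      rwa [hΦ, if_pos h] at this
    have h2 : ∀ v n, ¬ R v n → T.laplacian (fun v n => p (v, red m n)) v n = 0 := by
      intro v n h
      have := congrFun hp (v, red m n)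
      rwa [hΦ, if_neg h] at this
    ext ⟨v, r⟩
    obtain ⟨n, rfl⟩ := red_surjective m r
    have h3 := T.le_of_harmonic hconn hR (hper p) h2 (c := 0) (fun v n h => (h1 v n h).le) v n
    have h4 := T.le_of_harmonic hconn hR (g := fun v n => - p (v, red m n)) (m := m)
      (fun v n k => by simp only [red_add_smul])
      (fun v n h => by rw [laplacian_neg T (fun v n => p (v, red m n)), h2 v n h, neg_zero])
      (c := 0) (fun v n h => by rw [h1 v n h, neg_zero]) v n
    simp only [Pi.zero_apply]
    linarith
  obtain ⟨p, hp⟩ := (LinearMap.injective_iff_surjective.1 hinj)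
    (fun x => if R' x then b' x else 0)
  refine ⟨fun v n => p (v, red m n), hper p, ?_, ?_⟩
  · intro v n h
    have h1 := hΦ p v n
    rw [hp, if_pos h] at h1
    simp only [hR', if_pos h, hb'] at h1
    exact h1.symm
  · intro v n h
    have h1 := hΦ p v n
    rw [hp, if_neg h] at h1
    simp only [hR', if_neg h] at h1
    exact h1.symm

/-- Every neighbor of the vertex has the same value of `H`. -/
def Flat {A : Type*} [AddGroup A] (H : T.Vertex → ℤ × ℤ → A) (v : T.Vertex) (n : ℤ × ℤ) : Prop :=
  ∀ d, T.tail d = v → T.dif H (d, n) = 0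

/-- Some neighbor of the vertex has a greater value of `H`, and some has a smaller one. -/
def Saddle (H : T.Vertex → ℤ × ℤ → ℝ) (v : T.Vertex) (n : ℤ × ℤ) : Prop :=
  (∃ d, T.tail d = v ∧ 0 < T.dif H (d, n)) ∧ ∃ d, T.tail d = v ∧ T.dif H (d, n) < 0

theorem flat_periodic {A : Type*} [AddGroup A] {m : ℕ} {H : T.Vertex → ℤ × ℤ → A}
    (hH : DartPeriodic m (T.dif H)) (v : T.Vertex) (n k : ℤ × ℤ) :
    T.Flat H v (n + (m : ℤ) • k) ↔ T.Flat H v n := by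
  simp only [Flat, hH _ _ _]

theorem smul_ne_zero' {m : ℕ} [NeZero m] {k : ℤ × ℤ} (hk : k ≠ 0) : (m : ℤ) • k ≠ 0 :=
  smul_ne_zero (by exact_mod_cast NeZero.ne m) hk

/-- By connectedness a function that is flat everywhere is constant, which a nonzero period rules
out. -/
theorem exists_not_flat (hconn : T.cover.IsThreeConnected) {A : Type*} [AddCommGroup A]
    {H : T.Vertex → ℤ × ℤ → A} {ω : ℤ × ℤ → A}
    (hH : ∀ v n k, H v (n + k) = H v n + ω k) (hω : ∃ k, ω k ≠ 0) : ∃ v n, ¬ T.Flat H v n := by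
  by_contra! hc
  obtain ⟨d⟩ := T.nonempty_dart
  obtain ⟨k, hk⟩ := hω
  have := T.mem_of_closed' hconn {w | H w.1 w.2 = H (T.tail d) 0} ⟨(T.tail d, 0), rfl⟩ (by
    intro d n hd
    simp only [Set.mem_ofPred_eq] at hd ⊢
    rw [← hd, ← sub_eq_zero]
    exact hc _ n d rfl) (T.tail d, 0 + k)
  simp only [Set.mem_ofPred_eq, hH] at this
  exact hk (by simpa using this)

/-- The vertices that are joined to a vertex by a path of flat vertices. -/
def FlatReach {A : Type*} [AddGroup A] (H : T.Vertex → ℤ × ℤ → A) (w w' : T.Vertex × (ℤ × ℤ)) :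
    Prop :=
  Relation.ReflTransGen (fun a b => (∃ d, T.tail d = a.1 ∧ T.head d = b.1 ∧
    a.2 + T.shift d = b.2) ∧ T.Flat H b.1 b.2) w w'

theorem FlatReach.flat {A : Type*} [AddGroup A] {H : T.Vertex → ℤ × ℤ → A}
    {w w' : T.Vertex × (ℤ × ℤ)} (h : T.FlatReach H w w') (hw : T.Flat H w.1 w.2) :
    T.Flat H w'.1 w'.2 := by
  induction h with
  | refl => exact hw
  | tail _ h _ => exact h.2

/-- A function that is constant around the vertices of a flat component is constant on it. -/
theorem FlatReach.eq {A B : Type*} [AddGroup A] [AddGroup B] {H : T.Vertex → ℤ × ℤ → A}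
    {g : T.Vertex → ℤ × ℤ → B} {w w' : T.Vertex × (ℤ × ℤ)} (h : T.FlatReach H w w')
    (hg : ∀ a, T.FlatReach H w a → g a.1 a.2 = g w.1 w.2 → T.Flat g a.1 a.2) :
    g w'.1 w'.2 = g w.1 w.2 := by
  induction h with
  | refl => rfl
  | @tail a b hab h ih =>
    obtain ⟨⟨d, h1, h2, h3⟩, -⟩ := h
    rw [← ih, ← sub_eq_zero]
    have := hg a hab ih d h1
    rwa [dif, h2, h3, h1] at this

/-- A flat component has a neighbor different from two given vertices that are not flat. -/
theorem exists_boundary (hconn : T.cover.IsThreeConnected) {m : ℕ} [NeZero m] {A : Type*}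
    [AddGroup A] {H : T.Vertex → ℤ × ℤ → A} (hper : DartPeriodic m (T.dif H))
    {w p q : T.Vertex × (ℤ × ℤ)} (hw : T.Flat H w.1 w.2) (hp : ¬ T.Flat H p.1 p.2)
    (hq : ¬ T.Flat H q.1 q.2) : ∃ d n, T.FlatReach H w (T.tail d, n) ∧
      ¬ T.Flat H (T.head d) (n + T.shift d) ∧ (T.head d, n + T.shift d) ≠ p ∧
        (T.head d, n + T.shift d) ≠ q := by
  by_contra! hc
  -- If `p` and `q` were the only non-flat neighbors of the component, deleting them would leave the
  -- component closed under adjacency, hence everything else flat.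
  have key : ∀ r : T.Vertex × (ℤ × ℤ), ¬ T.Flat H r.1 r.2 → r = p ∨ r = q := by
    intro r hr
    by_contra! hrpq
    have := T.mem_of_closed hconn p q {a | T.FlatReach H w a}
      ⟨w, Relation.ReflTransGen.refl, fun h => hp (h ▸ hw), fun h => hq (h ▸ hw)⟩ (by
        intro d n h1 _ _ h2 h3
        refine Relation.ReflTransGen.tail h1 ⟨⟨d, rfl, rfl, rfl⟩, ?_⟩
        by_contra h4
        exact h3 (hc d n h1 h4 h2)) r hrpq.1 hrpq.2
    exact hr (FlatReach.flat T this hw)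
  -- But `p` has infinitely many non-flat translates.
  have hx : ∀ k : ℤ × ℤ, (p.1, p.2 + (m : ℤ) • k) = p ∨ (p.1, p.2 + (m : ℤ) • k) = q :=
    fun k => key _ (by
      have := T.flat_periodic hper p.1 p.2 k
      exact fun h => hp (this.1 h))
  have hm : (m : ℤ) ≠ 0 := by exact_mod_cast NeZero.ne m
  have h1 : ∀ k : ℤ × ℤ, k ≠ 0 → (p.1, p.2 + (m : ℤ) • k) = q := by
    intro k hk
    refine (hx k).resolve_left fun h => smul_ne_zero' (m := m) hk ?_
    simpa using congrArg Prod.snd h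
  have h2 := congrArg (fun x => x.2.1) ((h1 (1, 0) (by simp)).trans (h1 (2, 0) (by simp)).symm)
  simp only [Prod.smul_mk, Prod.fst_add, add_right_inj, smul_eq_mul, mul_one] at h2
  omega

theorem Saddle.mono {H K : T.Vertex → ℤ × ℤ → ℝ} {v : T.Vertex} {n : ℤ × ℤ} (h : T.Saddle H v n)
    (h1 : ∀ x, 0 < T.dif H x → 0 < T.dif K x) (h2 : ∀ x, T.dif H x < 0 → T.dif K x < 0) :
    T.Saddle K v n := by
  obtain ⟨⟨d1, e1, f1⟩, ⟨d2, e2, f2⟩⟩ := h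
  exact ⟨⟨d1, e1, h1 _ f1⟩, ⟨d2, e2, h2 _ f2⟩⟩

/-- A small perturbation keeps saddles and can only resolve flat vertices, so `G` has to be well
behaved only where `H` is flat. Harmonic extensions of arbitrary values on the non-flat vertices are
therefore admissible perturbations. -/
theorem exists_lex_saddle {m : ℕ} [NeZero m] {H G : T.Vertex → ℤ × ℤ → ℝ}
    (hH : DartPeriodic m (T.dif H)) (hG : DartPeriodic m (T.dif G))
    (hres : ∀ v n, T.Saddle H v n ∨ T.Flat H v n)
    (hres' : ∀ v n, T.Flat H v n → T.Saddle G v n ∨ T.Flat G v n) :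
    ∃ K : T.Vertex → ℤ × ℤ → ℝ, DartPeriodic m (T.dif K) ∧
      (∀ v n, T.Saddle K v n ∨ T.Flat K v n) ∧
      (∀ x, 0 < T.dif H x → 0 < T.dif K x) ∧ (∀ x, T.dif H x < 0 → T.dif K x < 0) ∧
      (∀ x, T.dif K x = 0 → T.dif H x = 0) ∧
      ∃ ε > 0, ∀ x, T.dif H x = 0 → T.dif K x = ε * T.dif G x := by
  obtain ⟨K, hK, hKpos, hKneg, ε, hε, hK0⟩ := T.exists_lex hH hG
  refine ⟨K, hK, ?_, hKpos, hKneg, ?_, ε, hε, hK0⟩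
  · intro v n
    rcases hres v n with h | h
    · exact Or.inl (h.mono T hKpos hKneg)
    · rcases hres' v n h with ⟨⟨d1, e1, f1⟩, ⟨d2, e2, f2⟩⟩ | h0
      · refine Or.inl ⟨⟨d1, e1, ?_⟩, ⟨d2, e2, ?_⟩⟩
        · rw [hK0 _ (h d1 e1)]
          exact mul_pos hε f1
        · rw [hK0 _ (h d2 e2)]
          exact mul_neg_of_pos_of_neg hε f2
      · refine Or.inr fun d hd => ?_
        rw [hK0 _ (h d hd), h0 d hd, mul_zero]
  · intro x hx
    rcases lt_trichotomy (T.dif H x) 0 with h | h | h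
    · exact absurd hx (hKneg x h).ne
    · exact h
    · exact absurd hx (hKpos x h).ne'

/-- The index theorem for functions all of whose vertices are saddles or flat, provided that the
flat parts are collapsed by a map of the torus. -/
theorem not_alternates_of_saddle_or_flat (hsimple : T.cover.IsSimple)
    (hconn : T.cover.IsThreeConnected) {h : T.Vertex → ℤ × ℤ → ℂ} {ω : ℤ × ℤ → ℂ}
    (hh : ∀ v n k, h v (n + k) = h v n + ω k) (hω : ∀ k, ω k = 0 → k = 0) {m : ℕ} [NeZero m]
    {H : T.Vertex → ℤ × ℤ → ℝ} (hper : DartPeriodic m (T.dif H))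
    (hres : ∀ v n, T.Saddle H v n ∨ T.Flat H v n) (hzero : ∀ x, T.dif H x = 0 → T.dif h x = 0) :
    ¬ Alternates T.cover.rot (T.dif H) ∧ ¬ Alternates T.cover.next (T.dif H) := by
  classical
  -- Induction on the number of flat vertices modulo `m`: each step resolves at least one by a
  -- perturbation that preserves alternations.
  induction hN : Set.ncard {y : T.Vertex × (ZMod m × ZMod m) |
    ∃ n, red m n = y.2 ∧ T.Flat H y.1 n} using Nat.strong_induction_on generalizing H with
  | _ N ih =>
  by_cases hflat : ∃ w : T.Vertex × (ℤ × ℤ), T.Flat H w.1 w.2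
  · obtain ⟨w, hw⟩ := hflat
    obtain ⟨v1, n1, h1⟩ : ∃ v n, ¬ T.Flat H v n := by
      by_contra! hc
      obtain ⟨v, n, hv⟩ := T.exists_not_flat hconn hh
        ⟨(1, 0), fun h => by simpa using congrArg Prod.fst (hω _ h)⟩
      exact hv fun d hd => hzero _ (hc v n d hd)
    obtain ⟨d, n, hd, hdf, -, -⟩ := T.exists_boundary hconn hper (p := (v1, n1)) (q := (v1, n1))
      hw h1 h1
    set q : T.Vertex × (ℤ × ℤ) := (T.head d, n + T.shift d) with hq
    obtain ⟨d', n', hd', hdf', hne, -⟩ := T.exists_boundary hconn hper (p := q) (q := q)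
      hw hdf hdf
    set q' : T.Vertex × (ℤ × ℤ) := (T.head d', n' + T.shift d') with hq'
    have hconst : ∀ e k, T.FlatReach H w (T.tail e, k) →
        h (T.head e) (k + T.shift e) = h w.1 w.2 := by
      intro e k hek
      have h2 : h (T.tail e) k = h w.1 w.2 := hek.eq T (g := h) fun a ha _ d hd =>
        hzero _ (FlatReach.flat T ha hw d hd)
      rw [← h2, ← sub_eq_zero]
      exact hzero _ (FlatReach.flat T hek hw e rfl)
    have hb : VertexPeriodic m (fun (v : T.Vertex) (n : ℤ × ℤ) =>
        if (v, red m n) = (q.1, red m q.2) then (1 : ℝ) else 0) := by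
      intro v n k
      simp only [red_add_smul]
    -- The boundary values are one on the class of `q` and zero on the other non-flat classes. If
    -- `g` resolved no flat vertex, it would be constant on the component and its neighbors `q`,
    -- `q'`, so `q'` would be congruent to `q`. Since `h` has the same value at both, injectivity of
    -- the periods would give `q' = q`.
    obtain ⟨g, hg, hgR, hgharm⟩ := T.exists_harmonic hconn (m := m)
      (R := fun v n => ¬ T.Flat H v n) ⟨v1, n1, h1⟩
      (fun v n k => not_congr (T.flat_periodic hper v n k)) hb
    obtain ⟨K, hK, hresK, hKpos, hKneg, hKH, ε, hε, hK0⟩ := T.exists_lex_saddle hper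
      (VertexPeriodic.dif T hg) hres
      (fun v n hvn => T.exists_sign_or_dif_eq_zero (hgharm v n (not_not.2 hvn)))
    have hsub : ∀ v n, T.Flat K v n → T.Flat H v n := fun v n hvn d hd => hKH _ (hvn d hd)
    have hlt : Set.ncard {y : T.Vertex × (ZMod m × ZMod m) |
        ∃ n, red m n = y.2 ∧ T.Flat K y.1 n} < N := by
      rw [← hN]
      apply Set.ncard_lt_ncard _ (Set.toFinite _)
      refine ⟨fun y ⟨n, h1, h2⟩ => ⟨n, h1, hsub _ _ h2⟩, fun hcon => ?_⟩
      have hall : ∀ v n, T.Flat H v n → T.Flat K v n := by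
        intro v n hvn
        obtain ⟨n', h1, h2⟩ := hcon (a := (v, red m n)) ⟨n, rfl, hvn⟩
        obtain ⟨k, rfl⟩ := red_eq_red_iff.1 h1
        exact (T.flat_periodic hK v n' k).2 h2
      have hgflat : ∀ a, T.FlatReach H w a → T.Flat g a.1 a.2 := by
        intro a ha d hd
        have h2 := FlatReach.flat T ha hw
        have h3 := hall _ _ h2 d hd
        rw [hK0 _ (h2 d hd)] at h3
        exact (mul_eq_zero.1 h3).resolve_left hε.ne'
      have hgconst : ∀ e k, T.FlatReach H w (T.tail e, k) →
          g (T.head e) (k + T.shift e) = g w.1 w.2 := by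
        intro e k hek
        have h2 : g (T.tail e) k = g w.1 w.2 := hek.eq T (g := g) fun a ha _ => hgflat a ha
        rw [← h2, ← sub_eq_zero]
        exact hgflat _ hek e rfl
      have e1 := hgconst d n hd
      have e2 := hgconst d' n' hd'
      rw [hgR _ _ hdf, if_pos rfl] at e1
      rw [hgR _ _ hdf', ← e1] at e2
      split_ifs at e2 with h3
      · simp only [Prod.mk.injEq] at h3
        obtain ⟨k, hk⟩ := red_eq_red_iff.1 h3.2.symm
        apply hne
        have h4 : h q.1 q.2 = h q'.1 q'.2 := (hconst d n hd).trans (hconst d' n' hd').symm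
        have h6 : h q'.1 q'.2 = h q.1 q.2 + ω ((m : ℤ) • k) := by
          rw [← hh, ← hk, ← h3.1]
        rw [h6] at h4
        have h5 := hω _ (left_eq_add.1 h4)
        rw [h5, add_zero] at hk
        exact Prod.ext h3.1 hk
      · norm_num at e2
    obtain ⟨k1, k2⟩ := ih _ hlt hK hresK (fun x hx => hzero x (hKH x hx)) rfl
    exact ⟨fun hA => k1 (hA.mono hKpos hKneg), fun hA => k2 (hA.mono hKpos hKneg)⟩
  · push Not at hflat
    -- Only zero edges are left to break, and an injective labelling of the vertices modulo `m` does
    -- so. The ends of a zero edge carry different labels: `h` collapses the edge, so congruent ends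
    -- would coincide and form a loop.
    let ι : T.Vertex × (ZMod m × ZMod m) → ℝ := fun x => ((Finite.equivFin _ x : ℕ) : ℝ)
    have hι : Function.Injective ι := fun x y hxy =>
      (Finite.equivFin _).injective (Fin.ext (Nat.cast_injective hxy))
    have hG : VertexPeriodic m (fun (v : T.Vertex) (n : ℤ × ℤ) => ι (v, red m n)) := by
      intro v n k
      simp only [red_add_smul]
    obtain ⟨K, hK, hKpos, hKneg, ε, hε, hK0⟩ := T.exists_lex hper (VertexPeriodic.dif T hG)
    have hne : ∀ x, T.dif K x ≠ 0 := by
      rintro ⟨d, n⟩ hx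
      rcases lt_trichotomy (T.dif H (d, n)) 0 with h0 | h0 | h0
      · exact (hKneg _ h0).ne hx
      · rw [hK0 _ h0, mul_eq_zero] at hx
        have h1 := hx.resolve_left hε.ne'
        rw [dif, sub_eq_zero] at h1
        have h2 := hι h1
        rw [Prod.mk.injEq] at h2
        obtain ⟨k, hk⟩ := red_eq_red_iff.1 h2.2
        have h3 := hzero _ h0
        simp only [dif, h2.1, hh, add_sub_cancel_left] at h3
        exact T.no_loop hsimple d ⟨h2.1.symm, hω _ h3⟩
      · exact (hKpos _ h0).ne' hx
    obtain ⟨k1, k2⟩ := T.not_alternates_of_ne_zero hK hne (fun d n =>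
      ((hres (T.tail d) n).resolve_right (hflat (_, n))).mono T hKpos hKneg)
    exact ⟨fun hA => k1 (hA.mono hKpos hKneg), fun hA => k2 (hA.mono hKpos hKneg)⟩

end MarkedTorus

/-! ### Components of harmonic maps have no flat vertices. -/

theorem exists_lt_succ {f : ℕ → ℝ} {i j : ℕ} (hij : i ≤ j) (h : f i < f j) :
    ∃ t, i ≤ t ∧ t < j ∧ f t < f (t + 1) := by
  obtain ⟨t, h1, h2, h3, h4⟩ := exists_sign_change (P := fun t => f t ≤ f i) hij le_rfl (not_le.2 h)
  exact ⟨t, h1, h2, h3.trans_lt (not_le.1 h4)⟩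

/-- The component of a plane vector in the direction `e`. -/
def cdot (e z : ℂ) : ℝ := ((starRingEnd ℂ) e * z).re

theorem cdot_neg_left (e z : ℂ) : cdot (-e) z = - cdot e z := by
  simp [cdot]

theorem cdot_sub (e z w : ℂ) : cdot e (z - w) = cdot e z - cdot e w := by
  simp only [cdot, mul_sub, Complex.sub_re]

theorem cdot_add (e z w : ℂ) : cdot e (z + w) = cdot e z + cdot e w := by
  simp only [cdot, mul_add, Complex.add_re]

theorem cdot_real_mul (e z : ℂ) (r : ℝ) : cdot e ((r : ℂ) * z) = r * cdot e z := by
  simp only [cdot, Complex.mul_re, Complex.conj_re, Complex.conj_im, Complex.mul_im,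
    Complex.ofReal_re, Complex.ofReal_im]
  ring

theorem cdot_sum {ι : Type*} (s : Finset ι) (e : ℂ) (f : ι → ℂ) :
    cdot e (∑ i ∈ s, f i) = ∑ i ∈ s, cdot e (f i) := by
  simp only [cdot, Finset.mul_sum, Complex.re_sum]

theorem cdot_zero (e : ℂ) : cdot e 0 = 0 := by simp [cdot]

theorem eq_zero_of_cdot {e z : ℂ} (he : e ≠ 0) (h1 : cdot e z = 0)
    (h2 : cdot (Complex.I * e) z = 0) : z = 0 := by
  have h : (starRingEnd ℂ) e * z = 0 := by
    apply Complex.ext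
    · exact h1
    · simp [cdot] at h2 ⊢
      linarith
  rcases mul_eq_zero.1 h with h | h
  · exact absurd ((map_eq_zero _).1 h) he
  · exact h

namespace MarkedTorus

variable {D : Type*} [Fintype D] (T : MarkedTorus D)

theorem red_injective_of_lt {m : ℕ} {n n' : ℤ × ℤ}
    (h : (n.1 - n'.1).natAbs + (n.2 - n'.2).natAbs < m) (hr : red m n = red m n') : n = n' := by
  obtain ⟨k, rfl⟩ := red_eq_red_iff.1 hr
  simp only [Prod.fst_add, Prod.snd_add, sub_add_cancel_left, smul_eq_mul,
    Int.natAbs_neg, Prod.smul_fst, Prod.smul_snd, Int.natAbs_mul, Int.natAbs_natCast] at h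
  have h1 : k.1.natAbs = 0 := by
    by_contra h0
    have := Nat.le_mul_of_pos_right m (Nat.pos_of_ne_zero h0)
    omega
  have h2 : k.2.natAbs = 0 := by
    by_contra h0
    have := Nat.le_mul_of_pos_right m (Nat.pos_of_ne_zero h0)
    omega
  have : k = 0 := Prod.ext (Int.natAbs_eq_zero.1 h1) (Int.natAbs_eq_zero.1 h2)
  rw [this, smul_zero, add_zero]

/-- The component in the direction `e` of a map to the plane. -/
def comp (e : ℂ) (h : T.Vertex → ℤ × ℤ → ℂ) (v : T.Vertex) (n : ℤ × ℤ) : ℝ := cdot e (h v n)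

theorem dif_comp (e : ℂ) (h : T.Vertex → ℤ × ℤ → ℂ) (x : D × (ℤ × ℤ)) :
    T.dif (T.comp e h) x = cdot e (T.dif h x) := by
  simp only [dif, comp, cdot_sub]

theorem dif_eq_of_lift {h : T.Vertex → ℤ × ℤ → ℂ} {ω : ℤ × ℤ → ℂ}
    (hh : ∀ v n k, h v (n + k) = h v n + ω k) (d : D) (n k : ℤ × ℤ) :
    T.dif h (d, n + k) = T.dif h (d, n) := by
  simp only [dif]
  rw [add_right_comm, hh _ (n + T.shift d) k, hh _ n k]
  ring

theorem dartPeriodic_comp {h : T.Vertex → ℤ × ℤ → ℂ} {ω : ℤ × ℤ → ℂ}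
    (hh : ∀ v n k, h v (n + k) = h v n + ω k) (m : ℕ) (e : ℂ) :
    DartPeriodic m (T.dif (T.comp e h)) := by
  intro d n k
  rw [dif_comp, dif_comp, T.dif_eq_of_lift hh]

open Classical in
/-- The map `h` is harmonic for the weights `c`. -/
def Harmonic (c : D → ℝ) (h : T.Vertex → ℤ × ℤ → ℂ) : Prop :=
  ∀ v n, ∑ d ∈ Finset.univ.filter (fun d => T.tail d = v), (c d : ℂ) * T.dif h (d, n) = 0

variable {T} in
theorem Harmonic.saddle_or_flat {c : D → ℝ} (hc : ∀ d, 0 < c d) {h : T.Vertex → ℤ × ℤ → ℂ}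
    (hharm : T.Harmonic c h) (e : ℂ) (v : T.Vertex) (n : ℤ × ℤ) :
    T.Saddle (T.comp e h) v n ∨ T.Flat (T.comp e h) v n := by
  classical
  have h1 := congrArg (cdot e) (hharm v n)
  rw [cdot_sum, cdot_zero] at h1
  simp only [cdot_real_mul, ← dif_comp] at h1
  by_cases h2 : T.Flat (T.comp e h) v n
  · exact Or.inr h2
  · left
    rw [Flat] at h2
    push Not at h2
    obtain ⟨d, hd, hne⟩ := h2
    obtain ⟨⟨i, hi, hi'⟩, ⟨j, hj, hj'⟩⟩ := exists_sign_of_sum_eq_zero h1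
      ⟨d, by simp [hd], mul_ne_zero (hc d).ne' hne⟩
    exact ⟨⟨i, by simpa using hi, (mul_pos_iff_of_pos_left (hc i)).1 hi'⟩,
      ⟨j, by simpa using hj, by
        by_contra h3
        exact hj'.not_ge (mul_nonneg (hc j).le (not_lt.1 h3))⟩⟩

theorem flat_comp_neg {e : ℂ} {h : T.Vertex → ℤ × ℤ → ℂ} {v : T.Vertex} {n : ℤ × ℤ} :
    T.Flat (T.comp (-e) h) v n ↔ T.Flat (T.comp e h) v n := by
  simp only [Flat, dif_comp, cdot_neg_left, neg_eq_zero]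

/-- A harmonic function that is maximal at two given vertices and not at a given flat vertex. -/
theorem exists_barrier (hconn : T.cover.IsThreeConnected) {H : T.Vertex → ℤ × ℤ → ℝ}
    (hper : ∀ m, DartPeriodic m (T.dif H)) {w a a' : T.Vertex × (ℤ × ℤ)}
    (hw : T.Flat H w.1 w.2) (ha : ¬ T.Flat H a.1 a.2) (ha' : ¬ T.Flat H a'.1 a'.2) :
    ∃ m : ℕ, m ≠ 0 ∧ (a.1 = a'.1 → red m a.2 = red m a'.2 → a = a') ∧
      ∃ p : T.Vertex → ℤ × ℤ → ℝ, VertexPeriodic m p ∧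
        (∀ v n, T.Flat H v n → T.laplacian p v n = 0) ∧
        p a.1 a.2 = 1 ∧ p a'.1 a'.2 = 1 ∧ p w.1 w.2 < 1 := by
  classical
  obtain ⟨d, n, hd, hdf, hda, hda'⟩ := T.exists_boundary hconn (hper 1) hw ha ha'
  -- The modulus is taken so large that `a`, `a'` and a third boundary vertex of the component of
  -- `w` are not identified by the reduction.
  obtain ⟨m, hm1, hm2, hm3⟩ : ∃ m : ℕ,
      (a.2.1 - a'.2.1).natAbs + (a.2.2 - a'.2.2).natAbs < m ∧
      ((n + T.shift d).1 - a.2.1).natAbs + ((n + T.shift d).2 - a.2.2).natAbs < m ∧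
      ((n + T.shift d).1 - a'.2.1).natAbs + ((n + T.shift d).2 - a'.2.2).natAbs < m :=
    ⟨_, Nat.lt_succ_of_le (le_max_left _ (max _ _)),
      Nat.lt_succ_of_le ((le_max_left _ _).trans (le_max_right _ _)),
      Nat.lt_succ_of_le ((le_max_right _ _).trans (le_max_right _ _))⟩
  have : NeZero m := ⟨by omega⟩
  refine ⟨m, NeZero.ne m, fun h1 h2 => Prod.ext h1 (red_injective_of_lt hm1 h2), ?_⟩
  obtain ⟨p, hp, hpR, hpharm⟩ := T.exists_harmonic hconn (m := m) (R := fun v n => ¬ T.Flat H v n)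
    ⟨_, _, ha⟩ (fun v n k => not_congr (T.flat_periodic (hper m) v n k))
    (b := fun v n => if (v, red m n) = (a.1, red m a.2) ∨ (v, red m n) = (a'.1, red m a'.2)
      then 1 else 0) (by
      intro v n k
      simp only [red_add_smul])
  have hpharm' : ∀ v n, T.Flat H v n → T.laplacian p v n = 0 := fun v n h =>
    hpharm v n (not_not.2 h)
  have hle : ∀ v n, p v n ≤ 1 := T.le_of_harmonic hconn ⟨_, _, ha⟩ hp hpharm fun v n h => by
    rw [hpR v n h]
    split_ifs <;> norm_num
  refine ⟨p, hp, hpharm', ?_, ?_, ?_⟩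
  · rw [hpR _ _ ha, if_pos (Or.inl rfl)]
  · rw [hpR _ _ ha', if_pos (Or.inr rfl)]
  -- The maximal value one at `w` would spread over the flat component to the third boundary vertex,
  -- where `p` vanishes.
  · refine lt_of_le_of_ne (hle _ _) fun h1 => ?_
    have hflat : ∀ b, T.FlatReach H w b → p b.1 b.2 = p w.1 w.2 → T.Flat p b.1 b.2 := by
      intro b hb hb1
      rcases T.exists_sign_or_dif_eq_zero (hpharm' _ _ (FlatReach.flat T hb hw)) with
        ⟨⟨d', e1, e2⟩, -⟩ | h2
      · have := hle (T.head d') (b.2 + T.shift d')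
        simp only [dif, e1, hb1, h1] at e2
        linarith
      · exact h2
    have h2 : p (T.tail d) n = p w.1 w.2 := hd.eq T (g := p) hflat
    have h3 := hflat _ hd h2 d rfl
    rw [dif, sub_eq_zero] at h3
    simp only [h2, h1] at h3
    rw [hpR _ _ hdf] at h3
    split_ifs at h3 with h4
    · simp only [Prod.mk.injEq] at h4
      rcases h4 with h4 | h4
      · exact hda (Prod.ext h4.1 (red_injective_of_lt hm2 h4.2))
      · exact hda' (Prod.ext h4.1 (red_injective_of_lt hm3 h4.2))
    · norm_num at h3

/-- A vertex of the boundary of a face. -/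
theorem dif_next_iterate {A : Type*} [AddGroup A] (H : T.Vertex → ℤ × ℤ → A) (x : D × (ℤ × ℤ))
    (i : ℕ) : T.dif H (T.cover.next^[i] x) =
      H (T.tail (T.cover.next^[i + 1] x).1) (T.cover.next^[i + 1] x).2 -
        H (T.tail (T.cover.next^[i] x).1) (T.cover.next^[i] x).2 := by
  rw [Function.iterate_succ_apply']
  obtain ⟨d, n⟩ := T.cover.next^[i] x
  rw [cover_next]
  simp only [dif, CombinatorialMap.tail_next]

theorem minimalPeriod_next_pos (x : D × (ℤ × ℤ)) : 0 < Function.minimalPeriod T.cover.next x := by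
  rw [← Prod.mk.eta (p := x), cover_next_minimalPeriod]
  exact Function.minimalPeriod_pos_of_mem_periodicPts
    (Function.Injective.mem_periodicPts T.next.injective _)

theorem iterate_pred_minimalPeriod (x : D × (ℤ × ℤ)) :
    T.cover.next^[Function.minimalPeriod T.cover.next x - 1] x = T.cover.flip (T.cover.rot x) := by
  apply T.cover.next.injective
  rw [T.cover.next_flip_rot, ← Function.iterate_succ_apply' T.cover.next]
  have := T.minimalPeriod_next_pos x
  rw [Nat.succ_eq_add_one, Nat.sub_add_cancel this, Function.iterate_minimalPeriod]

section Collapse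

variable {h : T.Vertex → ℤ × ℤ → ℂ} {ω : ℤ × ℤ → ℂ} {c : D → ℝ}

/-- If the head were flat, follow the face on the left of `z` to the next non-flat vertex `w l`;
this stretch is level. A barrier `p` equal to one at both ends of the stretch and smaller at the
head of `z`, subtracted from the component, makes the face rise along `z` and fall later on the
stretch. Beyond it the face must rise to the head of `rot z` and fall along its last side `flip (rot
z)`. This is the forbidden pattern `+ - + -`. -/
theorem head_not_flat_of_pos (hsimple : T.cover.IsSimple)
    (hconn : T.cover.IsThreeConnected) (hh : ∀ v n k, h v (n + k) = h v n + ω k)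
    (hω : ∀ k, ω k = 0 → k = 0) (hc : ∀ d, 0 < c d) (hharm : T.Harmonic c h) {e : ℂ} (he : e ≠ 0)
    {z : D} {n : ℤ × ℤ} (hz : T.dif (T.comp e h) (z, n) = 0)
    (hz' : 0 < T.dif (T.comp e h) (T.rot z, n)) :
    ¬ T.Flat (T.comp e h) (T.head z) (n + T.shift z) := by
  intro hx
  set u := T.comp e h with hu
  set N := Function.minimalPeriod T.cover.next (z, n) with hN
  have hNpos : 0 < N := T.minimalPeriod_next_pos _
  set w : ℕ → T.Vertex × (ℤ × ℤ) := fun i =>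
    (T.tail (T.cover.next^[i] (z, n)).1, (T.cover.next^[i] (z, n)).2) with hw
  have hdif : ∀ (H : T.Vertex → ℤ × ℤ → ℝ) i, T.dif H (T.cover.next^[i] (z, n)) =
      H (w (i + 1)).1 (w (i + 1)).2 - H (w i).1 (w i).2 := fun H i => T.dif_next_iterate H _ i
  have hw1 : w 1 = (T.head z, n + T.shift z) := by
    simp only [hw, Function.iterate_one, cover_next, CombinatorialMap.tail_next]
  have hw0 : w 0 = (T.tail z, n) := rfl
  have hwN : w N = w 0 := by
    simp only [hw, hN, Function.iterate_minimalPeriod, Function.iterate_zero, id]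
  have ha : ¬ T.Flat u (w 0).1 (w 0).2 := fun hf => hz'.ne' (hf (T.rot z) (T.tail_rot z))
  have hex : ∃ l, 1 ≤ l ∧ ¬ T.Flat u (w l).1 (w l).2 := ⟨N, hNpos, by rwa [hwN]⟩
  classical
  set l := Nat.find hex with hl
  obtain ⟨hl1, hlf⟩ := Nat.find_spec hex
  have hlmin : ∀ i, 1 ≤ i → i < l → T.Flat u (w i).1 (w i).2 := by
    intro i h1 h2
    by_contra h3
    exact Nat.find_min hex h2 ⟨h1, h3⟩
  rw [← hl] at hl1 hlf
  have hl2 : 2 ≤ l := by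
    by_contra h1
    have h2 : l = 1 := by omega
    rw [h2, hw1] at hlf
    exact hlf hx
  have hlevel : ∀ i, i ≤ l → u (w i).1 (w i).2 = u (w 0).1 (w 0).2 := by
    intro i
    induction i with
    | zero => intro _; rfl
    | succ i ih =>
      intro hi
      rw [← ih (by omega), ← sub_eq_zero, ← hdif u i]
      rcases Nat.eq_zero_or_pos i with rfl | h0
      · exact hz
      · exact hlmin i h0 (by omega) _ rfl
  have hlast : T.dif u (T.cover.next^[N - 1] (z, n)) < 0 := by
    rw [hN, iterate_pred_minimalPeriod, dif_flip, cover_rot]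
    linarith
  have hy : u (w 0).1 (w 0).2 < u (w (N - 1)).1 (w (N - 1)).2 := by
    rw [hdif, Nat.sub_add_cancel hNpos, hwN] at hlast
    linarith
  have hlN : l < N - 1 := by
    by_contra h1
    rw [hlevel (N - 1) (by omega)] at hy
    exact lt_irrefl _ hy
  obtain ⟨m, hm, -, p, hp, hpharm, pa, pa', px⟩ := T.exists_barrier hconn
    (fun m => T.dartPeriodic_comp hh m e) (w := w 1) (a := w 0) (a' := w l)
    (by rw [hw1]; exact hx) ha hlf
  have : NeZero m := ⟨hm⟩
  have hp' : VertexPeriodic m (fun v n => - p v n) := fun v n k => congrArg _ (hp v n k)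
  obtain ⟨K, hK, hKres, hKpos, hKneg, hK0, ε, hε, hKε⟩ := T.exists_lex_saddle
    (T.dartPeriodic_comp hh m e) (VertexPeriodic.dif T hp')
    (hharm.saddle_or_flat hc e) (fun v n hf => T.exists_sign_or_dif_eq_zero (by
      rw [laplacian_neg, hpharm v n hf, neg_zero]))
  -- The component along `I * e` breaks the remaining ties, so that a vanishing difference of `L`
  -- means a vanishing difference of `h`.
  obtain ⟨L, hL, hLres, hLpos, hLneg, hL0, ε', hε', hLε⟩ := T.exists_lex_saddle hK
    (T.dartPeriodic_comp hh m (Complex.I * e)) hKres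
    (fun v n _ => hharm.saddle_or_flat hc (Complex.I * e) v n)
  apply (T.not_alternates_of_saddle_or_flat hsimple hconn hh hω hL hLres ?_).2
  · obtain ⟨i, hi1, hi2, hi3⟩ := exists_lt_succ (f := fun i => p (w i).1 (w i).2) hl1
      (by rw [pa']; exact px)
    obtain ⟨j, hj1, hj2, hj3⟩ := exists_lt_succ (f := fun i => u (w i).1 (w i).2) hlN.le
      (by rw [hlevel l le_rfl]; exact hy)
    refine ⟨(z, n), i, j, N - 1, by omega, by omega, by omega, by omega, ?_, ?_, ?_, ?_⟩
    · apply hLpos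
      rw [hKε _ hz, dif_neg']
      have := hdif p 0
      simp only [Function.iterate_zero, id, zero_add] at this
      rw [this, pa]
      nlinarith
    · apply hLneg
      rw [hKε _ (by rw [hdif u, hlevel (i + 1) (by omega), hlevel i (by omega), sub_self]), dif_neg',
        hdif]
      nlinarith
    · apply hLpos
      apply hKpos
      rw [hdif]
      linarith
    · exact hLneg _ (hKneg _ hlast)
  · intro x hx0
    have h1 := hL0 x hx0
    rw [hLε x h1] at hx0
    have h2 := (mul_eq_zero.1 hx0).resolve_left hε'.ne'
    have h3 := hK0 x h1
    rw [dif_comp] at h2 h3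
    exact eq_zero_of_cdot he h3 h2

theorem head_not_flat (hsimple : T.cover.IsSimple)
    (hconn : T.cover.IsThreeConnected) (hh : ∀ v n k, h v (n + k) = h v n + ω k)
    (hω : ∀ k, ω k = 0 → k = 0) (hc : ∀ d, 0 < c d) (hharm : T.Harmonic c h) {e : ℂ} (he : e ≠ 0)
    {z : D} {n : ℤ × ℤ} (hz : T.dif (T.comp e h) (z, n) = 0)
    (hz' : T.dif (T.comp e h) (T.rot z, n) ≠ 0) :
    ¬ T.Flat (T.comp e h) (T.head z) (n + T.shift z) := by
  rcases lt_or_gt_of_ne hz' with h1 | h1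
  · rw [← flat_comp_neg]
    rw [dif_comp] at hz h1
    apply T.head_not_flat_of_pos hsimple hconn hh hω hc hharm (neg_ne_zero.2 he)
    · rw [dif_comp, cdot_neg_left, hz, neg_zero]
    · rw [dif_comp, cdot_neg_left]
      linarith
  · exact T.head_not_flat_of_pos hsimple hconn hh hω hc hharm he hz h1

/-- In a harmonic map, the edges at a vertex do not all have the same direction. -/
theorem not_flat (hsimple : T.cover.IsSimple)
    (hconn : T.cover.IsThreeConnected) (hh : ∀ v n k, h v (n + k) = h v n + ω k)
    (hω : ∀ k, ω k = 0 → k = 0) (hc : ∀ d, 0 < c d) (hharm : T.Harmonic c h) {e : ℂ} (he : e ≠ 0)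
    (hnf : ∃ v n, ¬ T.Flat (T.comp e h) v n) (v : T.Vertex) (n : ℤ × ℤ) :
    ¬ T.Flat (T.comp e h) v n := by
  intro hv
  obtain ⟨v1, n1, hv1⟩ := hnf
  obtain ⟨d, k, hd, hdf, -, -⟩ := T.exists_boundary hconn (T.dartPeriodic_comp hh 1 e)
    (w := (v, n)) (p := (v1, n1)) (q := (v1, n1)) hv hv1 hv1
  -- A boundary edge of the flat component, reversed: a level edge from a non-flat vertex to a flat
  -- one.
  obtain ⟨z, n, hx, ha, hz⟩ : ∃ z n, T.Flat (T.comp e h) (T.head z) (n + T.shift z) ∧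
      ¬ T.Flat (T.comp e h) (T.tail z) n ∧ T.dif (T.comp e h) (z, n) = 0 := by
    have h1 : T.Flat (T.comp e h) (T.tail d) k := FlatReach.flat T hd hv
    refine ⟨T.flip d, k + T.shift d, ?_, hdf, ?_⟩
    · rwa [CombinatorialMap.head_flip, T.shift_flip, add_neg_cancel_right]
    · have := T.dif_flip (T.comp e h) (d, k)
      rw [cover_flip, h1 d rfl, neg_zero] at this
      exact this
  clear hd hdf hv hv1 d k v v1 n1
  set N := Function.minimalPeriod T.rot z with hN
  have hex : ∃ i < N, T.dif (T.comp e h) (T.rot^[i] z, n) ≠ 0 := by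
    by_contra! hc'
    apply ha
    intro d hd
    obtain ⟨i, hi, rfl⟩ := exists_iterate_lt_minimalPeriod (T.tail_eq_iff.1 hd.symm)
    exact hc' i hi
  classical
  obtain ⟨i0, hi0N, hi0, hi0max⟩ : ∃ i0 < N, T.dif (T.comp e h) (T.rot^[i0] z, n) ≠ 0 ∧
      ∀ i, i < N → T.dif (T.comp e h) (T.rot^[i] z, n) ≠ 0 → i ≤ i0 := by
    obtain ⟨i, hi, hi'⟩ := hex
    set F := (Finset.range N).filter (fun i => T.dif (T.comp e h) (T.rot^[i] z, n) ≠ 0) with hF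
    have hne : F.Nonempty := ⟨i, by simp [hF, hi, hi']⟩
    have h1 := Finset.mem_filter.1 (F.max'_mem hne)
    exact ⟨_, Finset.mem_range.1 h1.1, h1.2, fun j hj hj' => F.le_max' j (by simp [hF, hj, hj'])⟩
  wlog hneg : T.dif (T.comp e h) (T.rot^[i0] z, n) < 0 generalizing e
  · have hm : ∀ x, T.dif (T.comp (-e) h) x = - T.dif (T.comp e h) x := fun x => by
      rw [dif_comp, dif_comp, cdot_neg_left]
    refine this (neg_ne_zero.2 he) (T.flat_comp_neg.2 hx) (mt T.flat_comp_neg.1 ha) ?_ ?_ ?_ ?_ ?_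
    · rw [hm, hz, neg_zero]
    · simpa only [hm, neg_ne_zero] using hex
    · rwa [hm, neg_ne_zero]
    · simpa only [hm, neg_ne_zero] using hi0max
    · rw [hm]
      have := lt_of_le_of_ne (not_lt.1 hneg) hi0.symm
      linarith
  set u := T.comp e h with hu
  have hex' : ∃ i, T.dif u (T.rot^[i] z, n) ≠ 0 := ⟨i0, hi0⟩
  set j := Nat.find hex' with hj
  have hj1 : T.dif u (T.rot^[j] z, n) ≠ 0 := Nat.find_spec hex'
  have hjmin : ∀ i, i < j → T.dif u (T.rot^[i] z, n) = 0 := fun i hi => by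
    by_contra h1
    exact Nat.find_min hex' hi h1
  have hj0 : 0 < j := by
    rcases Nat.eq_zero_or_pos j with h0 | h0
    · rw [h0] at hj1
      exact absurd hz hj1
    · exact h0
  have hji0 : j ≤ i0 := Nat.find_min' hex' hi0
  -- The last of the level edges that follow `z` around its tail. By `head_not_flat` its head is not
  -- flat, so it is not `z` itself.
  set z' := T.rot^[j - 1] z with hz'
  have hrz' : T.rot z' = T.rot^[j] z := by
    rw [hz', ← Function.iterate_succ_apply' T.rot, Nat.succ_eq_add_one, Nat.sub_add_cancel hj0]
  have htz' : T.tail z' = T.tail z := T.tail_iterate z _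
  have hb : ¬ T.Flat u (T.head z') (n + T.shift z') :=
    T.head_not_flat hsimple hconn hh hω hc hharm he (hjmin _ (by omega)) (by rwa [hrz'])
  have hj2 : 1 < j := by
    by_contra h1
    have h2 : j - 1 = 0 := by omega
    rw [hz', h2] at hb
    exact hb hx
  obtain ⟨⟨d1, e1, f1⟩, -⟩ := (hharm.saddle_or_flat hc e (T.tail z) n).resolve_right ha
  obtain ⟨t, htN, rfl⟩ := exists_iterate_lt_minimalPeriod (T.tail_eq_iff.1 e1.symm)
  have htj : j ≤ t := Nat.find_min' hex' f1.ne'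
  have hti0 : t < i0 := lt_of_le_of_ne (hi0max t htN f1.ne') fun h1 => by
    rw [h1] at f1
    exact lt_asymm f1 hneg
  -- Subtracting `p` makes `z` rise and keeps `z'` level; subtracting `q` afterwards makes `z'`
  -- fall. Modulo `m` the ends of `z'` stay distinct, since there are no loops.
  obtain ⟨m, hm, hsep, p, hp, hpharm, pa, pa', px⟩ := T.exists_barrier hconn
    (fun m => T.dartPeriodic_comp hh m e) (w := (T.head z, n + T.shift z)) (a := (T.tail z, n))
    (a' := (T.head z', n + T.shift z')) hx ha hb
  have : NeZero m := ⟨hm⟩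
  obtain ⟨q, hq, hqR, hqharm⟩ := T.exists_harmonic hconn (m := m) (R := fun v n => ¬ T.Flat u v n)
    ⟨_, _, ha⟩ (fun v n k => not_congr (T.flat_periodic (T.dartPeriodic_comp hh m e) v n k))
    (b := fun v k => if (v, red m k) = (T.head z', red m (n + T.shift z')) then 1 else 0) (by
      intro v n k
      simp only [red_add_smul])
  have hp' : VertexPeriodic m (fun v n => - p v n) := fun v n k => congrArg _ (hp v n k)
  have hq' : VertexPeriodic m (fun v n => - q v n) := fun v n k => congrArg _ (hq v n k)
  obtain ⟨K, hK, hKres, hKpos, hKneg, hK0, ε, hε, hKε⟩ := T.exists_lex_saddle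
    (T.dartPeriodic_comp hh m e) (VertexPeriodic.dif T hp')
    (hharm.saddle_or_flat hc e) (fun v n hf => T.exists_sign_or_dif_eq_zero (by
      rw [laplacian_neg, hpharm v n hf, neg_zero]))
  obtain ⟨K', hK', hKres', hKpos', hKneg', hK0', ε', hε', hKε'⟩ := T.exists_lex_saddle hK
    (VertexPeriodic.dif T hq') hKres (fun v n hf => T.exists_sign_or_dif_eq_zero (by
      rw [laplacian_neg, hqharm v n (not_not.2 fun d hd => hK0 _ (hf d hd)), neg_zero]))
  obtain ⟨L, hL, hLres, hLpos, hLneg, hL0, ε'', hε'', hLε⟩ := T.exists_lex_saddle hK'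
    (T.dartPeriodic_comp hh m (Complex.I * e)) hKres'
    (fun v n _ => hharm.saddle_or_flat hc (Complex.I * e) v n)
  have hfinal : ∀ x, T.dif L x = 0 → T.dif h x = 0 := by
    intro x hx0
    have h1 := hL0 x hx0
    rw [hLε x h1] at hx0
    have h2 := (mul_eq_zero.1 hx0).resolve_left hε''.ne'
    have h3 := hK0 x (hK0' x h1)
    rw [dif_comp] at h2 h3
    exact eq_zero_of_cdot he h3 h2
  have hLz : 0 < T.dif L (z, n) := by
    apply hLpos
    apply hKpos'
    rw [hKε _ hz, dif_neg', dif]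
    simp only at pa px ⊢
    rw [pa]
    nlinarith
  have hLz' : T.dif L (z', n) < 0 := by
    apply hLneg
    have h1 : T.dif u (z', n) = 0 := hjmin _ (by omega)
    have h2 : T.dif K (z', n) = 0 := by
      rw [hKε _ h1, dif_neg', dif]
      simp only [htz'] at pa pa' ⊢
      rw [pa, pa']
      ring
    rw [hKε' _ h2, dif_neg', dif]
    simp only [htz']
    rw [hqR _ _ hb, hqR _ _ ha, if_pos rfl, if_neg]
    · linarith
    · intro h3
      rw [Prod.mk.injEq] at h3
      have h4 := hsep h3.1 h3.2
      rw [Prod.mk.injEq, left_eq_add] at h4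
      exact T.no_loop hsimple z' ⟨htz'.trans h4.1, h4.2⟩
  apply (T.not_alternates_of_saddle_or_flat hsimple hconn hh hω hL hLres hfinal).1
  -- The signs `+ - + -` appear at `0, j, t, i0` if the first nonzero component is negative, and at
  -- `0, j - 1, j, i0` if it is positive.
  rcases lt_or_gt_of_ne hj1 with h1 | h1
  · refine ⟨(z, n), j, t, i0, hj0, lt_of_le_of_ne htj fun h2 => ?_, hti0, ?_, hLz, ?_, ?_, ?_⟩
    · rw [← h2] at f1
      exact lt_asymm f1 h1
    · rwa [cover_rot_minimalPeriod]
    all_goals rw [cover_rot_iterate]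
    · exact hLneg _ (hKneg' _ (hKneg _ h1))
    · exact hLpos _ (hKpos' _ (hKpos _ f1))
    · exact hLneg _ (hKneg' _ (hKneg _ hneg))
  · refine ⟨(z, n), j - 1, j, i0, by omega, by omega, by omega, ?_, hLz, ?_, ?_, ?_⟩
    · rwa [cover_rot_minimalPeriod]
    all_goals rw [cover_rot_iterate]
    · exact hLz'
    · exact hLpos _ (hKpos' _ (hKpos _ h1))
    · exact hLneg _ (hKneg' _ (hKneg _ hneg))

end Collapse

end MarkedTorus

/-! ### Balanced cycles of plane vectors: turning and convexity. -/

/-- The signed area of the parallelogram spanned by two plane vectors. -/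
def cross (z w : ℂ) : ℝ := ((starRingEnd ℂ) z * w).im

theorem cross_def (z w : ℂ) : cross z w = z.re * w.im - z.im * w.re := by
  simp [cross]
  ring

theorem cdot_def (z w : ℂ) : cdot z w = z.re * w.re + z.im * w.im := by
  simp [cdot]

theorem cdot_I_mul (z w : ℂ) : cdot (Complex.I * z) w = cross z w := by
  simp [cross_def, cdot_def]
  ring

theorem cdot_neg_I_mul (z w : ℂ) : cdot (-(Complex.I * z)) w = cross w z := by
  rw [cdot_neg_left, cdot_I_mul, cross_def, cross_def]
  ring

theorem cross_comm (z w : ℂ) : cross w z = - cross z w := by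
  rw [cross_def, cross_def]
  ring

theorem cross_same (z : ℂ) : cross z z = 0 := by
  rw [cross_def]
  ring

theorem cross_neg_left (z w : ℂ) : cross (-z) w = - cross z w := by
  simp [cross]

theorem cross_neg_right (z w : ℂ) : cross z (-w) = - cross z w := by
  simp [cross]

theorem cross_real_mul (z w : ℂ) (r : ℝ) : cross z ((r : ℂ) * w) = r * cross z w := by
  simp [cross_def]
  ring

theorem cross_sum {ι : Type*} (s : Finset ι) (z : ℂ) (f : ι → ℂ) :
    cross z (∑ i ∈ s, f i) = ∑ i ∈ s, cross z (f i) := by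
  simp only [cross, Finset.mul_sum, Complex.im_sum]

theorem cdot_self_pos {z : ℂ} (hz : z ≠ 0) : 0 < cdot z z := by
  have : cdot z z = Complex.normSq z := by rw [cdot_def, Complex.normSq_apply]
  rw [this]
  exact Complex.normSq_pos.2 hz

theorem cdot_neg_right (e z : ℂ) : cdot e (-z) = - cdot e z := by
  simp [cdot]

/-- A vector that is parallel to `z`. -/
theorem eq_real_mul_of_cross_eq_zero {z w : ℂ} (hz : z ≠ 0) (h : cross z w = 0) :
    w = ((cdot z w / cdot z z : ℝ) : ℂ) * z := by
  have h1 := cdot_self_pos hz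
  rw [← sub_eq_zero]
  apply eq_zero_of_cdot hz
  · rw [cdot_sub, cdot_real_mul, div_mul_cancel₀ _ h1.ne', sub_self]
  · rw [cdot_I_mul, cross, mul_sub, Complex.sub_im]
    change cross z w - cross z _ = 0
    rw [cross_real_mul, cross_same, h, mul_zero, sub_zero]

/-- The vectors `E`, multiplied by positive weights, sum to zero along the cycles of `π`, and their
components in a direction do not change sign more than twice along a cycle, even if the zero
components are broken by the components in another direction. -/
structure BalancedCycles {D : Type*} (π : Equiv.Perm D) (wt : D → ℝ) (E : D → ℂ) : Prop where
  pos : ∀ d, 0 < wt d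
  sum : ∀ d, ∑ i ∈ Finset.range (Function.minimalPeriod π d), (wt (π^[i] d) : ℂ) * E (π^[i] d) = 0
  not_alternates : ∀ e e' : ℂ, e ≠ 0 → ∃ s : D → ℝ, (∀ d, 0 < cdot e (E d) → 0 < s d) ∧
    (∀ d, cdot e (E d) < 0 → s d < 0) ∧
    (∀ d, cdot e (E d) = 0 → 0 < cdot e' (E d) → 0 < s d) ∧
    (∀ d, cdot e (E d) = 0 → cdot e' (E d) < 0 → s d < 0) ∧ ¬ Alternates π s

namespace BalancedCycles

variable {D : Type*} {π : Equiv.Perm D} {wt : D → ℝ} {E : D → ℂ}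

theorem sum_cdot (B : BalancedCycles π wt E) (e : ℂ) (d : D) :
    ∑ i ∈ Finset.range (Function.minimalPeriod π d), wt (π^[i] d) * cdot e (E (π^[i] d)) = 0 := by
  have h := congrArg (cdot e) (B.sum d)
  rw [cdot_sum, cdot_zero] at h
  simpa only [cdot_real_mul] using h

theorem exists_sign (B : BalancedCycles π wt E) {e : ℂ} {d : D} {i : ℕ}
    (hi : i < Function.minimalPeriod π d) (h : cdot e (E (π^[i] d)) ≠ 0) :
    (∃ j < Function.minimalPeriod π d, 0 < cdot e (E (π^[j] d))) ∧
      ∃ j < Function.minimalPeriod π d, cdot e (E (π^[j] d)) < 0 := by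
  obtain ⟨⟨j, hj, hj'⟩, ⟨k, hk, hk'⟩⟩ := MarkedTorus.exists_sign_of_sum_eq_zero (B.sum_cdot e d)
    ⟨i, Finset.mem_range.2 hi, mul_ne_zero (B.pos _).ne' h⟩
  refine ⟨⟨j, Finset.mem_range.1 hj, (mul_pos_iff_of_pos_left (B.pos _)).1 hj'⟩,
    ⟨k, Finset.mem_range.1 hk, ?_⟩⟩
  by_contra h1
  exact hk'.not_ge (mul_nonneg (B.pos _).le (not_lt.1 h1))

/-- Breaking the ties along `E d` gives `d` the sign `+` and its antiparallel successor the sign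
`-`; the places `p` and `q` complete the pattern. -/
theorem false_of_antiparallel_of_lt (B : BalancedCycles π wt E) {d : D} {r : ℝ} (hd : E d ≠ 0)
    (hr : 0 < r) (hπ : E (π d) = ((-r : ℝ) : ℂ) * E d) {e : ℂ} (he : e ≠ 0)
    (hed : cdot e (E d) = 0) {p q : ℕ} (hpq : p < q) (hq : q < Function.minimalPeriod π d)
    (hp' : 0 < cdot e (E (π^[p] d))) (hq' : cdot e (E (π^[q] d)) < 0) : False := by
  obtain ⟨s, s1, s2, s3, s4, hs⟩ := B.not_alternates e (E d) he
  have h1 := cdot_self_pos hd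
  have hp0 : p ≠ 0 := by
    rintro rfl
    exact hp'.ne' hed
  have hp1 : p ≠ 1 := by
    rintro rfl
    rw [Function.iterate_one, hπ, cdot_real_mul, hed, mul_zero] at hp'
    exact lt_irrefl _ hp'
  refine hs ⟨d, 1, p, q, by omega, by omega, by omega, by omega, s3 _ hed h1, s4 _ ?_ ?_, s1 _ hp',
    s2 _ hq'⟩
  · rw [Function.iterate_one, hπ, cdot_real_mul, hed, mul_zero]
  · rw [Function.iterate_one, hπ, cdot_real_mul]
    nlinarith

/-- If two consecutive vectors have opposite directions, then the cycle is contained in a line. -/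
theorem cross_eq_zero_of_antiparallel (B : BalancedCycles π wt E) {d : D} {r : ℝ} (hd : E d ≠ 0)
    (hr : 0 < r) (hπ : E (π d) = ((-r : ℝ) : ℂ) * E d) {i : ℕ}
    (hi : i < Function.minimalPeriod π d) : cross (E d) (E (π^[i] d)) = 0 := by
  by_contra h
  rw [← cdot_I_mul] at h
  have he : Complex.I * E d ≠ 0 := mul_ne_zero Complex.I_ne_zero hd
  have hed : cdot (Complex.I * E d) (E d) = 0 := by rw [cdot_I_mul, cross_same]
  obtain ⟨⟨p, hp, hp'⟩, ⟨q, hq, hq'⟩⟩ := B.exists_sign hi h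
  rcases lt_trichotomy p q with hpq | rfl | hpq
  · exact B.false_of_antiparallel_of_lt hd hr hπ he hed hpq hq hp' hq'
  · exact lt_asymm hp' hq'
  · refine B.false_of_antiparallel_of_lt hd hr hπ (neg_ne_zero.2 he) ?_ hpq hp ?_ ?_
    · rw [cdot_neg_left, hed, neg_zero]
    · rw [cdot_neg_left]
      linarith
    · rw [cdot_neg_left]
      linarith

/-- A change of turning direction puts both neighbors of `E (π d)` on the same side of its line.
Breaking the tie to the other side gives `+ - +`, and balance supplies a further negative component.
-/
theorem false_of_cross_aux [Finite D] (B : BalancedCycles π wt E) {d : D} {e : ℂ} (he : e ≠ 0)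
    (hd : E (π d) ≠ 0) (h0 : 0 < cdot e (E d)) (h1 : cdot e (E (π d)) = 0)
    (h2 : 0 < cdot e (E (π (π d)))) : False := by
  obtain ⟨s, s1, s2, s3, s4, hs⟩ := B.not_alternates e (- E (π d)) he
  have hN : 0 < Function.minimalPeriod π d := Function.minimalPeriod_pos_of_mem_periodicPts
    (Function.Injective.mem_periodicPts π.injective _)
  obtain ⟨-, k, hk, hk'⟩ := B.exists_sign (e := e) hN h0.ne'
  have hk0 : k ≠ 0 := by
    rintro rfl
    exact lt_asymm h0 hk'
  have hk1 : k ≠ 1 := by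
    rintro rfl
    exact hk'.ne h1
  have hk2 : k ≠ 2 := by
    rintro rfl
    exact lt_asymm h2 hk'
  refine hs ⟨d, 1, 2, k, by omega, by omega, by omega, by omega, s1 _ h0, s4 _ h1 ?_, s1 _ h2,
    s2 _ hk'⟩
  rw [cdot_neg_left]
  have := cdot_self_pos hd
  simpa using this

/-- The sign of the angle between consecutive vectors is constant along a cycle. -/
theorem cross_pos_iff [Finite D] (B : BalancedCycles π wt E) (hne : ∀ d, cross (E d) (E (π d)) ≠ 0) (d : D) :
    0 < cross (E (π d)) (E (π (π d))) ↔ 0 < cross (E d) (E (π d)) := by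
  have hd : E (π d) ≠ 0 := by
    intro h
    apply hne d
    rw [h]
    simp [cross]
  have he : Complex.I * E (π d) ≠ 0 := mul_ne_zero Complex.I_ne_zero hd
  constructor
  · intro h1
    by_contra h2
    have h3 := lt_of_le_of_ne (not_lt.1 h2) (hne d)
    refine B.false_of_cross_aux he hd ?_ ?_ ?_ (d := d)
    · rw [cdot_I_mul, cross_comm]
      linarith
    · rw [cdot_I_mul, cross_same]
    · rwa [cdot_I_mul]
  · intro h1
    by_contra h2
    have h3 := lt_of_le_of_ne (not_lt.1 h2) (hne _)
    refine B.false_of_cross_aux (neg_ne_zero.2 he) hd ?_ ?_ ?_ (d := d)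
    · rwa [cdot_neg_I_mul]
    · rw [cdot_neg_I_mul, cross_same]
    · rw [cdot_neg_I_mul, cross_comm]
      linarith

theorem two_lt_minimalPeriod [Finite D]
    (hpos : ∀ d, 0 < cross (E d) (E (π d))) (d : D) : 2 < Function.minimalPeriod π d := by
  have hN : 0 < Function.minimalPeriod π d := Function.minimalPeriod_pos_of_mem_periodicPts
    (Function.Injective.mem_periodicPts π.injective _)
  by_contra h
  have h1 : Function.minimalPeriod π d = 1 ∨ Function.minimalPeriod π d = 2 := by omega
  rcases h1 with h1 | h1
  · have h2 : π d = d := Function.minimalPeriod_eq_one_iff_isFixedPt.1 h1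
    have := hpos d
    rw [h2, cross_same] at this
    exact lt_irrefl _ this
  · have h2 : π^[2] d = d := by
      rw [← h1]
      exact Function.iterate_minimalPeriod
    have h3 := hpos d
    have h4 := hpos (π d)
    change π (π d) = d at h2
    rw [h2, cross_comm] at h4
    linarith

/-- If consecutive vectors turn left, then the partial sums form a strictly convex polygon. -/
theorem cross_sum_pos [Finite D] (B : BalancedCycles π wt E) (hpos : ∀ d, 0 < cross (E d) (E (π d))) (d : D)
    {l : ℕ} (hl : 1 ≤ l) (hlN : l + 2 ≤ Function.minimalPeriod π d) :
    0 < ∑ j ∈ Finset.range l, wt (π^[j + 1] d) * cross (E d) (E (π^[j + 1] d)) := by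
  by_contra hcon
  have hd : E d ≠ 0 := by
    intro h
    have := hpos d
    simp [h, cross] at this
  set N := Function.minimalPeriod π d with hN
  -- The heights gained over the side `d` start positive, end negative and sum to zero. A
  -- nonpositive partial sum would need a negative term before `l` and a positive one after it, that
  -- is, `+ - + -`.
  set u : ℕ → ℝ := fun j => wt (π^[j + 1] d) * cross (E d) (E (π^[j + 1] d)) with hu
  have hsum : ∑ j ∈ Finset.range (N - 1), u j = 0 := by
    have h1 := B.sum_cdot (Complex.I * E d) d
    obtain ⟨N', hN'⟩ : ∃ N', N = N' + 1 := ⟨N - 1, by omega⟩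
    rw [← hN, hN', Finset.sum_range_succ'] at h1
    simp only [cdot_I_mul, Function.iterate_zero, id, cross_same, mul_zero, add_zero] at h1
    rw [hN', Nat.add_sub_cancel]
    exact h1
  have h0 : 0 < u 0 := mul_pos (B.pos _) (hpos d)
  have hlast : u (N - 2) < 0 := by
    have h1 : π (π^[N - 2 + 1] d) = d := by
      rw [← Function.iterate_succ_apply' π, show (N - 2 + 1).succ = N by omega, hN]
      exact Function.iterate_minimalPeriod
    have h2 := hpos (π^[N - 2 + 1] d)
    rw [h1, cross_comm] at h2
    have h3 := B.pos (π^[N - 2 + 1] d)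
    simp only [hu]
    nlinarith
  have hsign : ∀ j, (0 < u j → 0 < cdot (Complex.I * E d) (E (π^[j + 1] d))) ∧
      (u j < 0 → cdot (Complex.I * E d) (E (π^[j + 1] d)) < 0) := by
    intro j
    rw [cdot_I_mul]
    refine ⟨fun h => (mul_pos_iff_of_pos_left (B.pos _)).1 h, fun h => ?_⟩
    by_contra h1
    exact h.not_ge (mul_nonneg (B.pos _).le (not_lt.1 h1))
  obtain ⟨i, hi, hi'⟩ : ∃ i ∈ Finset.range l, u i < 0 := by
    by_contra! h
    have h1 := Finset.single_le_sum h (Finset.mem_range.2 (by omega : 0 < l))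
    linarith
  rw [Finset.mem_range] at hi
  have hi0 : i ≠ 0 := by
    rintro rfl
    exact lt_asymm h0 hi'
  obtain ⟨j, hj, hj'⟩ : ∃ j ∈ Finset.Ico l (N - 1), 0 < u j := by
    by_contra! h
    have h1 := Finset.sum_range_add_sum_Ico u (by omega : l ≤ N - 1)
    have h2 := Finset.sum_lt_sum (s := Finset.Ico l (N - 1)) (f := u) (g := fun _ => 0) h
      ⟨N - 2, Finset.mem_Ico.2 ⟨by omega, by omega⟩, hlast⟩
    rw [Finset.sum_const_zero] at h2
    rw [hsum] at h1
    linarith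
  rw [Finset.mem_Ico] at hj
  have hj2 : j ≠ N - 2 := by
    rintro rfl
    exact lt_asymm hlast hj'
  obtain ⟨s, s1, s2, -, -, hs⟩ := B.not_alternates _ 0 (mul_ne_zero Complex.I_ne_zero hd)
  have hN' : Function.minimalPeriod π (π d) = N :=
    Function.minimalPeriod_apply (Function.Injective.mem_periodicPts π.injective _)
  refine hs ⟨π d, i, j, N - 2, by omega, by omega, by omega, by omega, s1 _ ((hsign 0).1 h0),
    s2 _ ((hsign i).2 hi'), s1 _ ((hsign j).1 hj'), s2 _ ((hsign (N - 2)).2 hlast)⟩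

end BalancedCycles

/-! ### Tutte's theorem on the torus: no degenerate edges, coherent corners. -/

namespace MarkedTorus

variable {D : Type*} [Fintype D] (T : MarkedTorus D)

/-- A harmonic map of the universal cover of a torus with a simple, 3-connected graph. -/
structure IsTutte (c : D → ℝ) (h : T.Vertex → ℤ × ℤ → ℂ) (ω : ℤ × ℤ → ℂ) : Prop where
  simple : T.cover.IsSimple
  conn : T.cover.IsThreeConnected
  pos : ∀ d, 0 < c d
  lift : ∀ v n k, h v (n + k) = h v n + ω k
  inj : ∀ k, ω k = 0 → k = 0
  indep : ∀ e : ℂ, e ≠ 0 → ∃ k, cdot e (ω k) ≠ 0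
  harmonic : T.Harmonic c h

/-- The vector that represents an edge. -/
def vec (h : T.Vertex → ℤ × ℤ → ℂ) (d : D) : ℂ := T.dif h (d, 0)

variable {T}

namespace IsTutte

variable {h : T.Vertex → ℤ × ℤ → ℂ} {ω : ℤ × ℤ → ℂ} {c : D → ℝ}

theorem dif_eq (H : T.IsTutte c h ω) (d : D) (n : ℤ × ℤ) : T.dif h (d, n) = T.vec h d := by
  have := T.dif_eq_of_lift H.lift d 0 n
  rwa [zero_add] at this

theorem vec_flip (H : T.IsTutte c h ω) (d : D) : T.vec h (T.flip d) = - T.vec h d := by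
  have := T.dif_flip h (d, 0)
  rwa [cover_flip, H.dif_eq] at this

theorem sum_rot (H : T.IsTutte c h ω) (d : D) :
    ∑ i ∈ Finset.range (Function.minimalPeriod T.rot d),
      (c (T.rot^[i] d) : ℂ) * T.vec h (T.rot^[i] d) = 0 := by
  classical
  have h1 := H.harmonic (T.tail d) 0
  rw [← h1]
  convert T.sum_iterate_rot (fun x => (c x : ℂ) * T.vec h x) d using 1
  rfl

theorem sum_next (H : T.IsTutte c h ω) (d : D) :
    ∑ i ∈ Finset.range (Function.minimalPeriod T.next d), T.vec h (T.next^[i] d) = 0 := by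
  have h1 := T.sum_dif_face h (d, 0)
  rw [cover_next_minimalPeriod] at h1
  rw [← h1]
  refine Finset.sum_congr rfl fun i _ => ?_
  rw [cover_next_iterate, H.dif_eq]

/-- The two independent periods make the component in every direction nonconstant, so `not_flat`
applies and each vertex is a saddle of it. -/
theorem exists_vec (H : T.IsTutte c h ω) {e : ℂ} (he : e ≠ 0) (v : T.Vertex) :
    (∃ d, T.tail d = v ∧ 0 < cdot e (T.vec h d)) ∧ ∃ d, T.tail d = v ∧ cdot e (T.vec h d) < 0 := by
  have hnf : ∃ v n, ¬ T.Flat (T.comp e h) v n := by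
    refine T.exists_not_flat H.conn (ω := fun k => cdot e (ω k)) (fun v n k => ?_) (H.indep e he)
    simp only [comp, H.lift, cdot_add]
  have h1 := (H.harmonic.saddle_or_flat H.pos e v 0).resolve_right
    (T.not_flat H.simple H.conn H.lift H.inj H.pos H.harmonic he hnf v 0)
  simpa only [Saddle, dif_comp, vec] using h1

/-- Along the cycles of `rot` and `next`, the components of the edges in a direction do not change
sign more than twice, even after a perturbation. -/
theorem exists_not_alternates (H : T.IsTutte c h ω) {e : ℂ} (he : e ≠ 0)
    {G : T.Vertex → ℤ × ℤ → ℝ} (hG : ∀ d n k, T.dif G (d, n + k) = T.dif G (d, n)) :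
    ∃ s : D → ℝ, (∀ d, 0 < cdot e (T.vec h d) → 0 < s d) ∧
      (∀ d, cdot e (T.vec h d) < 0 → s d < 0) ∧
      (∀ d, cdot e (T.vec h d) = 0 → 0 < T.dif G (d, 0) → 0 < s d) ∧
      (∀ d, cdot e (T.vec h d) = 0 → T.dif G (d, 0) < 0 → s d < 0) ∧
      ¬ Alternates T.rot s ∧ ¬ Alternates T.next s := by
  have hsad : ∀ e : ℂ, e ≠ 0 → ∀ v n, T.Saddle (T.comp e h) v n := by
    intro e he v n
    simpa only [Saddle, dif_comp, H.dif_eq] using H.exists_vec he v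
  have hnf : ∀ v n, ¬ T.Flat (T.comp e h) v n := by
    intro v n hf
    obtain ⟨⟨d, hd, hd'⟩, -⟩ := hsad e he v n
    exact hd'.ne' (hf d hd)
  obtain ⟨K, hK, hKres, hKpos, hKneg, hK0, ε, hε, hKε⟩ := T.exists_lex_saddle (m := 1)
    (T.dartPeriodic_comp H.lift 1 e) (fun d n k => hG d n _)
    (H.harmonic.saddle_or_flat H.pos e) (fun v n hf => absurd hf (hnf v n))
  obtain ⟨L, hL, hLres, hLpos, hLneg, hL0, ε', hε', hLε⟩ := T.exists_lex_saddle hK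
    (T.dartPeriodic_comp H.lift 1 (Complex.I * e)) hKres
    (fun v n _ => H.harmonic.saddle_or_flat H.pos (Complex.I * e) v n)
  have hL' : ∀ d n, T.dif L (d, n) = T.dif L (d, 0) := by
    intro d n
    have := hL d 0 n
    rwa [Nat.cast_one, one_smul, zero_add] at this
  have key := T.not_alternates_of_saddle_or_flat H.simple H.conn H.lift H.inj hL hLres (by
    intro x hx0
    have h1 := hL0 x hx0
    rw [hLε x h1] at hx0
    have h2 := (mul_eq_zero.1 hx0).resolve_left hε'.ne'
    have h3 := hK0 x h1
    rw [dif_comp] at h2 h3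
    exact eq_zero_of_cdot he h3 h2)
  refine ⟨fun d => T.dif L (d, 0), fun d hd => hLpos _ (hKpos _ ?_),
    fun d hd => hLneg _ (hKneg _ ?_), fun d hd hd' => hLpos _ ?_, fun d hd hd' => hLneg _ ?_,
    fun hA => key.1 ?_, fun hA => key.2 ?_⟩
  · rwa [dif_comp, H.dif_eq]
  · rwa [dif_comp, H.dif_eq]
  · rw [hKε _ (by rwa [dif_comp, H.dif_eq])]
    exact mul_pos hε hd'
  · rw [hKε _ (by rwa [dif_comp, H.dif_eq])]
    nlinarith
  · obtain ⟨x, i, j, k, h1, h2, h3, h4, h5, h6, h7, h8⟩ := hA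
    refine ⟨(x, 0), i, j, k, h1, h2, h3, ?_, h5, ?_, ?_, ?_⟩
    · rwa [cover_rot_minimalPeriod]
    all_goals rwa [cover_rot_iterate]
  · obtain ⟨x, i, j, k, h1, h2, h3, h4, h5, h6, h7, h8⟩ := hA
    refine ⟨(x, 0), i, j, k, h1, h2, h3, ?_, h5, ?_, ?_, ?_⟩
    · rwa [cover_next_minimalPeriod]
    all_goals rwa [cover_next_iterate, hL']

theorem balancedCycles (H : T.IsTutte c h ω) :
    BalancedCycles T.rot c (T.vec h) ∧ BalancedCycles T.next (fun _ => 1) (T.vec h) := by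
  refine ⟨⟨H.pos, H.sum_rot, fun e e' he => ?_⟩, ⟨fun _ => one_pos, fun d => ?_, fun e e' he => ?_⟩⟩
  · obtain ⟨s, s1, s2, s3, s4, s5, -⟩ := H.exists_not_alternates he (G := T.comp e' h)
      (fun d n k => by simp only [dif_comp, H.dif_eq])
    simp only [dif_comp, H.dif_eq] at s3 s4
    exact ⟨s, s1, s2, s3, s4, s5⟩
  · simpa using H.sum_next d
  · obtain ⟨s, s1, s2, s3, s4, -, s5⟩ := H.exists_not_alternates he (G := T.comp e' h)
      (fun d n k => by simp only [dif_comp, H.dif_eq])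
    simp only [dif_comp, H.dif_eq] at s3 s4
    exact ⟨s, s1, s2, s3, s4, s5⟩

/-- Components of `h` cannot give a collapsed edge a sign, but a function on the vertices of the
torus can: the ends of `z` project to distinct vertices, because otherwise `z` would lift to a loop.
-/
theorem false_of_vec_eq_zero_of_lt (H : T.IsTutte c h ω) {z : D} (hz : T.vec h z = 0) {e : ℂ}
    (he : e ≠ 0) {i p q : ℕ} (hi0 : 0 < i) (hip : i < p) (hpq : p < q)
    (hq : q < Function.minimalPeriod T.rot z) (hi : T.vec h (T.rot^[i] z) ≠ 0)
    (hei : cdot e (T.vec h (T.rot^[i] z)) = 0) (hp' : 0 < cdot e (T.vec h (T.rot^[p] z)))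
    (hq' : cdot e (T.vec h (T.rot^[q] z)) < 0) : False := by
  classical
  have htz : T.head z ≠ T.tail z := by
    intro h1
    apply T.no_loop H.simple z ⟨h1.symm, H.inj _ ?_⟩
    have h2 := H.lift (T.head z) 0 (T.shift z)
    rw [vec, dif] at hz
    simp only [h1] at hz h2
    rw [h2] at hz
    simpa using hz
  set y := T.vec h (T.rot^[i] z) with hy
  have hyy := cdot_self_pos hi
  -- With the factor `cdot y y / 2`, the perturbation is positive on `z`, while on the edge `y` the
  -- term `-cdot y y` dominates. Together with `p` and `q` this is `+ - + -`.
  set g : T.Vertex → ℤ × ℤ → ℝ := fun v _ => if v = T.tail z then 0 else 1 with hg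
  have hgle : ∀ x, T.dif g x ≤ 1 := by
    intro x
    simp only [dif, hg]
    split_ifs <;> norm_num
  have hdif : ∀ x, T.dif (fun v n => T.comp (-y) h v n + cdot y y / 2 * g v n) x =
      - cdot y (T.dif h x) + cdot y y / 2 * T.dif g x := by
    intro x
    rw [dif_add_smul, dif_comp, cdot_neg_left]
  obtain ⟨s, s1, s2, s3, s4, s5, -⟩ := H.exists_not_alternates he
    (G := fun v n => T.comp (-y) h v n + cdot y y / 2 * g v n) (fun d n k => by
      rw [hdif, hdif, H.dif_eq, H.dif_eq]
      rfl)
  refine s5 ⟨z, i, p, q, hi0, hip, hpq, hq, s3 _ ?_ ?_, s4 _ hei ?_, s1 _ hp', s2 _ hq'⟩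
  · rw [hz, cdot_zero]
  · rw [hdif, H.dif_eq, hz, cdot_zero]
    simp only [dif, hg, if_neg htz, if_true]
    linarith
  · rw [hdif, H.dif_eq, ← hy]
    have := hgle (T.rot^[i] z, 0)
    nlinarith

/-- Take the direction orthogonal to the first nonzero edge after the collapsed one. Components of
both signs then occur only later around the vertex. -/
theorem vec_ne_zero (H : T.IsTutte c h ω) (z : D) : T.vec h z ≠ 0 := by
  classical
  intro hz
  have hex : ∃ i, T.vec h (T.rot^[i] z) ≠ 0 := by
    obtain ⟨⟨d, hd, hd'⟩, -⟩ := H.exists_vec one_ne_zero (T.tail z)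
    obtain ⟨i, -, rfl⟩ := exists_iterate_lt_minimalPeriod (T.tail_eq_iff.1 hd.symm)
    refine ⟨i, fun h0 => ?_⟩
    rw [h0, cdot_zero] at hd'
    exact lt_irrefl _ hd'
  set i := Nat.find hex with hi
  have hi1 : T.vec h (T.rot^[i] z) ≠ 0 := Nat.find_spec hex
  have hmin : ∀ j, T.vec h (T.rot^[j] z) ≠ 0 → i ≤ j := fun j hj => Nat.find_min' hex hj
  have hi0 : 0 < i := by
    rcases Nat.eq_zero_or_pos i with h0 | h0
    · rw [h0] at hi1
      exact absurd hz hi1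
    · exact h0
  have hne : ∀ (e : ℂ) j, cdot e (T.vec h (T.rot^[i] z)) = 0 → cdot e (T.vec h (T.rot^[j] z)) ≠ 0 →
      i < j := by
    intro e j h1 h2
    refine lt_of_le_of_ne (hmin j fun h3 => h2 (by rw [h3, cdot_zero])) ?_
    rintro rfl
    exact h2 h1
  set e := Complex.I * T.vec h (T.rot^[i] z) with he
  have he0 : e ≠ 0 := mul_ne_zero Complex.I_ne_zero hi1
  have hei : cdot e (T.vec h (T.rot^[i] z)) = 0 := by rw [he, cdot_I_mul, cross_same]
  obtain ⟨⟨d, hd, hd'⟩, ⟨d', hd2, hd2'⟩⟩ := H.exists_vec he0 (T.tail z)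
  obtain ⟨p, hp, rfl⟩ := exists_iterate_lt_minimalPeriod (T.tail_eq_iff.1 hd.symm)
  obtain ⟨q, hq, rfl⟩ := exists_iterate_lt_minimalPeriod (T.tail_eq_iff.1 hd2.symm)
  have hp1 := hne e p hei hd'.ne'
  have hq1 := hne e q hei hd2'.ne
  rcases lt_trichotomy p q with hpq | rfl | hpq
  · exact H.false_of_vec_eq_zero_of_lt hz he0 hi0 hp1 hpq hq hi1 hei hd' hd2'
  · exact lt_asymm hd' hd2'
  · refine H.false_of_vec_eq_zero_of_lt hz (neg_ne_zero.2 he0) hi0 hq1 hpq hp hi1 ?_ ?_ ?_ <;>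
      rw [cdot_neg_left] <;> linarith

theorem not_antiparallel_rot (H : T.IsTutte c h ω) {d : D} {r : ℝ} (hr : 0 < r) :
    T.vec h (T.rot d) ≠ ((-r : ℝ) : ℂ) * T.vec h d := by
  intro h1
  have he : Complex.I * T.vec h d ≠ 0 := mul_ne_zero Complex.I_ne_zero (H.vec_ne_zero d)
  obtain ⟨⟨d', hd, hd'⟩, -⟩ := H.exists_vec he (T.tail d)
  obtain ⟨p, hp, rfl⟩ := exists_iterate_lt_minimalPeriod (T.tail_eq_iff.1 hd.symm)
  rw [cdot_I_mul] at hd'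
  exact hd'.ne' (H.balancedCycles.1.cross_eq_zero_of_antiparallel (H.vec_ne_zero d) hr h1 hp)

theorem rot_ne (H : T.IsTutte c h ω) (d : D) : T.rot d ≠ d := by
  intro h1
  obtain ⟨-, ⟨d', hd, hd'⟩⟩ := H.exists_vec (H.vec_ne_zero d) (T.tail d)
  obtain ⟨p, -, rfl⟩ := exists_iterate_lt_minimalPeriod (T.tail_eq_iff.1 hd.symm)
  rw [Function.iterate_fixed h1] at hd'
  exact lt_asymm hd' (cdot_self_pos (H.vec_ne_zero d))

/-- Consecutive edges at a vertex cannot be antiparallel, so parallel ones have the same direction.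
The face between them then has two antiparallel sides and lies in a line, with sides of alternating
direction. The index bound and parity leave only a digon, which is a multiple edge. -/
theorem cross_rot_ne_zero (H : T.IsTutte c h ω) (d : D) :
    cross (T.vec h d) (T.vec h (T.rot d)) ≠ 0 := by
  intro hcr
  have hpar := eq_real_mul_of_cross_eq_zero (H.vec_ne_zero d) hcr
  set r := cdot (T.vec h d) (T.vec h (T.rot d)) / cdot (T.vec h d) (T.vec h d) with hr
  have hr0 : r ≠ 0 := by
    intro h0
    rw [h0, Complex.ofReal_zero, zero_mul] at hpar
    exact H.vec_ne_zero _ hpar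
  rcases lt_or_gt_of_ne hr0 with hneg | hpos
  · apply H.not_antiparallel_rot (neg_pos.2 hneg) (d := d)
    rwa [neg_neg]
  set a := T.flip (T.rot d) with ha
  have hna : T.next a = d := T.next_flip_rot d
  have hva : T.vec h a = ((-r : ℝ) : ℂ) * T.vec h d := by
    rw [ha, H.vec_flip, hpar]
    push_cast
    ring
  have hvd : T.vec h (T.next a) = ((-r⁻¹ : ℝ) : ℂ) * T.vec h a := by
    rw [hna, hva, ← mul_assoc, ← Complex.ofReal_mul, neg_mul_neg, inv_mul_cancel₀ hr0]
    simp
  have hcol : ∀ i, cross (T.vec h a) (T.vec h (T.next^[i] a)) = 0 := by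
    intro i
    obtain ⟨j, hj, hj'⟩ := exists_iterate_lt_minimalPeriod (π := T.next) (x := a)
      (y := T.next^[i] a) ⟨i, by rw [zpow_natCast, Equiv.Perm.coe_pow]⟩
    rw [← hj']
    exact H.balancedCycles.2.cross_eq_zero_of_antiparallel (H.vec_ne_zero a) (inv_pos.2 hpos) hvd hj
  -- Two consecutive collinear sides with the same direction would be an antiparallel corner at
  -- their common vertex, since `rot (next b) = flip b`.
  have hflip : ∀ b, cross (T.vec h a) (T.vec h b) = 0 →
      cross (T.vec h a) (T.vec h (T.next b)) = 0 →
      cdot (T.vec h a) (T.vec h b) * cdot (T.vec h a) (T.vec h (T.next b)) < 0 := by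
    intro b h1 h2
    have haa := cdot_self_pos (H.vec_ne_zero a)
    have hb := eq_real_mul_of_cross_eq_zero (H.vec_ne_zero a) h1
    have hb' := eq_real_mul_of_cross_eq_zero (H.vec_ne_zero a) h2
    set α := cdot (T.vec h a) (T.vec h b)
    set β := cdot (T.vec h a) (T.vec h (T.next b))
    have hα : α ≠ 0 := by
      intro h0
      rw [h0] at hb
      exact H.vec_ne_zero b (by simpa using hb)
    have hβ : β ≠ 0 := by
      intro h0
      rw [h0] at hb'
      exact H.vec_ne_zero (T.next b) (by simpa using hb')
    by_contra h3
    have h4 : 0 < α * β := lt_of_le_of_ne (not_lt.1 h3) (mul_ne_zero hα hβ).symm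
    have h5 : 0 < α / β := by
      rw [div_eq_mul_inv, ← mul_pos_iff_of_pos_right (mul_self_pos.2 hβ)]
      have : α * β⁻¹ * (β * β) = α * β := by field_simp
      rwa [this]
    apply H.not_antiparallel_rot h5 (d := T.next b)
    rw [T.rot_next, H.vec_flip, hb, hb', ← mul_assoc, ← Complex.ofReal_mul, ← neg_mul,
      ← Complex.ofReal_neg]
    congr 2
    field_simp
  have halt : ∀ i, cdot (T.vec h a) (T.vec h (T.next^[i] a)) *
      cdot (T.vec h a) (T.vec h (T.next^[i + 1] a)) < 0 := by
    intro i
    have h1 := hcol (i + 1)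
    rw [Function.iterate_succ_apply'] at h1 ⊢
    exact hflip _ (hcol i) h1
  have h0 : 0 < cdot (T.vec h a) (T.vec h (T.next^[0] a)) := cdot_self_pos (H.vec_ne_zero a)
  have h1 : cdot (T.vec h a) (T.vec h (T.next^[1] a)) < 0 := by nlinarith [halt 0]
  have h2 : 0 < cdot (T.vec h a) (T.vec h (T.next^[2] a)) := by nlinarith [halt 1]
  have h3 : cdot (T.vec h a) (T.vec h (T.next^[3] a)) < 0 := by nlinarith [halt 2]
  obtain ⟨s, s1, s2, -, -, hs⟩ := H.balancedCycles.2.not_alternates _ 0 (H.vec_ne_zero a)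
  have hN : 0 < Function.minimalPeriod T.next a := Function.minimalPeriod_pos_of_mem_periodicPts
    (Function.Injective.mem_periodicPts T.next.injective _)
  have hper : T.next^[Function.minimalPeriod T.next a] a = a := Function.iterate_minimalPeriod
  have hN3 : Function.minimalPeriod T.next a ≤ 3 := by
    by_contra h4
    exact hs ⟨a, 1, 2, 3, by omega, by omega, by omega, by omega, s1 _ h0, s2 _ h1, s1 _ h2,
      s2 _ h3⟩
  have hN2 : Function.minimalPeriod T.next a = 2 := by
    have h4 : Function.minimalPeriod T.next a ≠ 1 := by
      intro h5
      rw [h5] at hper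
      rw [hper] at h1
      exact lt_asymm h0 h1
    have h6 : Function.minimalPeriod T.next a ≠ 3 := by
      intro h5
      rw [h5] at hper
      rw [hper] at h3
      exact lt_asymm h0 h3
    omega
  have hsh := T.shift_face a
  rw [hN2, Finset.sum_range_succ, Finset.sum_range_one, Function.iterate_zero, id,
    Function.iterate_one, hna, ha, T.shift_flip, neg_add_eq_zero] at hsh
  apply H.rot_ne d
  refine T.simple_darts H.simple (T.tail_rot d) ?_ hsh
  rw [hN2, Function.iterate_succ_apply, Function.iterate_one, hna] at hper
  rw [← T.tail_next d, hper, ha]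
  rfl

/-- All the corners have the same orientation. -/
theorem cross_pos_or_neg (H : T.IsTutte c h ω) :
    (∀ d, 0 < cross (T.vec h d) (T.vec h (T.rot d))) ∨
      ∀ d, cross (T.vec h d) (T.vec h (T.rot d)) < 0 := by
  have hnext : ∀ d, cross (T.vec h d) (T.vec h (T.next d)) =
      cross (T.vec h (T.next d)) (T.vec h (T.rot (T.next d))) := by
    intro d
    rw [T.rot_next, H.vec_flip, cross_neg_right, ← cross_comm]
  have hrot : ∀ d, (0 < cross (T.vec h (T.rot d)) (T.vec h (T.rot (T.rot d)))) =
      (0 < cross (T.vec h d) (T.vec h (T.rot d))) := fun d =>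
    propext (H.balancedCycles.1.cross_pos_iff H.cross_rot_ne_zero d)
  -- Constancy around vertices and constancy around faces together carry the orientation to the
  -- other end of an edge, and connectedness spreads it everywhere.
  have hflip : ∀ d, (0 < cross (T.vec h (T.flip d)) (T.vec h (T.rot (T.flip d)))) =
      (0 < cross (T.vec h d) (T.vec h (T.rot d))) := by
    intro d
    rw [← T.rot_next, hrot, ← hnext]
    have h1 := H.balancedCycles.2.cross_pos_iff (fun d => by
      rw [hnext]
      exact H.cross_rot_ne_zero _) (T.flip (T.rot d))
    rw [T.next_flip_rot] at h1
    rw [h1, H.vec_flip, cross_neg_left, cross_comm (T.vec h d), neg_neg]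
  obtain ⟨d0⟩ := T.nonempty_dart
  have hall := fun d => T.eq_of_invariant
    (f := fun d => 0 < cross (T.vec h d) (T.vec h (T.rot d))) hflip hrot d d0
  by_cases h0 : 0 < cross (T.vec h d0) (T.vec h (T.rot d0))
  · left
    intro d
    exact (hall d).mpr h0
  · right
    intro d
    exact lt_of_le_of_ne (not_lt.1 fun h1 => h0 ((hall d).mp h1)) (H.cross_rot_ne_zero d)

theorem cross_next_pos (H : T.IsTutte c h ω)
    (hpos : ∀ d, 0 < cross (T.vec h d) (T.vec h (T.rot d))) (d : D) :
    0 < cross (T.vec h d) (T.vec h (T.next d)) := by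
  have h1 := hpos (T.next d)
  rwa [T.rot_next, H.vec_flip, cross_neg_right, ← cross_comm] at h1

end IsTutte

end MarkedTorus

/-! ### Cochains, the intersection pairing and the Hodge decomposition. -/

namespace MarkedTorus

variable {D : Type*} [Fintype D] (T : MarkedTorus D)

section Cochains

variable {R : Type*} [CommRing R]

/-- The homomorphism that takes the values `P.1` and `P.2` on the two generators. -/
def combo (P : R × R) (n : ℤ × ℤ) : R := n.1 * P.1 + n.2 * P.2

theorem combo_add (P : R × R) (n k : ℤ × ℤ) : combo P (n + k) = combo P n + combo P k := by
  simp only [combo, Prod.fst_add, Prod.snd_add, Int.cast_add]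
  ring

theorem combo_neg (P : R × R) (n : ℤ × ℤ) : combo P (-n) = - combo P n := by
  simp only [combo, Prod.fst_neg, Prod.snd_neg, Int.cast_neg]
  ring

theorem combo_zero (P : R × R) : combo P 0 = 0 := by
  simp [combo]

theorem combo_sub (P : R × R) (n k : ℤ × ℤ) : combo P (n - k) = combo P n - combo P k := by
  rw [sub_eq_add_neg, combo_add, combo_neg, sub_eq_add_neg]

theorem combo_sum {ι : Type*} (s : Finset ι) (P : R × R) (f : ι → ℤ × ℤ) :
    combo P (∑ i ∈ s, f i) = ∑ i ∈ s, combo P (f i) := by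
  classical
  induction s using Finset.induction_on with
  | empty => simp [combo_zero]
  | insert a s ha ih => rw [Finset.sum_insert ha, Finset.sum_insert ha, combo_add, ih]

/-- The coboundary of a function on the vertices. -/
def grad (p : T.Vertex → R) (d : D) : R := p (T.head d) - p (T.tail d)

/-- The coboundary of a function on the faces. -/
def cograd (q : T.Face → R) (d : D) : R := q (T.left d) - q (T.right d)

/-- The 1-cochain sums to zero along the boundary of each face. -/
def Closed (β : D → R) : Prop :=
  ∀ d, ∑ i ∈ Finset.range (Function.minimalPeriod T.next d), β (T.next^[i] d) = 0

open Classical in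
/-- The 1-cochain sums to zero around each vertex. -/
def Coclosed (β : D → R) : Prop :=
  ∀ v, ∑ d ∈ Finset.univ.filter (fun d => T.tail d = v), β d = 0

/-- The cocycle on the dual graph that corresponds to `shift`. -/
noncomputable def coshift (d : D) : ℤ × ℤ := T.off (T.rot.symm d) - T.off d

theorem coshift_eq (d : D) : T.coshift d = T.off (T.flip d) - T.shift d - T.off d := by
  have h1 : T.rot.symm d = T.next (T.flip d) := by
    rw [Equiv.symm_apply_eq, T.rot_next, T.flip_flip]
  rw [coshift, h1, off_next, T.shift_flip]
  abel

theorem coshift_flip (d : D) : T.coshift (T.flip d) = - T.coshift d := by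
  rw [coshift_eq, coshift_eq, T.flip_flip, T.shift_flip]
  abel

theorem grad_flip (p : T.Vertex → R) (d : D) : T.grad p (T.flip d) = - T.grad p d := by
  rw [grad, grad, T.head_flip, neg_sub]
  rfl

theorem cograd_flip (q : T.Face → R) (d : D) : T.cograd q (T.flip d) = - T.cograd q d := by
  rw [cograd, cograd, CombinatorialMap.right, CombinatorialMap.right, T.flip_flip, neg_sub]

theorem closed_grad (p : T.Vertex → R) : T.Closed (T.grad p) := by
  intro d
  have h1 : ∀ i, T.grad p (T.next^[i] d) =
      p (T.tail (T.next^[i + 1] d)) - p (T.tail (T.next^[i] d)) := by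
    intro i
    rw [Function.iterate_succ_apply', T.tail_next, grad]
  simp only [h1]
  rw [Finset.sum_range_sub (fun i => p (T.tail (T.next^[i] d))), Function.iterate_minimalPeriod]
  simp

theorem closed_shift (P : R × R) : T.Closed (fun d => combo P (T.shift d)) := by
  intro d
  rw [← combo_sum, T.shift_face, combo_zero]

/-- The sum telescopes, since `rot` permutes the darts at a vertex. -/
theorem coclosed_sub_rot {A : D → R} : T.Coclosed (fun d => A (T.rot.symm d) - A d) := by
  classical
  intro v
  rw [Finset.sum_sub_distrib, sub_eq_zero]
  refine Finset.sum_equiv T.rot.symm (fun d => ?_) fun d _ => rfl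
  simp only [Finset.mem_filter, Finset.mem_univ, true_and]
  rw [← T.tail_rot (T.rot.symm d), Equiv.apply_symm_apply]

theorem coclosed_coshift (P : R × R) : T.Coclosed (fun d => combo P (T.coshift d)) := by
  simp only [coshift, combo_sub]
  exact T.coclosed_sub_rot (A := fun d => combo P (T.off d))

theorem sum_flip {A : Type*} [AddCommMonoid A] (F : D → A) : ∑ d, F (T.flip d) = ∑ d, F d :=
  Equiv.sum_comp T.flip F

variable {T}

/-- Summation by parts: grouping by faces pairs `q` with the boundary sums of `β`. -/
theorem Closed.sum_cograd_mul {β : D → R} (hβ : T.Closed β) (hβ' : ∀ d, β (T.flip d) = - β d)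
    (q : T.Face → R) : ∑ d, T.cograd q d * β d = 0 := by
  classical
  have := Fintype.ofFinite T.Face
  have h1 : ∑ d, q (T.left d) * β d = 0 := by
    rw [T.sum_eq_sum_faces]
    refine Finset.sum_eq_zero fun f _ => ?_
    simp only [T.left_iterate]
    rw [← Finset.mul_sum, hβ, mul_zero]
  have h2 : ∑ d, q (T.right d) * β d = - ∑ d, q (T.left d) * β d := by
    rw [← T.sum_flip (fun d => q (T.left d) * β d), ← Finset.sum_neg_distrib]
    refine Finset.sum_congr rfl fun d _ => ?_
    rw [hβ', mul_neg, neg_neg]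
    rfl
  simp only [cograd, sub_mul, Finset.sum_sub_distrib]
  rw [h2, h1, neg_zero, sub_zero]

theorem sum_tail_mul (p : T.Vertex → R) (α : D → R) [Fintype T.Vertex] [DecidableEq T.Vertex] :
    ∑ d, p (T.tail d) * α d =
      ∑ v, p v * ∑ d ∈ Finset.univ.filter (fun d => T.tail d = v), α d := by
  rw [← Finset.sum_fiberwise (s := Finset.univ) (g := T.tail)]
  refine Finset.sum_congr rfl fun v _ => ?_
  rw [Finset.mul_sum]
  refine Finset.sum_congr rfl fun d hd => ?_
  rw [(Finset.mem_filter.1 hd).2]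

theorem sum_mul_grad {α : D → R} (hα' : ∀ d, α (T.flip d) = - α d) (p : T.Vertex → R) :
    ∑ d, α d * T.grad p d = - (2 * ∑ d, p (T.tail d) * α d) := by
  have h2 : ∑ d, p (T.head d) * α d = - ∑ d, p (T.tail d) * α d := by
    rw [← T.sum_flip (fun d => p (T.tail d) * α d), ← Finset.sum_neg_distrib]
    refine Finset.sum_congr rfl fun d _ => ?_
    rw [hα', mul_neg, neg_neg]
    rfl
  have h3 : ∑ d, α d * T.grad p d = ∑ d, p (T.head d) * α d - ∑ d, p (T.tail d) * α d := by
    rw [← Finset.sum_sub_distrib]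
    refine Finset.sum_congr rfl fun d _ => ?_
    rw [grad]
    ring
  rw [h3, h2]
  ring

theorem Coclosed.sum_mul_grad {α : D → R} (hα : T.Coclosed α) (hα' : ∀ d, α (T.flip d) = - α d)
    (p : T.Vertex → R) : ∑ d, α d * T.grad p d = 0 := by
  classical
  have := Fintype.ofFinite T.Vertex
  rw [MarkedTorus.sum_mul_grad hα', sum_tail_mul, Finset.sum_eq_zero, mul_zero, neg_zero]
  intro v _
  have h := hα v
  convert mul_zero (p v)

variable (T)

/-- This is `degree_one` regrouped by darts, the inner partial sums of `shift` being the offsets. -/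
theorem sum_off_mul_shift : (∑ d, (T.off d).1 * (T.shift d).2) - ∑ d, (T.off d).2 * (T.shift d).1
    = 2 := by
  classical
  have := Fintype.ofFinite T.Face
  have h := T.degree_one
  rw [finsum_eq_sum_of_fintype] at h
  rw [← h, ← Finset.sum_sub_distrib, T.sum_eq_sum_faces]
  refine Finset.sum_congr rfl fun f _ => Finset.sum_congr rfl fun j hj => ?_
  have hl : T.left (T.next^[j] (Quotient.out f)) = f := by
    rw [T.left_iterate]
    exact Quotient.out_eq f
  have h1 : T.off (T.next^[j] (Quotient.out f)) =
      ∑ i ∈ Finset.range j, T.shift (T.next^[i] (Quotient.out f)) := by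
    rw [off, T.index_iterate_out f (Finset.mem_range.1 hj), hl]
  rw [h1, Prod.fst_sum, Prod.snd_sum, Finset.sum_mul, Finset.sum_mul, Finset.sum_sub_distrib]

/-- The total of `a (off d) * b (off d)` is unchanged by reindexing along `next`; the terms shown
are the increment given by `off_next`. -/
theorem sum_off_mul_shift_add (a b : ℤ × ℤ → ℤ) (ha : ∀ n k, a (n + k) = a n + a k)
    (hb : ∀ n k, b (n + k) = b n + b k) :
    ∑ d, a (T.off d) * b (T.shift d) + ∑ d, b (T.off d) * a (T.shift d)
      + ∑ d, a (T.shift d) * b (T.shift d) = 0 := by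
  have h := Equiv.sum_comp T.next (fun d => a (T.off d) * b (T.off d))
  have h1 : ∑ d, a (T.off (T.next d)) * b (T.off (T.next d)) = ∑ d, a (T.off d) * b (T.off d)
      + (∑ d, a (T.off d) * b (T.shift d) + ∑ d, b (T.off d) * a (T.shift d)
      + ∑ d, a (T.shift d) * b (T.shift d)) := by
    simp only [← Finset.sum_add_distrib]
    refine Finset.sum_congr rfl fun d _ => ?_
    rw [off_next, ha, hb]
    ring
  rw [h1] at h
  linarith

theorem sum_coshift_mul_shift (a b : ℤ × ℤ → ℤ) (ha : ∀ n k, a (n + k) = a n + a k)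
    (hb : ∀ n k, b (n + k) = b n + b k) :
    ∑ d, a (T.coshift d) * b (T.shift d) =
      ∑ d, b (T.off d) * a (T.shift d) - ∑ d, a (T.off d) * b (T.shift d) := by
  have h0 : ∀ (f : ℤ × ℤ → ℤ), (∀ n k, f (n + k) = f n + f k) → ∀ n k, f (n - k) = f n - f k := by
    intro f hf n k
    have := hf (n - k) k
    rw [sub_add_cancel] at this
    linarith
  have h1 := T.sum_off_mul_shift_add a b ha hb
  have h2 : ∑ d, a (T.off (T.flip d)) * b (T.shift d) = - ∑ d, a (T.off d) * b (T.shift d) := by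
    rw [← T.sum_flip (fun d => a (T.off d) * b (T.shift d)), ← Finset.sum_neg_distrib]
    refine Finset.sum_congr rfl fun d _ => ?_
    have : b (- T.shift d) = - b (T.shift d) := by
      have h3 := h0 b hb 0 (T.shift d)
      have h4 := h0 b hb 0 0
      rw [sub_self] at h4
      rw [zero_sub] at h3
      linarith
    rw [T.shift_flip, this]
    ring
  simp only [coshift_eq, h0 a ha, sub_mul, Finset.sum_sub_distrib]
  rw [h2]
  linarith

/-- The intersection pairing of the torus. -/
theorem sum_combo_mul_combo (P Q : R × R) :
    ∑ d, combo P (T.coshift d) * combo Q (T.shift d) = -2 * (P.1 * Q.2 - P.2 * Q.1) := by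
  have h := T.sum_off_mul_shift
  have h11 := T.sum_coshift_mul_shift Prod.fst Prod.fst (fun _ _ => rfl) (fun _ _ => rfl)
  have h12 := T.sum_coshift_mul_shift Prod.fst Prod.snd (fun _ _ => rfl) (fun _ _ => rfl)
  have h21 := T.sum_coshift_mul_shift Prod.snd Prod.fst (fun _ _ => rfl) (fun _ _ => rfl)
  have h22 := T.sum_coshift_mul_shift Prod.snd Prod.snd (fun _ _ => rfl) (fun _ _ => rfl)
  rw [sub_self] at h11 h22
  replace h12 : ∑ d, (T.coshift d).1 * (T.shift d).2 = -2 := by linarith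
  replace h21 : ∑ d, (T.coshift d).2 * (T.shift d).1 = 2 := by linarith
  have k11 := congrArg (Int.cast : ℤ → R) h11
  have k12 := congrArg (Int.cast : ℤ → R) h12
  have k21 := congrArg (Int.cast : ℤ → R) h21
  have k22 := congrArg (Int.cast : ℤ → R) h22
  push_cast at k11 k12 k21 k22
  have h1 : ∑ d, combo P (T.coshift d) * combo Q (T.shift d) =
      (P.1 * Q.1) * ∑ d, ((T.coshift d).1 : R) * ((T.shift d).1 : R) +
      (P.1 * Q.2) * ∑ d, ((T.coshift d).1 : R) * ((T.shift d).2 : R) +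
      (P.2 * Q.1) * ∑ d, ((T.coshift d).2 : R) * ((T.shift d).1 : R) +
      (P.2 * Q.2) * ∑ d, ((T.coshift d).2 : R) * ((T.shift d).2 : R) := by
    simp only [Finset.mul_sum, ← Finset.sum_add_distrib]
    refine Finset.sum_congr rfl fun d _ => ?_
    simp only [combo]
    ring
  rw [h1, k11, k12, k21, k22]
  ring

theorem combo_shift_flip (P : R × R) (d : D) :
    combo P (T.shift (T.flip d)) = - combo P (T.shift d) := by
  rw [T.shift_flip, combo_neg]

theorem combo_coshift_flip (P : R × R) (d : D) :
    combo P (T.coshift (T.flip d)) = - combo P (T.coshift d) := by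
  rw [coshift_flip, combo_neg]

/-- The Riemann bilinear relation. -/
theorem sum_cograd_mul_grad (q : T.Face → R) (P : R × R) (p : T.Vertex → R) (Q : R × R) :
    ∑ d, (T.cograd q d + combo P (T.coshift d)) * (T.grad p d + combo Q (T.shift d)) =
      -2 * (P.1 * Q.2 - P.2 * Q.1) := by
  have h1 := (T.closed_grad p).sum_cograd_mul (T.grad_flip p) q
  have h2 := (T.closed_shift Q).sum_cograd_mul (T.combo_shift_flip Q) q
  have h3 := (T.coclosed_coshift P).sum_mul_grad (T.combo_coshift_flip P) p
  rw [← T.sum_combo_mul_combo P Q, ← add_zero (∑ d, combo P (T.coshift d) * combo Q (T.shift d)),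
    ← h1, add_comm, ← zero_add (∑ d, T.cograd q d * T.grad p d + _), ← h2, ← add_zero (_ + _), ← h3]
  simp only [← Finset.sum_add_distrib]
  refine Finset.sum_congr rfl fun d _ => ?_
  ring

end Cochains

/-- The Hodge decomposition in the middle dimension of a cell decomposition of the torus. The
roles of the graph and of the dual graph are symmetric. -/
theorem exists_hodge {A B C : Type*} [Fintype A] [Fintype B] [Fintype C] {flip : D → D}
    {edge : D → C} (hedge : Function.Surjective edge) (hedge' : ∀ d, edge (flip d) = edge d)
    (hcard : Fintype.card D = Fintype.card C + Fintype.card A + Fintype.card B)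
    (α : (A → ℝ) →ₗ[ℝ] D → ℝ) (β : (B → ℝ) →ₗ[ℝ] D → ℝ) (σ χ : ℝ × ℝ →ₗ[ℝ] D → ℝ)
    (hα : ∀ p d, α p (flip d) = - α p d) (hβ : ∀ p d, β p (flip d) = - β p d)
    (hσ : ∀ p d, σ p (flip d) = - σ p d)
    (hβα : ∀ p q, ∑ d, β q d * α p d = 0) (hβσ : ∀ l q, ∑ d, β q d * σ l d = 0)
    (hχα : ∀ l p, ∑ d, χ l d * α p d = 0)
    (hχσ : ∀ l, (∀ m, ∑ d, χ m d * σ l d = 0) → l = 0)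
    (a0 : A) (hα0 : ∀ p, α p = 0 → p a0 = 0 → p = 0)
    (b0 : B) (hβ0 : ∀ p, β p = 0 → p b0 = 0 → p = 0)
    {f : D → ℝ} (hf : ∀ d, f (flip d) = - f d) (hβf : ∀ q, ∑ d, β q d * f d = 0) :
    ∃ p l, f = α p + σ l := by
  have hvanish : ∀ q (g : D → ℝ), (∀ d, β q d + g d = 0) → ∑ d, β q d * g d = 0 → β q = 0 := by
    intro q g h1 h2
    have h3 : ∑ d, β q d * β q d = 0 := by
      rw [← neg_eq_zero, ← h2, ← Finset.sum_neg_distrib]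
      refine Finset.sum_congr rfl fun d _ => ?_
      rw [eq_neg_of_add_eq_zero_right (h1 d)]
      ring
    funext d
    rw [Finset.sum_eq_zero_iff_of_nonneg fun d _ => mul_self_nonneg _] at h3
    exact mul_self_eq_zero.1 (h3 d (Finset.mem_univ d))
  -- The two extra target coordinates fix the additive constants of the potentials on `A` and `B`
  -- and match the two periods in dimension, so injectivity gives surjectivity.
  let L : ((C → ℝ) × (A → ℝ) × (ℝ × ℝ) × (B → ℝ)) →ₗ[ℝ] (D → ℝ) × ℝ × ℝ :=
    { toFun := fun x => (fun d => x.1 (edge d) + (α x.2.1 d + σ x.2.2.1 d + β x.2.2.2 d),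
        x.2.1 a0, x.2.2.2 b0)
      map_add' := fun x y => by
        ext d
        · simp only [Prod.fst_add, Prod.snd_add, map_add, Pi.add_apply]
          ring
        · rfl
        · rfl
      map_smul' := fun r x => by
        ext d
        · simp only [Prod.smul_fst, Prod.smul_snd, map_smul, Pi.smul_apply, smul_eq_mul,
            RingHom.id_apply]
          ring
        · rfl
        · rfl }
  -- The summand pulled back from `C` is even under `flip` and all the others are odd.
  have hsplit : ∀ (s : C → ℝ) p l q (g : D → ℝ), (∀ d, g (flip d) = - g d) →
      (∀ d, s (edge d) + (α p d + σ l d + β q d) = g d) →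
      s = 0 ∧ ∀ d, α p d + σ l d + β q d = g d := by
    intro s p l q g hg h1
    have h2 : ∀ d, s (edge d) = 0 := by
      intro d
      have h3 := h1 d
      have h4 := h1 (flip d)
      rw [hedge', hα, hσ, hβ, hg] at h4
      linarith
    refine ⟨funext fun c => ?_, fun d => ?_⟩
    · obtain ⟨d, rfl⟩ := hedge c
      exact h2 d
    · have := h1 d
      rwa [h2, zero_add] at this
  have hinj : Function.Injective L := by
    rw [← LinearMap.ker_eq_bot, LinearMap.ker_eq_bot']
    rintro ⟨s, p, l, q⟩ hx
    simp only [L, LinearMap.coe_mk, AddHom.coe_mk, Prod.mk_eq_zero] at hx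
    obtain ⟨h1, h2, h3⟩ := hx
    obtain ⟨h4, h5⟩ := hsplit s p l q 0 (by simp) (fun d => congrFun h1 d)
    have h6 : β q = 0 := by
      refine hvanish q (fun d => α p d + σ l d) (fun d => ?_) ?_
      · rw [add_comm]
        exact h5 d
      · simp only [mul_add, Finset.sum_add_distrib]
        rw [hβα, hβσ, add_zero]
    have h7 : ∀ d, α p d + σ l d = 0 := by
      intro d
      have := h5 d
      rw [h6] at this
      simpa using this
    have h8 : l = 0 := by
      refine hχσ l fun m => ?_
      rw [← hχα m p, ← sub_eq_zero, ← neg_eq_zero, neg_sub]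
      rw [← Finset.sum_sub_distrib]
      have : ∀ d, χ m d * α p d - χ m d * σ l d = 2 * (χ m d * α p d) := by
        intro d
        rw [eq_neg_of_add_eq_zero_right (h7 d)]
        ring
      simp only [this]
      rw [← Finset.mul_sum, hχα, mul_zero]
    have h9 : α p = 0 := by
      funext d
      have := h7 d
      rw [h8, map_zero] at this
      simpa using this
    rw [h4, h8, hα0 p h9 h2, hβ0 q h6 h3]
    rfl
  have hsurj : Function.Surjective L := by
    rw [← LinearMap.injective_iff_surjective_of_finrank_eq_finrank]
    · exact hinj
    · simp only [Module.finrank_prod, Module.finrank_fintype_fun_eq_card, Module.finrank_self]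
      omega
  obtain ⟨⟨s, p, l, q⟩, hx⟩ := hsurj (f, 0, 0)
  have hx' := congrArg Prod.fst hx
  obtain ⟨-, h5⟩ := hsplit s p l q f hf (fun d => congrFun hx' d)
  have h6 : β q = 0 := by
    refine hvanish q (fun d => α p d + σ l d - f d) (fun d => ?_) ?_
    · rw [← h5 d]
      ring
    · simp only [mul_add, mul_sub, Finset.sum_add_distrib, Finset.sum_sub_distrib]
      rw [hβα, hβσ, hβf, add_zero, sub_zero]
  refine ⟨p, l, funext fun d => ?_⟩
  rw [← h5, h6]
  simp

/-- The coboundary of functions on the vertices, as a linear map. -/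
def gradL : (T.Vertex → ℝ) →ₗ[ℝ] D → ℝ where
  toFun := T.grad
  map_add' p q := by
    funext d
    simp only [grad, Pi.add_apply]
    ring
  map_smul' r p := by
    funext d
    simp only [grad, Pi.smul_apply, smul_eq_mul, RingHom.id_apply]
    ring

/-- The coboundary of functions on the faces, as a linear map. -/
def cogradL : (T.Face → ℝ) →ₗ[ℝ] D → ℝ where
  toFun := T.cograd
  map_add' p q := by
    funext d
    simp only [cograd, Pi.add_apply]
    ring
  map_smul' r p := by
    funext d
    simp only [cograd, Pi.smul_apply, smul_eq_mul, RingHom.id_apply]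
    ring

/-- The linear map `P ↦ combo P ∘ s`. -/
def comboL {D : Type*} (s : D → ℤ × ℤ) : ℝ × ℝ →ₗ[ℝ] D → ℝ where
  toFun P d := combo P (s d)
  map_add' p q := by
    funext d
    simp only [combo, Pi.add_apply, Prod.fst_add, Prod.snd_add]
    ring
  map_smul' r p := by
    funext d
    simp only [combo, Pi.smul_apply, smul_eq_mul, RingHom.id_apply, Prod.smul_fst, Prod.smul_snd]
    ring

theorem eq_zero_of_grad_eq_zero (d0 : D) (p : T.Vertex → ℝ) (h : T.grad p = 0)
    (h0 : p (T.tail d0) = 0) : p = 0 := by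
  funext v
  obtain ⟨d, rfl⟩ := T.tail_surjective v
  rw [Pi.zero_apply, ← h0]
  refine T.eq_of_invariant (f := fun d => p (T.tail d)) (fun d => ?_) (fun d => ?_) d d0
  · exact sub_eq_zero.1 (congrFun h d)
  · simp only [T.tail_rot]

theorem eq_zero_of_cograd_eq_zero (d0 : D) (p : T.Face → ℝ) (h : T.cograd p = 0)
    (h0 : p (T.left d0) = 0) : p = 0 := by
  funext v
  obtain ⟨d, rfl⟩ := T.left_surjective v
  rw [Pi.zero_apply, ← h0]
  have hflip : ∀ d, p (T.left (T.flip d)) = p (T.left d) := fun d =>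
    (sub_eq_zero.1 (congrFun h d)).symm
  refine T.eq_of_invariant (f := fun d => p (T.left d)) hflip (fun d => ?_) d d0
  have h1 := T.left_flip_rot d
  rw [← h1, hflip]

theorem edge_flip (d : D) : T.edge (T.flip d) = T.edge d :=
  (T.edge_eq_iff.2 (Or.inr rfl)).symm

theorem Closed.exists_eq {T : MarkedTorus D} {f : D → ℝ} (hf : T.Closed f)
    (hf' : ∀ d, f (T.flip d) = - f d) :
    ∃ p : T.Vertex → ℝ, ∃ P : ℝ × ℝ, ∀ d, f d = T.grad p d + combo P (T.shift d) := by
  classical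
  have := Fintype.ofFinite T.Vertex
  have := Fintype.ofFinite T.Face
  have := Fintype.ofFinite T.Edge
  obtain ⟨d0⟩ := T.nonempty_dart
  have hcard := T.card_eq_two_mul_card_edge
  have hcard' := T.card_dart
  rw [Nat.card_eq_fintype_card] at hcard
  obtain ⟨p, l, h⟩ := exists_hodge (flip := T.flip) (edge := T.edge) Quotient.mk_surjective
    T.edge_flip (by omega) T.gradL T.cogradL (comboL T.shift) (comboL T.coshift) T.grad_flip T.cograd_flip
    T.combo_shift_flip
    (fun p q => (T.closed_grad p).sum_cograd_mul (T.grad_flip p) q)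
    (fun P q => (T.closed_shift P).sum_cograd_mul (T.combo_shift_flip P) q)
    (fun P p => (T.coclosed_coshift P).sum_mul_grad (T.combo_coshift_flip P) p)
    (fun Q h => by
      have h1 := h (1, 0)
      have h2 := h (0, 1)
      change ∑ d, combo _ _ * combo Q _ = 0 at h1 h2
      rw [sum_combo_mul_combo] at h1 h2
      apply Prod.ext
      · simpa using h2
      · simpa using h1)
    (T.tail d0) (T.eq_zero_of_grad_eq_zero d0) (T.left d0) (T.eq_zero_of_cograd_eq_zero d0) hf'
    (fun q => hf.sum_cograd_mul hf' q)
  exact ⟨p, l, fun d => congrFun h d⟩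

theorem Coclosed.exists_eq {T : MarkedTorus D} {f : D → ℝ} (hf : T.Coclosed f)
    (hf' : ∀ d, f (T.flip d) = - f d) :
    ∃ q : T.Face → ℝ, ∃ P : ℝ × ℝ, ∀ d, f d = T.cograd q d + combo P (T.coshift d) := by
  classical
  have := Fintype.ofFinite T.Vertex
  have := Fintype.ofFinite T.Face
  have := Fintype.ofFinite T.Edge
  obtain ⟨d0⟩ := T.nonempty_dart
  have hcard := T.card_eq_two_mul_card_edge
  have hcard' := T.card_dart
  rw [Nat.card_eq_fintype_card] at hcard
  have hcomm : ∀ f g : D → ℝ, ∑ d, f d * g d = ∑ d, g d * f d := fun f g =>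
    Finset.sum_congr rfl fun d _ => mul_comm _ _
  obtain ⟨p, l, h⟩ := exists_hodge (flip := T.flip) (edge := T.edge) Quotient.mk_surjective
    T.edge_flip (by omega) T.cogradL T.gradL (comboL T.coshift) (comboL T.shift) T.cograd_flip T.grad_flip
    T.combo_coshift_flip
    (fun q p => (hcomm _ _).trans ((T.closed_grad p).sum_cograd_mul (T.grad_flip p) q))
    (fun P p => (hcomm _ _).trans ((T.coclosed_coshift P).sum_mul_grad (T.combo_coshift_flip P) p))
    (fun P q => (hcomm _ _).trans ((T.closed_shift P).sum_cograd_mul (T.combo_shift_flip P) q))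
    (fun Q h => by
      have h1 := (hcomm _ _).trans (h (1, 0))
      have h2 := (hcomm _ _).trans (h (0, 1))
      change ∑ d, combo Q _ * combo _ _ = 0 at h1 h2
      rw [sum_combo_mul_combo] at h1 h2
      apply Prod.ext
      · simpa using h2
      · simpa using h1)
    (T.left d0) (T.eq_zero_of_cograd_eq_zero d0) (T.tail d0) (T.eq_zero_of_grad_eq_zero d0) hf'
    (fun p => (hcomm _ _).trans (hf.sum_mul_grad hf' p))
  exact ⟨p, l, fun d => congrFun h d⟩

theorem Coclosed.exists_eq_complex {T : MarkedTorus D} {f : D → ℂ} (hf : T.Coclosed f)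
    (hf' : ∀ d, f (T.flip d) = - f d) :
    ∃ q : T.Face → ℂ, ∃ P : ℂ × ℂ, ∀ d, f d = T.cograd q d + combo P (T.coshift d) := by
  have h1 : T.Coclosed (fun d => (f d).re) := fun v => by
    rw [← Complex.re_sum, hf v, Complex.zero_re]
  have h2 : T.Coclosed (fun d => (f d).im) := fun v => by
    rw [← Complex.im_sum, hf v, Complex.zero_im]
  obtain ⟨q, P, hq⟩ := h1.exists_eq (fun d => by rw [hf', Complex.neg_re])
  obtain ⟨q', P', hq'⟩ := h2.exists_eq (fun d => by rw [hf', Complex.neg_im])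
  refine ⟨fun x => ⟨q x, q' x⟩, (⟨P.1, P'.1⟩, ⟨P.2, P'.2⟩), fun d => ?_⟩
  apply Complex.ext
  · simp [hq, cograd, combo]
  · simp [hq', cograd, combo]

end MarkedTorus

/-! ### Periods, first variation and the energy bound. -/

namespace MarkedTorus

variable {D : Type*} [Fintype D] (T : MarkedTorus D)

/-- The map with the values `p` on a fundamental domain and the periods `W`. -/
def ofPeriods (p : T.Vertex → ℂ) (W : ℂ × ℂ) (v : T.Vertex) (n : ℤ × ℤ) : ℂ := p v + combo W n

/-- A function on the vertices of the cover, given on pairs of a vertex and a translation. -/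
def onVertices {A : Type*} (h : T.Vertex → ℤ × ℤ → A) (v : T.cover.Vertex) : A :=
  h (T.vtx v).1 (T.vtx v).2

/-- A function on the faces of the cover, given on pairs of a face and a translation. -/
noncomputable def onFaces {A : Type*} (h : T.Face → ℤ × ℤ → A) (f : T.cover.Face) : A :=
  h (T.fce f).1 (T.fce f).2

theorem ofPeriods_add (p : T.Vertex → ℂ) (W : ℂ × ℂ) (v : T.Vertex) (n k : ℤ × ℤ) :
    T.ofPeriods p W v (n + k) = T.ofPeriods p W v n + combo W k := by
  rw [ofPeriods, ofPeriods, combo_add, add_assoc]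

theorem dif_ofPeriods (p : T.Vertex → ℂ) (W : ℂ × ℂ) (x : D × (ℤ × ℤ)) :
    T.dif (T.ofPeriods p W) x = T.grad p x.1 + combo W (T.shift x.1) := by
  rw [dif, ofPeriods_add, ofPeriods, ofPeriods, grad]
  ring

theorem vec_ofPeriods (p : T.Vertex → ℂ) (W : ℂ × ℂ) (d : D) :
    T.vec (T.ofPeriods p W) d = T.grad p d + combo W (T.shift d) :=
  T.dif_ofPeriods p W (d, 0)

theorem vec_ofPeriods_flip (p : T.Vertex → ℂ) (W : ℂ × ℂ) (d : D) :
    T.vec (T.ofPeriods p W) (T.flip d) = - T.vec (T.ofPeriods p W) d := by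
  rw [vec_ofPeriods, vec_ofPeriods, grad_flip, combo_shift_flip]
  ring

theorem onVertices_head_sub_tail {A : Type*} [AddGroup A] (h : T.Vertex → ℤ × ℤ → A)
    (x : D × (ℤ × ℤ)) :
    T.onVertices h (T.cover.head x) - T.onVertices h (T.cover.tail x) = T.dif h x := by
  obtain ⟨d, n⟩ := x
  rw [onVertices, onVertices, vtx_head, vtx_tail]
  rfl

/-- The periods of the maps to the torus `S_τ`. -/
noncomputable def periods (τ : UpperHalfPlane) : ℂ × ℂ :=
  (1 / ((Real.sqrt τ.im : ℝ) : ℂ), (τ : ℂ) / ((Real.sqrt τ.im : ℝ) : ℂ))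

theorem combo_periods (τ : UpperHalfPlane) (n : ℤ × ℤ) : combo (periods τ) n = holonomy τ n := by
  rw [combo, periods, holonomy]
  ring

theorem isLift_iff {τ : UpperHalfPlane} {h : T.cover.Vertex → ℂ} :
    T.IsLift τ h ↔ ∃ p, h = T.onVertices (T.ofPeriods p (periods τ)) := by
  constructor
  · intro hh
    refine ⟨fun v => h (Function.surjInv T.vtx_surjective (v, 0)), funext fun v => ?_⟩
    obtain ⟨⟨d, n⟩, rfl⟩ := T.cover.tail_surjective v
    have h1 : Function.surjInv T.vtx_surjective (T.tail d, 0) = T.cover.tail (d, 0) :=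
      T.vtx_injective (Function.surjInv_eq _ _)
    have h2 := hh d 0 n
    rw [zero_add] at h2
    rw [onVertices, vtx_tail, ofPeriods, combo_periods, h2, h1]
  · rintro ⟨p, rfl⟩ d m n
    rw [onVertices, onVertices, vtx_tail, vtx_tail, ofPeriods_add, combo_periods]

theorem energy_onVertices (c : D → ℝ) (h : T.Vertex → ℤ × ℤ → ℂ) :
    T.energy c (T.onVertices h) = 1 / 4 * ∑ d, c d * ‖T.vec h d‖ ^ 2 := by
  simp only [energy, onVertices_head_sub_tail]
  rw [← mul_assoc]
  norm_num
  rfl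

theorem sq_norm_eq (z : ℂ) : ‖z‖ ^ 2 = z.re * z.re + z.im * z.im := by
  rw [Complex.sq_norm, Complex.normSq_apply]

theorem sq_norm_add (z w : ℂ) : ‖z + w‖ ^ 2 = ‖z‖ ^ 2 + 2 * cdot w z + ‖w‖ ^ 2 := by
  simp only [sq_norm_eq, cdot_def, Complex.add_re, Complex.add_im]
  ring

theorem eq_zero_of_forall_quadratic {a b : ℝ} (h : ∀ t : ℝ, 0 ≤ t * a + t ^ 2 * b) : a = 0 := by
  have hb : 0 < 2 * |b| + 1 := by positivity
  -- At this `t` the quadratic equals `(a / (2 * |b| + 1)) ^ 2` times the negative number `b - (2 *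
  -- |b| + 1)`.
  have h1 := h (-a / (2 * |b| + 1))
  have h2 : -a / (2 * |b| + 1) * a + (-a / (2 * |b| + 1)) ^ 2 * b =
      (a / (2 * |b| + 1)) ^ 2 * (b - (2 * |b| + 1)) := by
    field_simp
    ring
  rw [h2] at h1
  have h3 : b - (2 * |b| + 1) < 0 := by linarith [le_abs_self b, abs_nonneg b]
  have h4 : (a / (2 * |b| + 1)) ^ 2 = 0 := by
    by_contra h5
    have h6 : 0 < (a / (2 * |b| + 1)) ^ 2 := lt_of_le_of_ne (sq_nonneg _) (Ne.symm h5)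
    nlinarith
  have h5 := pow_eq_zero_iff (two_ne_zero) |>.1 h4
  rw [div_eq_zero_iff] at h5
  exact h5.resolve_right hb.ne'

section Minimizer

variable {c : D → ℝ} {p : T.Vertex → ℂ} {W : ℂ × ℂ}

/-- A minimizer of the energy for fixed periods is in equilibrium. -/
theorem coclosed_of_forall_le
    (hmin : ∀ p', ∑ d, c d * ‖T.vec (T.ofPeriods p W) d‖ ^ 2 ≤
      ∑ d, c d * ‖T.vec (T.ofPeriods p' W) d‖ ^ 2) (hc : ∀ d, c (T.flip d) = c d) :
    T.Coclosed (fun d => (c d : ℂ) * T.vec (T.ofPeriods p W) d) := by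
  classical
  have := Fintype.ofFinite T.Vertex
  set e := T.vec (T.ofPeriods p W) with he
  -- The net force at a vertex, used also as the direction of variation: the derivative is then a
  -- nonzero multiple of `∑ v, normSq (S v)`.
  set S : T.Vertex → ℂ := fun v =>
    ∑ d ∈ Finset.univ.filter (fun d => T.tail d = v), (c d : ℂ) * e d with hS
  have hvec : ∀ (t : ℝ) d, T.vec (T.ofPeriods (fun v => p v + (t : ℂ) * S v) W) d =
      e d + (t : ℂ) * T.grad S d := by
    intro t d
    rw [he, vec_ofPeriods, vec_ofPeriods]
    simp only [grad]
    ring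
  have h1 : ∑ d, c d * cdot (T.grad S d) (e d) = 0 := by
    have h2 : 2 * ∑ d, c d * cdot (T.grad S d) (e d) = 0 := by
      apply eq_zero_of_forall_quadratic (b := ∑ d, c d * ‖T.grad S d‖ ^ 2)
      intro t
      have h3 := hmin (fun v => p v + (t : ℂ) * S v)
      have h4 : ∀ d, c d * ‖T.vec (T.ofPeriods (fun v => p v + (t : ℂ) * S v) W) d‖ ^ 2 =
          c d * ‖e d‖ ^ 2 + t * (2 * (c d * cdot (T.grad S d) (e d))) +
            t ^ 2 * (c d * ‖T.grad S d‖ ^ 2) := by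
        intro d
        rw [hvec, sq_norm_add, norm_mul, mul_pow, Complex.norm_real, Real.norm_eq_abs, sq_abs]
        simp only [cdot_def, Complex.re_ofReal_mul, Complex.im_ofReal_mul]
        ring
      simp only [h4, Finset.sum_add_distrib, ← Finset.mul_sum] at h3
      linarith
    linarith
  have h2 : ∑ d, (c d : ℂ) * e d * T.grad (fun v => (starRingEnd ℂ) (S v)) d =
      - (2 * ∑ d, (starRingEnd ℂ) (S (T.tail d)) * ((c d : ℂ) * e d)) :=
    sum_mul_grad (T := T) (α := fun d => (c d : ℂ) * e d)
      (fun d => by rw [hc, he, vec_ofPeriods_flip, mul_neg]) _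
  rw [sum_tail_mul (fun v => (starRingEnd ℂ) (S v))] at h2
  have h3 := congrArg Complex.re h2
  have h4 : ∀ d, ((c d : ℂ) * e d * T.grad (fun v => (starRingEnd ℂ) (S v)) d).re =
      c d * cdot (T.grad S d) (e d) := by
    intro d
    rw [mul_assoc, Complex.re_ofReal_mul, mul_comm (e d), cdot, grad, grad, map_sub]
  rw [Complex.re_sum] at h3
  simp only [h4, h1] at h3
  have h5 : ∑ v, Complex.normSq (S v) = 0 := by
    rw [Complex.neg_re, ← Complex.ofReal_ofNat, Complex.re_ofReal_mul, Complex.re_sum] at h3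
    have h6 : ∀ v, ((starRingEnd ℂ) (S v) * S v).re = Complex.normSq (S v) := by
      intro v
      rw [← Complex.normSq_eq_conj_mul_self, Complex.ofReal_re]
    have h7 : ∑ v, ((starRingEnd ℂ) (S v) * S v).re = 0 := by
      change (0 : ℝ) = -(2 * ∑ v, ((starRingEnd ℂ) (S v) * S v).re) at h3
      linarith
    simpa only [h6] using h7
  intro v
  rw [Finset.sum_eq_zero_iff_of_nonneg fun v _ => Complex.normSq_nonneg _] at h5
  have h6 := Complex.normSq_eq_zero.1 (h5 v (Finset.mem_univ v))
  simp only [hS] at h6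
  convert h6

theorem norm_vec_smul (u : ℂ) (p : T.Vertex → ℂ) (W : ℂ × ℂ) (d : D) :
    T.vec (T.ofPeriods (fun v => u * p v) (u * W.1, u * W.2)) d =
      u * T.vec (T.ofPeriods p W) d := by
  simp only [vec_ofPeriods, grad, combo]
  ring

/-- Every pair of periods of a unit-area parallelogram becomes the pair of periods of a point of
the upper half-plane after a rotation. -/
theorem exists_rotation (hW : cross W.1 W.2 = 1) :
    ∃ (u : ℂ) (τ : UpperHalfPlane), ‖u‖ = 1 ∧ periods τ = (u * W.1, u * W.2) := by
  have h0 : W.1 ≠ 0 := by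
    intro h
    rw [h] at hW
    simp [cross] at hW
  have hn : 0 < ‖W.1‖ := norm_pos_iff.2 h0
  have him : (W.2 / W.1).im = 1 / ‖W.1‖ ^ 2 := by
    rw [Complex.div_im, ← hW, cross_def, ← Complex.normSq_eq_norm_sq]
    ring
  have hτ : 0 < (W.2 / W.1).im := by
    rw [him]
    positivity
  have hs : Real.sqrt (W.2 / W.1).im = 1 / ‖W.1‖ := by
    rw [him, ← one_div_pow, Real.sqrt_sq (by positivity)]
  have hcn : ((‖W.1‖ : ℝ) : ℂ) ≠ 0 := by exact_mod_cast hn.ne'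
  refine ⟨(‖W.1‖ : ℝ) / W.1, ⟨W.2 / W.1, hτ⟩, ?_, ?_⟩
  · rw [norm_div, Complex.norm_real, norm_norm, div_self hn.ne']
  · have h1 : (UpperHalfPlane.mk (W.2 / W.1) hτ).im = (W.2 / W.1).im := rfl
    have h2 : ((UpperHalfPlane.mk (W.2 / W.1) hτ : UpperHalfPlane) : ℂ) = W.2 / W.1 := rfl
    rw [periods, h1, h2, hs]
    apply Prod.ext
    · push_cast
      field_simp
    · push_cast
      field_simp

theorem cross_periods (τ : UpperHalfPlane) : cross (periods τ).1 (periods τ).2 = 1 := by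
  have h1 : 0 < Real.sqrt τ.im := Real.sqrt_pos.2 τ.im_pos
  have h2 : Real.sqrt τ.im * Real.sqrt τ.im = τ.im := Real.mul_self_sqrt τ.im_pos.le
  have h3 : cross (periods τ).1 (periods τ).2 = τ.im / (Real.sqrt τ.im * Real.sqrt τ.im) := by
    rw [cross_def, periods, ← Complex.ofReal_one, ← Complex.ofReal_div, Complex.div_ofReal_im]
    simp only [Complex.ofReal_re, Complex.ofReal_im, UpperHalfPlane.coe_im]
    rw [zero_mul, sub_zero, div_mul_div_comm, one_mul]
  rw [h3, h2, div_self τ.im_pos.ne']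

/-- Compose the map with the area-preserving maps `z ↦ a * z + b * conj z`, where `b = -t * Z` and
`a ^ 2 - ‖b‖ ^ 2 = 1`. The sum `A` grows by `2 * t ^ 2 * ‖Z‖ ^ 2 * A - 2 * a * t * ‖Z‖ ^ 2`, so
minimality with `Z ≠ 0` would give `1 ≤ t * A` for all positive `t`. -/
theorem sum_sq_eq_zero_of_forall_le (hW : cross W.1 W.2 = 1)
    (hmin : ∀ p' W', cross W'.1 W'.2 = 1 → ∑ d, c d * ‖T.vec (T.ofPeriods p W) d‖ ^ 2 ≤
      ∑ d, c d * ‖T.vec (T.ofPeriods p' W') d‖ ^ 2) :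
    ∑ d, (c d : ℂ) * T.vec (T.ofPeriods p W) d ^ 2 = 0 := by
  set e := T.vec (T.ofPeriods p W) with he
  set Z := ∑ d, (c d : ℂ) * e d ^ 2 with hZ
  set A := ∑ d, c d * ‖e d‖ ^ 2 with hA
  by_contra hne
  have hZ0 : 0 < ‖Z‖ ^ 2 := by
    have := norm_pos_iff.2 hne
    positivity
  have key : ∀ t : ℝ, 0 < t → 1 ≤ t * A := by
    intro t ht
    set a := Real.sqrt (1 + t ^ 2 * ‖Z‖ ^ 2) with ha
    have ha2 : a ^ 2 = 1 + t ^ 2 * ‖Z‖ ^ 2 := Real.sq_sqrt (by positivity)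
    have ha1 : 1 ≤ a := by
      rw [ha]
      apply Real.one_le_sqrt.2
      have : 0 ≤ t ^ 2 * ‖Z‖ ^ 2 := by positivity
      linarith
    set b : ℂ := -((t : ℂ) * Z) with hb
    have hb2 : ‖b‖ ^ 2 = t ^ 2 * ‖Z‖ ^ 2 := by
      rw [hb, norm_neg, norm_mul, mul_pow, Complex.norm_real, Real.norm_eq_abs, sq_abs]
    let f : ℂ → ℂ := fun z => (a : ℂ) * z + b * (starRingEnd ℂ) z
    have hcr : cross (f W.1) (f W.2) = 1 := by
      have h1 : cross (f W.1) (f W.2) = (a ^ 2 - ‖b‖ ^ 2) * cross W.1 W.2 := by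
        simp only [f, cross_def, sq_norm_eq, Complex.add_re, Complex.add_im, Complex.mul_re,
          Complex.mul_im, Complex.conj_re, Complex.conj_im, Complex.ofReal_re, Complex.ofReal_im]
        ring
      rw [h1, hW, hb2, ha2]
      ring
    have h1 := hmin (fun v => f (p v)) (f W.1, f W.2) hcr
    have h2 : ∀ d, T.vec (T.ofPeriods (fun v => f (p v)) (f W.1, f W.2)) d = f (e d) := by
      intro d
      simp only [he, vec_ofPeriods, grad, combo, f, map_add, map_sub, map_mul, map_intCast]
      ring
    have h3 : ∀ d, c d * ‖f (e d)‖ ^ 2 = (a ^ 2 + ‖b‖ ^ 2) * (c d * ‖e d‖ ^ 2) +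
        2 * a * ((starRingEnd ℂ) b * ((c d : ℂ) * e d ^ 2)).re := by
      intro d
      simp only [f, sq_norm_eq, Complex.add_re, Complex.add_im, Complex.mul_re, pow_two (e d),
        Complex.mul_im, Complex.conj_re, Complex.conj_im, Complex.ofReal_re, Complex.ofReal_im]
      ring
    simp only [h2, h3, Finset.sum_add_distrib, ← Finset.mul_sum, ← Complex.re_sum] at h1
    have h4 : ((starRingEnd ℂ) b * Z).re = - (t * ‖Z‖ ^ 2) := by
      rw [hb, sq_norm_eq]
      simp only [map_neg, map_mul, Complex.conj_ofReal, neg_mul, Complex.neg_re, Complex.mul_re,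
        Complex.mul_im, Complex.conj_re, Complex.conj_im, Complex.ofReal_re, Complex.ofReal_im]
      ring
    rw [← hZ, h4, ← hA, ha2, hb2] at h1
    have h5 : a * (t * ‖Z‖ ^ 2) ≤ t ^ 2 * ‖Z‖ ^ 2 * A := by linarith
    have h6 : t * ‖Z‖ ^ 2 ≤ t * ‖Z‖ ^ 2 * (t * A) := by
      have : 0 < t * ‖Z‖ ^ 2 := by positivity
      nlinarith
    have h7 : 0 < t * ‖Z‖ ^ 2 := by positivity
    by_contra h8
    push Not at h8
    nlinarith
  have h1 := key 1 one_pos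
  have h2 := key (1 / (2 * A)) (by
    have : 0 < A := by linarith
    positivity)
  have h3 : 1 / (2 * A) * A = 1 / 2 := by
    have : A ≠ 0 := by linarith
    field_simp
  linarith

variable {T}

/-- The bilinear relation for a conjugate map and an arbitrary second map. The right side does not
involve `p'`, which is what permits comparison with all competitors. -/
theorem sum_energy_pairing {q : T.Face → ℂ} {P : ℂ × ℂ}
    (hq : ∀ d, Complex.I * (c d : ℂ) * T.vec (T.ofPeriods p W) d =
      T.cograd q d + combo P (T.coshift d)) (p' : T.Vertex → ℂ) (W' : ℂ × ℂ) :
    Complex.I * ∑ d, (c d : ℂ) * (T.vec (T.ofPeriods p W) d * T.vec (T.ofPeriods p' W') d) =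
      -2 * (P.1 * W'.2 - P.2 * W'.1) := by
  rw [← T.sum_cograd_mul_grad q P p' W', Finset.mul_sum]
  refine Finset.sum_congr rfl fun d _ => ?_
  rw [← hq, ← T.vec_ofPeriods p' W']
  ring

theorem vec_conj (p : T.Vertex → ℂ) (W : ℂ × ℂ) (d : D) :
    T.vec (T.ofPeriods (fun v => (starRingEnd ℂ) (p v))
      ((starRingEnd ℂ) W.1, (starRingEnd ℂ) W.2)) d =
      (starRingEnd ℂ) (T.vec (T.ofPeriods p W) d) := by
  simp only [vec_ofPeriods, grad, combo, map_add, map_sub, map_mul, map_intCast]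

theorem sum_energy_pairing_conj {q : T.Face → ℂ} {P : ℂ × ℂ}
    (hq : ∀ d, Complex.I * (c d : ℂ) * T.vec (T.ofPeriods p W) d =
      T.cograd q d + combo P (T.coshift d)) (p' : T.Vertex → ℂ) (W' : ℂ × ℂ) :
    Complex.I * ∑ d, (c d : ℂ) * (T.vec (T.ofPeriods p W) d *
        (starRingEnd ℂ) (T.vec (T.ofPeriods p' W') d)) =
      -2 * (P.1 * (starRingEnd ℂ) W'.2 - P.2 * (starRingEnd ℂ) W'.1) := by
  rw [← sum_energy_pairing hq (fun v => (starRingEnd ℂ) (p' v))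
    ((starRingEnd ℂ) W'.1, (starRingEnd ℂ) W'.2)]
  simp only [vec_conj]

/-- For a conjugate map whose periods are `k` times those of the map, `k` is the energy. -/
theorem energy_eq_of_periods {q : T.Face → ℂ} {P : ℂ × ℂ}
    (hq : ∀ d, Complex.I * (c d : ℂ) * T.vec (T.ofPeriods p W) d =
      T.cograd q d + combo P (T.coshift d)) (hW : cross W.1 W.2 = 1) {k : ℂ}
    (h1 : P.1 = k * W.1) (h2 : P.2 = k * W.2) :
    k = ((1 / 4 * ∑ d, c d * ‖T.vec (T.ofPeriods p W) d‖ ^ 2 : ℝ) : ℂ) := by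
  have h := sum_energy_pairing_conj hq p W
  simp only [Complex.mul_conj'] at h
  rw [h1, h2] at h
  have h3 : W.1 * (starRingEnd ℂ) W.2 - W.2 * (starRingEnd ℂ) W.1 = -2 * Complex.I := by
    have h4 : cross W.1 W.2 = W.1.re * W.2.im - W.1.im * W.2.re := cross_def _ _
    rw [hW] at h4
    apply Complex.ext
    · simp
      ring
    · simp
      linarith
  have h5 : Complex.I * ∑ d, (c d : ℂ) * (‖T.vec (T.ofPeriods p W) d‖ : ℂ) ^ 2 =
      Complex.I * (4 * k) := by
    rw [h]
    linear_combination (-2 * k) * h3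
  have h6 := mul_left_cancel₀ Complex.I_ne_zero h5
  push_cast
  rw [h6]
  ring

/-- Pairing the map with itself gives `P.1 * W.2 = P.2 * W.1`, so `P` is a complex multiple of `W`;
by `energy_eq_of_periods` the factor is the energy. -/
theorem periods_eq_of_sum_sq_eq_zero {q : T.Face → ℂ} {P : ℂ × ℂ}
    (hq : ∀ d, Complex.I * (c d : ℂ) * T.vec (T.ofPeriods p W) d =
      T.cograd q d + combo P (T.coshift d)) (hW : cross W.1 W.2 = 1)
    (hZ : ∑ d, (c d : ℂ) * T.vec (T.ofPeriods p W) d ^ 2 = 0) :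
    P.1 = ((1 / 4 * ∑ d, c d * ‖T.vec (T.ofPeriods p W) d‖ ^ 2 : ℝ) : ℂ) * W.1 ∧
      P.2 = ((1 / 4 * ∑ d, c d * ‖T.vec (T.ofPeriods p W) d‖ ^ 2 : ℝ) : ℂ) * W.2 := by
  have h0 : W.1 ≠ 0 := by
    intro h
    rw [h] at hW
    simp [cross] at hW
  have h := sum_energy_pairing hq p W
  simp only [← pow_two] at h
  rw [hZ, mul_zero] at h
  have h1 : P.1 = P.1 / W.1 * W.1 := by field_simp
  have h2 : P.2 = P.1 / W.1 * W.2 := by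
    field_simp
    linear_combination (-1 / 2 : ℂ) * h
  have h3 := energy_eq_of_periods hq hW h1 h2
  rw [← h3]
  exact ⟨h1, h2⟩

/-- Pair the map with the complex conjugate of a competitor. The norm of the pairing is at most half
the sum of the two quadratic sums, and by the periods it is at least `4 * k`, which is the quadratic
sum of the map itself. -/
theorem le_of_periods (hc : ∀ d, 0 < c d) {q : T.Face → ℂ} {τ : UpperHalfPlane} {P : ℂ × ℂ}
    (hq : ∀ d, Complex.I * (c d : ℂ) * T.vec (T.ofPeriods p (periods τ)) d =
      T.cograd q d + combo P (T.coshift d)) {k : ℝ} (hk : 0 < k)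
    (h1 : P.1 = k * (periods τ).1) (h2 : P.2 = k * (periods τ).2) (p' : T.Vertex → ℂ)
    (τ' : UpperHalfPlane) :
    ∑ d, c d * ‖T.vec (T.ofPeriods p (periods τ)) d‖ ^ 2 ≤
      ∑ d, c d * ‖T.vec (T.ofPeriods p' (periods τ')) d‖ ^ 2 := by
  have hE := energy_eq_of_periods hq (cross_periods τ) h1 h2
  have hE' : k = 1 / 4 * ∑ d, c d * ‖T.vec (T.ofPeriods p (periods τ)) d‖ ^ 2 := by
    exact_mod_cast hE
  have h := congrArg norm (sum_energy_pairing_conj hq p' (periods τ'))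
  rw [norm_mul, Complex.norm_I, one_mul] at h
  have hle : ‖∑ d, (c d : ℂ) * (T.vec (T.ofPeriods p (periods τ)) d *
      (starRingEnd ℂ) (T.vec (T.ofPeriods p' (periods τ')) d))‖ ≤
      1 / 2 * ∑ d, c d * ‖T.vec (T.ofPeriods p (periods τ)) d‖ ^ 2 +
      1 / 2 * ∑ d, c d * ‖T.vec (T.ofPeriods p' (periods τ')) d‖ ^ 2 := by
    refine (norm_sum_le _ _).trans ?_
    rw [Finset.mul_sum, Finset.mul_sum, ← Finset.sum_add_distrib]
    refine Finset.sum_le_sum fun d _ => ?_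
    rw [norm_mul, norm_mul, Complex.norm_real, Real.norm_eq_abs, abs_of_pos (hc d),
      RCLike.norm_conj]
    nlinarith [hc d, mul_nonneg (hc d).le (sq_nonneg (‖T.vec (T.ofPeriods p (periods τ)) d‖ -
      ‖T.vec (T.ofPeriods p' (periods τ')) d‖))]
  -- The pairing is a positive multiple of `τ - conj τ'`, whose imaginary part `τ.im + τ'.im` is at
  -- least twice the geometric mean.
  have hge : 4 * k ≤ ‖-2 * (P.1 * (starRingEnd ℂ) (periods τ').2 -
      P.2 * (starRingEnd ℂ) (periods τ').1)‖ := by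
    have hs : 0 < Real.sqrt τ.im := Real.sqrt_pos.2 τ.im_pos
    have hs' : 0 < Real.sqrt τ'.im := Real.sqrt_pos.2 τ'.im_pos
    have e1 : Real.sqrt τ.im * Real.sqrt τ.im = τ.im := Real.mul_self_sqrt τ.im_pos.le
    have e2 : Real.sqrt τ'.im * Real.sqrt τ'.im = τ'.im := Real.mul_self_sqrt τ'.im_pos.le
    have h3 : -2 * (P.1 * (starRingEnd ℂ) (periods τ').2 - P.2 * (starRingEnd ℂ) (periods τ').1) =
        ((2 * k / (Real.sqrt τ.im * Real.sqrt τ'.im) : ℝ) : ℂ) *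
          ((τ : ℂ) - (starRingEnd ℂ) (τ' : ℂ)) := by
      rw [h1, h2]
      simp only [periods, map_div₀, map_one, Complex.conj_ofReal]
      push_cast
      have f1 : ((Real.sqrt τ.im : ℝ) : ℂ) ≠ 0 := by exact_mod_cast hs.ne'
      have f2 : ((Real.sqrt τ'.im : ℝ) : ℂ) ≠ 0 := by exact_mod_cast hs'.ne'
      field_simp
      ring
    rw [h3, norm_mul, Complex.norm_real, Real.norm_eq_abs, abs_of_pos (by positivity)]
    have h4 : τ.im + τ'.im ≤ ‖(τ : ℂ) - (starRingEnd ℂ) (τ' : ℂ)‖ := by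
      have := (le_abs_self _).trans (Complex.abs_im_le_norm ((τ : ℂ) - (starRingEnd ℂ) (τ' : ℂ)))
      simpa using this
    refine le_trans ?_ (mul_le_mul_of_nonneg_left h4 (by positivity))
    rw [div_mul_eq_mul_div, le_div_iff₀ (by positivity)]
    nlinarith [mul_nonneg hk.le (sq_nonneg (Real.sqrt τ.im - Real.sqrt τ'.im))]
  rw [← h] at hge
  linarith

end Minimizer

/-! ### Conjugate maps and their periods. -/

section Conjugate

theorem onFaces_left_sub_right (q : T.Face → ℂ) (P : ℂ × ℂ) (x : D × (ℤ × ℤ)) :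
    T.onFaces (fun f n => q f + combo P n) (T.cover.left x) -
      T.onFaces (fun f n => q f + combo P n) (T.cover.right x) =
        T.cograd q x.1 + combo P (T.coshift x.1) := by
  obtain ⟨d, n⟩ := x
  rw [CombinatorialMap.right, cover_flip, onFaces, onFaces, fce_left, fce_left]
  simp only [cograd, CombinatorialMap.right, coshift_eq, combo_sub, combo_add]
  ring

theorem cover_eq_of_invariant (hconn : T.cover.IsThreeConnected) {A : Type*}
    {f : D × (ℤ × ℤ) → A} (h1 : ∀ x, f (T.cover.flip x) = f x) (h2 : ∀ x, f (T.cover.rot x) = f x)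
    (x y : D × (ℤ × ℤ)) : f x = f y := by
  have hrot : ∀ d d' n, T.tail d = T.tail d' → f (d, n) = f (d', n) := by
    intro d d' n h
    obtain ⟨i, -, rfl⟩ := exists_iterate_lt_minimalPeriod (T.tail_eq_iff.1 h)
    rw [← cover_rot_iterate, iterate_invariant h2]
  refine T.mem_of_closed' hconn {w | ∀ d, T.tail d = w.1 → f (d, w.2) = f y}
    ⟨(T.tail y.1, y.2), fun d hd => ?_⟩ (fun d n hd d' hd' => ?_) (T.tail x.1, x.2) x.1 rfl
  · exact hrot _ _ _ hd
  · have h3 : f (d, n) = f y := hd d rfl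
    rw [← h3, ← h1 (d, n), cover_flip]
    exact hrot _ _ _ hd'

variable {T}

theorem exists_onFaces (hconn : T.cover.IsThreeConnected) {g g' : T.cover.Face → ℂ}
    (h : ∀ x, g (T.cover.left x) - g (T.cover.right x) =
      g' (T.cover.left x) - g' (T.cover.right x)) : ∃ a, ∀ f, g f = g' f + a := by
  obtain ⟨d⟩ := T.nonempty_dart
  refine ⟨g (T.cover.left (d, 0)) - g' (T.cover.left (d, 0)), fun f => ?_⟩
  obtain ⟨x, rfl⟩ := T.cover.left_surjective f
  have h1 : ∀ x, g (T.cover.left (T.cover.flip x)) - g' (T.cover.left (T.cover.flip x)) =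
      g (T.cover.left x) - g' (T.cover.left x) := by
    intro x
    have h2 : T.cover.right x = T.cover.left (T.cover.flip x) := rfl
    rw [← h2]
    linear_combination - h x
  have := T.cover_eq_of_invariant hconn
    (f := fun x => g (T.cover.left x) - g' (T.cover.left x)) h1
    (fun x => by
      have h2 := h1 (T.cover.rot x)
      rw [T.cover.left_flip_rot] at h2
      exact h2.symm) x (d, 0)
  linear_combination this

/-- A conjugate map differs by a constant from the one built by the Hodge decomposition of the
rotated flux, so it inherits periods `P`. -/
theorem IsConjugate.exists_eq (hconn : T.cover.IsThreeConnected) {c : D → ℝ} {p : T.Vertex → ℂ}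
    {W : ℂ × ℂ} (hc : ∀ d, c (T.flip d) = c d)
    (hp : T.Coclosed (fun d => (c d : ℂ) * T.vec (T.ofPeriods p W) d)) {hs : T.cover.Face → ℂ}
    (hhs : T.IsConjugate c (T.onVertices (T.ofPeriods p W)) hs) :
    ∃ q P, hs = T.onFaces (fun f n => q f + combo P n) ∧
      ∀ d, Complex.I * (c d : ℂ) * T.vec (T.ofPeriods p W) d =
        T.cograd q d + combo P (T.coshift d) := by
  obtain ⟨q, P, hq⟩ := Coclosed.exists_eq_complex (T := T)
    (f := fun d => Complex.I * ((c d : ℂ) * T.vec (T.ofPeriods p W) d)) (fun v => by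
      rw [← Finset.mul_sum, hp v, mul_zero]) (fun d => by
      rw [hc, vec_ofPeriods_flip]
      ring)
  obtain ⟨a, ha⟩ := exists_onFaces hconn (g := hs)
    (g' := T.onFaces (fun f n => q f + combo P n)) (fun x => by
      rw [hhs x, onVertices_head_sub_tail, onFaces_left_sub_right, ← hq, dif_ofPeriods,
        vec_ofPeriods]
      ring)
  refine ⟨fun f => q f + a, P, funext fun f => ?_, fun d => ?_⟩
  · rw [ha, onFaces, onFaces]
    ring
  · rw [mul_assoc, hq, cograd, cograd]
    ring

theorem exists_isConjugate {c : D → ℝ} {p : T.Vertex → ℂ} {W : ℂ × ℂ}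
    (hc : ∀ d, c (T.flip d) = c d)
    (hp : T.Coclosed (fun d => (c d : ℂ) * T.vec (T.ofPeriods p W) d)) :
    ∃ hs, T.IsConjugate c (T.onVertices (T.ofPeriods p W)) hs := by
  obtain ⟨q, P, hq⟩ := Coclosed.exists_eq_complex (T := T)
    (f := fun d => Complex.I * ((c d : ℂ) * T.vec (T.ofPeriods p W) d)) (fun v => by
      rw [← Finset.mul_sum, hp v, mul_zero]) (fun d => by
      rw [hc, vec_ofPeriods_flip]
      ring)
  refine ⟨T.onFaces (fun f n => q f + combo P n), fun x => ?_⟩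
  rw [onVertices_head_sub_tail, onFaces_left_sub_right, ← hq, dif_ofPeriods, vec_ofPeriods]
  ring

end Conjugate

end MarkedTorus

/-! ### Convex polygons with sides orthogonal to a balanced cycle. -/

theorem cdot_I_mul_right (z w : ℂ) : cdot z (Complex.I * w) = - cross z w := by
  simp [cross_def, cdot_def]
  ring

theorem cross_I_mul_right (z w : ℂ) : cross z (Complex.I * w) = cdot z w := by
  simp [cross_def, cdot_def]

theorem cdot_comm (z w : ℂ) : cdot z w = cdot w z := by
  rw [cdot_def, cdot_def]
  ring

theorem cdot_real_mul_left (e z : ℂ) (r : ℝ) : cdot ((r : ℂ) * e) z = r * cdot e z := by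
  rw [cdot_comm, cdot_real_mul, cdot_comm]

theorem cdot_conj (z w : ℂ) : cdot z ((starRingEnd ℂ) w) = cdot ((starRingEnd ℂ) z) w := by
  simp [cdot_def]

theorem cross_conj (z w : ℂ) :
    cross ((starRingEnd ℂ) z) ((starRingEnd ℂ) w) = - cross z w := by
  simp [cross_def]
  ring

theorem cross_sub (z w w' : ℂ) : cross z (w - w') = cross z w - cross z w' := by
  simp only [cross, mul_sub, Complex.sub_im]

theorem cross_add (z w w' : ℂ) : cross z (w + w') = cross z w + cross z w' := by
  simp only [cross, mul_add, Complex.add_im]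

/-- Coordinates with respect to a basis of the plane. -/
theorem cross_mul_eq (z w r : ℂ) : (cross z w : ℂ) * r = (cross r w : ℂ) * z + (cross z r : ℂ) * w := by
  apply Complex.ext
  · simp [cross_def]
    ring
  · simp [cross_def]
    ring

namespace BalancedCycles

variable {D : Type*} {π : Equiv.Perm D} {wt : D → ℝ} {E : D → ℂ}

theorem conj (B : BalancedCycles π wt E) :
    BalancedCycles π wt (fun d => (starRingEnd ℂ) (E d)) where
  pos := B.pos
  sum d := by
    have h := congrArg (starRingEnd ℂ) (B.sum d)
    simpa only [map_sum, map_mul, Complex.conj_ofReal, map_zero] using h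
  not_alternates e e' he := by
    simp only [cdot_conj]
    exact B.not_alternates _ _ ((map_ne_zero _).2 he)

variable {a : D → ℂ} {k : ℝ}

/-- The corners of the polygon whose sides are, up to a rotation by a right angle, the vectors of a
cycle. -/
theorem cdot_iterate_sub (ha : ∀ d, a (π d) = a d + Complex.I * (((wt (π d) / k : ℝ) : ℂ) * E (π d)))
    (e : ℂ) (d : D) (l : ℕ) : cdot e (a (π^[l] d) - a d) =
      - (1 / k * ∑ j ∈ Finset.range l, wt (π^[j + 1] d) * cross e (E (π^[j + 1] d))) := by
  induction l with
  | zero => simp [cdot_zero]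
  | succ l ih =>
    rw [Finset.sum_range_succ, mul_add, neg_add, ← ih, Function.iterate_succ_apply', ha,
      add_sub_right_comm, cdot_add, cdot_I_mul_right, cross_real_mul]
    ring

theorem cdot_side_sub
    (ha : ∀ d, a (π d) = a d + Complex.I * (((wt (π d) / k : ℝ) : ℂ) * E (π d))) (d : D) :
    cdot (E (π d)) (a d - a (π d)) = 0 := by
  rw [ha, sub_add_cancel_left, cdot_neg_right, cdot_I_mul_right, cross_real_mul, cross_same]
  ring

/-- A point of the polygon on the line through a side lies on that side. -/
theorem mem_segment_of_cdot_eq_zero (B : BalancedCycles π wt E)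
    (hpos : ∀ d, 0 < cross (E d) (E (π d)))
    (hk : 0 < k) (ha : ∀ d, a (π d) = a d + Complex.I * (((wt (π d) / k : ℝ) : ℂ) * E (π d)))
    {d0 : D} {x : ℂ} (hx : ∀ d, π.SameCycle d0 d → cdot (E d) (x - a d) ≤ 0)
    (h0 : cdot (E (π d0)) (x - a (π d0)) = 0) :
    ∃ t : ℝ, 0 ≤ t ∧ t ≤ 1 ∧ x = a d0 + (t : ℂ) * (a (π d0) - a d0) := by
  have hE : E (π d0) ≠ 0 := by
    intro h
    have := hpos d0
    rw [h] at this
    simp [cross] at this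
  have hb : 0 < wt (π d0) / k := div_pos (B.pos _) hk
  obtain ⟨σ, hσ⟩ : ∃ σ : ℝ, x = a d0 + (σ : ℂ) * (Complex.I * E (π d0)) := by
    have h1 : cross (Complex.I * E (π d0)) (x - a (π d0)) = 0 := by
      rw [← cdot_I_mul, ← mul_assoc, Complex.I_mul_I, neg_one_mul, cdot_neg_left, h0, neg_zero]
    have h2 := eq_real_mul_of_cross_eq_zero (mul_ne_zero Complex.I_ne_zero hE) h1
    refine ⟨wt (π d0) / k + cdot (Complex.I * E (π d0)) (x - a (π d0)) /
      cdot (Complex.I * E (π d0)) (Complex.I * E (π d0)), ?_⟩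
    rw [Complex.ofReal_add, add_mul, ← h2, ha]
    ring
  -- The half-planes of the preceding and the following side bound the parameter below and above.
  refine ⟨σ / (wt (π d0) / k), ?_, ?_, ?_⟩
  · have h1 := hx d0 (Equiv.Perm.SameCycle.refl _ _)
    rw [hσ, add_sub_cancel_left, cdot_real_mul, cdot_I_mul_right] at h1
    have := hpos d0
    apply div_nonneg _ hb.le
    nlinarith
  · have h1 := hx (π (π d0)) ⟨2, by rw [zpow_two]; rfl⟩
    rw [ha, ha, hσ, add_assoc, add_sub_add_left_eq_sub, ← sub_sub, cdot_sub, cdot_sub,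
      cdot_real_mul, cdot_I_mul_right, cdot_I_mul_right, cdot_I_mul_right, cross_real_mul,
      cross_real_mul, cross_same, cross_comm (E (π d0))] at h1
    have := hpos (π d0)
    rw [div_le_one hb]
    nlinarith
  · rw [ha, hσ, add_sub_cancel_left]
    have : ((wt (π d0) / k : ℝ) : ℂ) ≠ 0 := by exact_mod_cast hb.ne'
    rw [Complex.ofReal_div σ]
    field_simp

variable [Finite D]

/-- The polygon is strictly convex. -/
theorem cdot_corner_neg (B : BalancedCycles π wt E) (hpos : ∀ d, 0 < cross (E d) (E (π d)))
    (hk : 0 < k) (ha : ∀ d, a (π d) = a d + Complex.I * (((wt (π d) / k : ℝ) : ℂ) * E (π d)))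
    {d d' : D} (hdd' : π.SameCycle d d') (h1 : d' ≠ d) (h2 : π d' ≠ d) :
    cdot (E d) (a d' - a d) < 0 := by
  obtain ⟨l, hl, rfl⟩ := exists_iterate_lt_minimalPeriod hdd'
  have hl0 : l ≠ 0 := by
    rintro rfl
    exact h1 rfl
  have hl1 : l + 1 ≠ Function.minimalPeriod π d := by
    intro h
    apply h2
    rw [← Function.iterate_succ_apply' π, Nat.succ_eq_add_one, h, Function.iterate_minimalPeriod]
  rw [cdot_iterate_sub ha]
  have := B.cross_sum_pos hpos d (l := l) (by omega) (by omega)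
  have h3 : 0 < 1 / k := by positivity
  nlinarith

theorem cdot_corner_nonpos (B : BalancedCycles π wt E) (hpos : ∀ d, 0 < cross (E d) (E (π d)))
    (hk : 0 < k) (ha : ∀ d, a (π d) = a d + Complex.I * (((wt (π d) / k : ℝ) : ℂ) * E (π d)))
    {d d' : D} (hdd' : π.SameCycle d d') : cdot (E d) (a d' - a d) ≤ 0 := by
  by_cases h1 : d' = d
  · rw [h1, sub_self, cdot_zero]
  · by_cases h2 : π d' = d
    · have := cdot_side_sub ha d'
      rw [h2] at this
      exact this.le
    · exact (B.cdot_corner_neg hpos hk ha hdd' h1 h2).le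

/-- The mirror image: conjugating `E` reverses the turns, and `-conj a` again satisfies the
recursion. -/
theorem cdot_corner_nonneg (B : BalancedCycles π wt E) (hneg : ∀ d, cross (E d) (E (π d)) < 0)
    (hk : 0 < k) (ha : ∀ d, a (π d) = a d + Complex.I * (((wt (π d) / k : ℝ) : ℂ) * E (π d)))
    {d d' : D} (hdd' : π.SameCycle d d') : 0 ≤ cdot (E d) (a d' - a d) := by
  have h := B.conj.cdot_corner_nonpos (a := fun d => - (starRingEnd ℂ) (a d)) (k := k)
    (fun d => by
      rw [cross_conj]
      linarith [hneg d]) hk (fun d => by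
      rw [ha, map_add, map_mul, map_mul, Complex.conj_I, Complex.conj_ofReal]
      ring) hdd'
  have h1 : -(starRingEnd ℂ) (a d') - -(starRingEnd ℂ) (a d) =
      - (starRingEnd ℂ) (a d' - a d) := by
    rw [map_sub]
    ring
  rw [h1, cdot_neg_right, cdot_conj, Complex.conj_conj] at h
  linarith

theorem apply_ne (hpos : ∀ d, 0 < cross (E d) (E (π d))) (d : D) : π d ≠ d ∧ π (π d) ≠ d := by
  have h := two_lt_minimalPeriod hpos d
  constructor
  · intro h1
    have : Function.minimalPeriod π d ≤ 1 :=
      Function.IsPeriodicPt.minimalPeriod_le one_pos h1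
    omega
  · intro h1
    have : Function.minimalPeriod π d ≤ 2 :=
      Function.IsPeriodicPt.minimalPeriod_le two_pos h1
    omega

/-- A point in the interior of the polygon, and the triangulation of the polygon with that
point. -/
theorem exists_center (B : BalancedCycles π wt E) (hpos : ∀ d, 0 < cross (E d) (E (π d)))
    (hk : 0 < k) (ha : ∀ d, a (π d) = a d + Complex.I * (((wt (π d) / k : ℝ) : ℂ) * E (π d)))
    (d0 : D) : ∃ o ∈ convexHull ℝ (a '' {d | π.SameCycle d0 d}),
      (∀ d, π.SameCycle d0 d → cdot (E d) (o - a d) < 0) ∧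
      ∀ x, (∀ d, π.SameCycle d0 d → cdot (E d) (x - a d) ≤ 0) →
        ∃ d, π.SameCycle d0 d ∧ ∃ s t : ℝ, 0 ≤ s ∧ 0 ≤ t ∧ s + t ≤ 1 ∧
          x = o + ((s : ℂ) * (a d - o) + (t : ℂ) * (a (π d) - o)) := by
  set N := Function.minimalPeriod π d0 with hN
  have hN2 : 2 < N := two_lt_minimalPeriod hpos d0
  have hN0 : (N : ℝ) ≠ 0 := by
    have : N ≠ 0 := by omega
    exact_mod_cast this
  have hcyc : ∀ i : ℕ, π.SameCycle d0 (π^[i] d0) := fun i =>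
    ⟨i, by rw [zpow_natCast, Equiv.Perm.coe_pow]⟩
  -- The centroid of the corners.
  set o : ℂ := ((1 / N : ℝ) : ℂ) * ∑ i ∈ Finset.range N, a (π^[i] d0) with ho
  have hosub : ∀ z, o - z = ((1 / N : ℝ) : ℂ) * ∑ i ∈ Finset.range N, (a (π^[i] d0) - z) := by
    intro z
    have hNc : (N : ℂ) ≠ 0 := by exact_mod_cast hN0
    rw [Finset.sum_sub_distrib, Finset.sum_const, Finset.card_range, nsmul_eq_mul, mul_sub, ← ho]
    push_cast
    field_simp
  have hoN : 0 < 1 / (N : ℝ) := by positivity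
  have hneg : ∀ d, π.SameCycle d0 d → cdot (E d) (o - a d) < 0 := by
    intro d hd
    rw [hosub, cdot_real_mul, cdot_sum]
    apply mul_neg_of_pos_of_neg hoN
    obtain ⟨i, hi, hi'⟩ := exists_iterate_lt_minimalPeriod
      (hd.trans ⟨1, by rw [zpow_one]⟩ : π.SameCycle d0 (π d))
    refine Finset.sum_neg' (fun j _ =>
      B.cdot_corner_nonpos hpos hk ha (hd.symm.trans (hcyc j))) ⟨i, Finset.mem_range.2 hi, ?_⟩
    rw [hi']
    obtain ⟨h1, h2⟩ := apply_ne hpos d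
    exact B.cdot_corner_neg hpos hk ha ⟨1, by rw [zpow_one]⟩ h1 h2
  refine ⟨o, ?_, hneg, fun x hx => ?_⟩
  · have h1 : o = ∑ i ∈ Finset.range N, (1 / N : ℝ) • a (π^[i] d0) := by
      rw [ho, Finset.mul_sum]
      refine Finset.sum_congr rfl fun i _ => ?_
      rw [Complex.real_smul]
    rw [h1]
    refine (convex_convexHull ℝ _).sum_mem (fun _ _ => hoN.le) ?_ fun i _ =>
      subset_convexHull ℝ _ ⟨_, hcyc i, rfl⟩
    rw [Finset.sum_const, Finset.card_range, nsmul_eq_mul, mul_one_div_cancel hN0]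
  set r := x - o with hr
  set f : ℕ → ℝ := fun i => cross r (a (π^[i] d0) - o) with hf
  have hfper : ∀ i, f (i + N) = f i := by
    intro i
    simp only [hf]
    rw [Function.iterate_add_apply, hN, Function.iterate_minimalPeriod]
  have hfsum : ∑ i ∈ Finset.range N, f i = 0 := by
    simp only [hf]
    rw [← cross_sum]
    have h1 := hosub o
    rw [sub_self, eq_comm, mul_eq_zero] at h1
    rw [h1.resolve_left (by exact_mod_cast hoN.ne'), cross, mul_zero, Complex.zero_im]
  -- Since `o` is the centroid, `f` sums to zero over a period and must pass from nonpositive to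
  -- nonnegative. The ray from `o` through `x` lies in the cone over that side.
  obtain ⟨i, hi1, hi2⟩ : ∃ i, f i ≤ 0 ∧ 0 ≤ f (i + 1) := by
    by_contra! hcon
    obtain ⟨i0, hi0, hi0'⟩ : ∃ i ∈ Finset.range N, f i ≤ 0 := by
      apply Finset.exists_le_of_sum_le (f := f) (g := fun _ => 0) ⟨0, Finset.mem_range.2 (by omega)⟩
      rw [hfsum, Finset.sum_const_zero]
    have h1 : ∀ j, f (i0 + 1 + j) < 0 := by
      intro j
      induction j with
      | zero => exact hcon _ hi0'
      | succ j ih => exact hcon _ ih.le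
    have h2 : ∑ i ∈ Finset.range N, f i < 0 := by
      apply Finset.sum_neg
      · intro i _
        rw [Finset.mem_range] at hi0
        rw [← hfper i, show i + N = i0 + 1 + (i + N - (i0 + 1)) by omega]
        exact h1 _
      · exact ⟨0, Finset.mem_range.2 (by omega)⟩
    exact h2.ne hfsum
  set d := π^[i] d0 with hd
  have hi1' : cross r (a d - o) ≤ 0 := hi1
  have hi2' : 0 ≤ cross r (a (π d) - o) := by
    have := hi2
    simp only [hf, Function.iterate_succ_apply'] at this
    exact this
  have hcd : π.SameCycle d0 (π d) := (hcyc i).trans ⟨1, by rw [zpow_one]⟩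
  have hside := cdot_side_sub ha d
  set l := cdot (E (π d)) (o - a (π d)) with hl
  have hl0 : l < 0 := hneg _ hcd
  have hA : cdot (E (π d)) (a d - o) = - l := by
    rw [hl, ← sub_eq_zero, sub_neg_eq_add, ← cdot_add, ← hside]
    congr 1
    ring
  have hB : cdot (E (π d)) (a (π d) - o) = - l := by
    rw [hl, ← cdot_neg_right, neg_sub]
  set Δ := cross (a d - o) (a (π d) - o) with hΔ
  have hΔ0 : 0 < Δ := by
    have h1 : a (π d) - o = (a d - o) + Complex.I * (((wt (π d) / k : ℝ) : ℂ) * E (π d)) := by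
      rw [ha]
      ring
    rw [hΔ, h1, cross_add, cross_same, cross_I_mul_right, cdot_real_mul, cdot_comm, hA, zero_add]
    have := B.pos (π d)
    have h2 : 0 < wt (π d) / k := by positivity
    nlinarith
  have hcoord := cross_mul_eq (a d - o) (a (π d) - o) r
  rw [← hΔ] at hcoord
  set s := cross r (a (π d) - o) / Δ with hs
  set t := cross (a d - o) r / Δ with ht
  have hrst : r = (s : ℂ) * (a d - o) + (t : ℂ) * (a (π d) - o) := by
    have h1 : (Δ : ℂ) ≠ 0 := by exact_mod_cast hΔ0.ne'
    apply mul_left_cancel₀ h1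
    rw [hcoord, hs, ht]
    push_cast
    field_simp
  refine ⟨d, hcyc i, s, t, by positivity, ?_, ?_, ?_⟩
  · rw [ht, cross_comm]
    apply div_nonneg _ hΔ0.le
    linarith
  · have h1 := hx _ hcd
    have h2 : x - a (π d) = (o - a (π d)) + r := by
      rw [hr]
      ring
    rw [h2, cdot_add, hrst, cdot_add, cdot_real_mul, cdot_real_mul, hA, hB, ← hl] at h1
    nlinarith
  · rw [← hrst, hr]
    ring

end BalancedCycles

/-! ### Areas of triangles and of lattice coverings. -/

section Area

open MeasureTheory

theorem volume_standard_triangle_le :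
    volume {z : ℂ | 0 ≤ z.re ∧ 0 ≤ z.im ∧ z.re + z.im ≤ 1} ≤ ENNReal.ofReal (1 / 2) := by
  set S : Set (ℝ × ℝ) := {p | 0 ≤ p.1 ∧ 0 ≤ p.2 ∧ p.1 + p.2 ≤ 1} with hS
  have hSm : MeasurableSet S := by
    apply IsClosed.measurableSet
    exact (isClosed_le continuous_const continuous_fst).inter
      ((isClosed_le continuous_const continuous_snd).inter
        (isClosed_le (continuous_fst.add continuous_snd) continuous_const))
  have h1 : {z : ℂ | 0 ≤ z.re ∧ 0 ≤ z.im ∧ z.re + z.im ≤ 1} =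
      Complex.measurableEquivRealProd ⁻¹' S := rfl
  rw [h1, Complex.volume_preserving_equiv_real_prod.measure_preimage_equiv, Measure.volume_eq_prod,
    Measure.prod_apply hSm]
  have h2 : ∀ x : ℝ, volume (Prod.mk x ⁻¹' S) ≤
      (Set.Icc (0 : ℝ) 1).indicator (fun x => ENNReal.ofReal (1 - x)) x := by
    intro x
    by_cases hx : x ∈ Set.Icc (0 : ℝ) 1
    · rw [Set.indicator_of_mem hx]
      have h3 : Prod.mk x ⁻¹' S ⊆ Set.Icc 0 (1 - x) := by
        rintro y ⟨-, h4, h5⟩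
        simp only at h4 h5
        exact ⟨h4, by linarith⟩
      refine (measure_mono h3).trans ?_
      rw [Real.volume_Icc, sub_zero]
    · have h3 : Prod.mk x ⁻¹' S = ∅ := by
        ext y
        simp only [Set.mem_preimage, Set.mem_empty_iff_false, iff_false]
        rintro ⟨h3, h4, h5⟩
        simp only at h3 h4 h5
        exact hx ⟨h3, by linarith⟩
      rw [h3, measure_empty]
      exact zero_le
  refine (lintegral_mono h2).trans ?_
  rw [lintegral_indicator measurableSet_Icc, ← ofReal_integral_eq_lintegral_ofReal]
  · rw [integral_Icc_eq_integral_Ioc, ← intervalIntegral.integral_of_le zero_le_one]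
    apply ENNReal.ofReal_le_ofReal
    rw [intervalIntegral.integral_sub (by simp) (by simp)]
    norm_num
  · exact (continuous_const.sub continuous_id).continuousOn.integrableOn_Icc
  · filter_upwards [ae_restrict_mem measurableSet_Icc] with x hx
    exact sub_nonneg.2 hx.2

/-- The linear map with the given values at `1` and `I`. -/
def linearMapOf (A B : ℂ) : ℂ →ₗ[ℝ] ℂ where
  toFun z := (z.re : ℂ) * A + (z.im : ℂ) * B
  map_add' z w := by
    push_cast [Complex.add_re, Complex.add_im]
    ring
  map_smul' r z := by
    simp only [Complex.real_smul, Complex.re_ofReal_mul, Complex.im_ofReal_mul, RingHom.id_apply]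
    push_cast
    ring

theorem det_linearMapOf (A B : ℂ) : LinearMap.det (linearMapOf A B) = cross A B := by
  rw [← LinearMap.det_toMatrix Complex.basisOneI, Matrix.det_fin_two, cross_def]
  simp [LinearMap.toMatrix_apply, linearMapOf]
  ring

theorem volume_triangle_le (o A B : ℂ) (h : 0 ≤ cross A B) :
    volume {x : ℂ | ∃ s t : ℝ, 0 ≤ s ∧ 0 ≤ t ∧ s + t ≤ 1 ∧ x = o + ((s : ℂ) * A + (t : ℂ) * B)} ≤
      ENNReal.ofReal (cross A B / 2) := by
  have h1 : {x : ℂ | ∃ s t : ℝ, 0 ≤ s ∧ 0 ≤ t ∧ s + t ≤ 1 ∧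
      x = o + ((s : ℂ) * A + (t : ℂ) * B)} = (fun x => -o + x) ⁻¹' (linearMapOf A B ''
        {z : ℂ | 0 ≤ z.re ∧ 0 ≤ z.im ∧ z.re + z.im ≤ 1}) := by
    ext x
    constructor
    · rintro ⟨s, t, hs, ht, hst, rfl⟩
      exact ⟨⟨s, t⟩, ⟨hs, ht, hst⟩, by simp [linearMapOf]⟩
    · rintro ⟨z, ⟨hs, ht, hst⟩, hz⟩
      refine ⟨z.re, z.im, hs, ht, hst, ?_⟩
      change (z.re : ℂ) * A + (z.im : ℂ) * B = -o + x at hz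
      rw [hz]
      ring
  rw [h1, measure_preimage_add, Measure.addHaar_image_linearMap, det_linearMapOf, abs_of_nonneg h]
  refine (mul_le_mul_right volume_standard_triangle_le _).trans ?_
  rw [← ENNReal.ofReal_mul h]
  apply ENNReal.ofReal_le_ofReal
  linarith

theorem volume_unit_square : volume {z : ℂ | ⌊z.re⌋ = 0 ∧ ⌊z.im⌋ = 0} = 1 := by
  have h1 : {z : ℂ | ⌊z.re⌋ = 0 ∧ ⌊z.im⌋ = 0} = Complex.measurableEquivRealProd ⁻¹'
      (Set.Ico (0 : ℝ) 1 ×ˢ Set.Ico (0 : ℝ) 1) := by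
    ext z
    simp only [Set.mem_ofPred_eq, Int.floor_eq_zero_iff, Set.mem_preimage, Set.mem_prod,
      Complex.measurableEquivRealProd_apply]
  rw [h1, Complex.volume_preserving_equiv_real_prod.measure_preimage_equiv, Measure.volume_eq_prod,
    Measure.prod_prod, Real.volume_Ico]
  simp

open MarkedTorus in
/-- Sets whose translates by a unit-area lattice cover the plane have total area at least one. -/
theorem one_le_sum_volume {ι : Type*} [Fintype ι] {W : ℂ × ℂ} (hW : cross W.1 W.2 = 1)
    {A : ι → Set ℂ} (hA : ∀ i, MeasurableSet (A i))
    (hcov : ∀ x, ∃ i n, x - combo W n ∈ A i) : 1 ≤ ∑ i, volume (A i) := by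
  -- The integer parts of the coordinates in the basis `W`; the fibers are fundamental
  -- parallelograms.
  set φ : ℂ → ℤ × ℤ := fun x => (⌊cross x W.2⌋, ⌊cross W.1 x⌋) with hφ
  have hcont1 : Continuous fun x : ℂ => cross x W.2 := by
    simp only [cross_def]
    fun_prop
  have hcont2 : Continuous fun x : ℂ => cross W.1 x := by
    simp only [cross_def]
    fun_prop
  have hφm : Measurable φ :=
    (Int.measurable_floor.comp hcont1.measurable).prodMk
      (Int.measurable_floor.comp hcont2.measurable)
  have hφadd : ∀ x n, φ (x + combo W n) = φ x + n := by
    intro x n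
    have h1 : cross (x + combo W n) W.2 = cross x W.2 + n.1 := by
      have : cross (x + combo W n) W.2 = cross x W.2 + n.1 * cross W.1 W.2 := by
        simp [cross_def, combo]
        ring
      rw [this, hW, mul_one]
    have h2 : cross W.1 (x + combo W n) = cross W.1 x + n.2 := by
      have : cross W.1 (x + combo W n) = cross W.1 x + n.2 * cross W.1 W.2 := by
        simp [cross_def, combo]
        ring
      rw [this, hW, mul_one]
    simp only [hφ, h1, h2, Int.floor_add_intCast]
    rfl
  have hF : volume (φ ⁻¹' {0}) = 1 := by
    have h1 : φ ⁻¹' {0} = linearMapOf (⟨W.2.im, - W.1.im⟩ : ℂ) (⟨- W.2.re, W.1.re⟩ : ℂ) ⁻¹'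
        {z : ℂ | ⌊z.re⌋ = 0 ∧ ⌊z.im⌋ = 0} := by
      ext x
      have h2 : linearMapOf (⟨W.2.im, - W.1.im⟩ : ℂ) (⟨- W.2.re, W.1.re⟩ : ℂ) x =
          ⟨cross x W.2, cross W.1 x⟩ := by
        apply Complex.ext
        · simp [linearMapOf, cross_def]
          ring
        · simp [linearMapOf, cross_def]
          ring
      rw [Set.mem_preimage, Set.mem_preimage, h2, Set.mem_singleton_iff, hφ, Prod.mk_eq_zero]
      rfl
    have h2 : LinearMap.det (linearMapOf (⟨W.2.im, - W.1.im⟩ : ℂ) (⟨- W.2.re, W.1.re⟩ : ℂ)) = 1 := by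
      rw [det_linearMapOf, ← hW, cross_def, cross_def]
      ring
    rw [h1, Measure.addHaar_preimage_linearMap _ (by rw [h2]; exact one_ne_zero), h2,
      volume_unit_square]
    simp
  -- The fundamental parallelogram is cut into pieces that translate into parts of the `A i`; for
  -- fixed `i` these parts are disjoint.
  have hsub : φ ⁻¹' {0} ⊆ ⋃ i, ⋃ n, (fun x => - combo W n + x) ⁻¹' (A i ∩ φ ⁻¹' {-n}) := by
    intro x hx
    obtain ⟨i, n, h⟩ := hcov x
    rw [Set.mem_iUnion]
    refine ⟨i, Set.mem_iUnion.2 ⟨n, ?_⟩⟩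
    rw [sub_eq_neg_add] at h
    refine ⟨h, ?_⟩
    have h1 := hφadd (- combo W n + x) n
    rw [neg_add_eq_sub, sub_add_cancel, Set.mem_singleton_iff.1 hx] at h1
    rw [Set.mem_preimage, Set.mem_singleton_iff]
    change φ (- combo W n + x) = -n
    rw [neg_add_eq_sub]
    exact (neg_eq_of_add_eq_zero_left h1.symm).symm
  rw [← hF]
  refine (measure_mono hsub).trans ((measure_iUnion_le _).trans ?_)
  rw [tsum_fintype]
  refine Finset.sum_le_sum fun i _ => (measure_iUnion_le _).trans ?_
  simp only [measure_preimage_add]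
  rw [← measure_iUnion]
  · exact measure_mono (Set.iUnion_subset fun n => Set.inter_subset_left)
  · intro n m hnm
    rw [Function.onFun, Set.disjoint_left]
    rintro x ⟨-, h1⟩ ⟨-, h2⟩
    rw [Set.mem_preimage, Set.mem_singleton_iff] at h1 h2
    exact hnm (neg_injective (h1.symm.trans h2))
  · exact fun n => (hA i).inter (hφm (measurableSet_singleton _))

end Area

/-! ### Power cells, local polygons and the area count. -/

namespace MarkedTorus

variable {D : Type*} [Fintype D] (T : MarkedTorus D)

/-- The power distance of `x` from a site of the cover. -/
noncomputable def sitePower (h : T.Vertex → ℤ × ℤ → ℂ) (w : T.Vertex → ℝ) (s : T.Vertex × (ℤ × ℤ))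
    (x : ℂ) : ℝ := ‖x - h s.1 s.2‖ ^ 2 - w s.1

/-- The power cell of a site of the cover. -/
def siteCell (h : T.Vertex → ℤ × ℤ → ℂ) (w : T.Vertex → ℝ) (s : T.Vertex × (ℤ × ℤ)) : Set ℂ :=
  {x | ∀ u, T.sitePower h w s x ≤ T.sitePower h w u x}

/-- The region that is cut out by the lines through the dual edges around a vertex. -/
def localCell (h : T.Vertex → ℤ × ℤ → ℂ) (a : D → ℂ) (v : T.Vertex) : Set ℂ :=
  {x | ∀ d, T.tail d = v → cdot (T.vec h d) (x - a d) ≤ 0}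

/-- The interior of `localCell`. -/
def strictCell (h : T.Vertex → ℤ × ℤ → ℂ) (a : D → ℂ) (v : T.Vertex) : Set ℂ :=
  {x | ∀ d, T.tail d = v → cdot (T.vec h d) (x - a d) < 0}

/-- A harmonic map together with a map of the dual graph that is orthogonal to it and has the same
periods, where `a d` is the position of the left face of the lift of `d` at the origin, and vertex
weights such that the ends of an edge have the same power distance from the adjacent faces. -/
structure IsDual (c : D → ℝ) (h : T.Vertex → ℤ × ℤ → ℂ) (W : ℂ × ℂ) (k : ℝ) (a : D → ℂ)
    (w : T.Vertex → ℝ) : Prop where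
  tutte : T.IsTutte c h (combo W)
  cross_eq_one : cross W.1 W.2 = 1
  pos : 0 < k
  symm : ∀ d, c (T.flip d) = c d
  energy : ∑ d, c d * ‖T.vec h d‖ ^ 2 = 4 * k
  rot : ∀ d, a (T.rot d) = a d + Complex.I * (((c (T.rot d) / k : ℝ) : ℂ) * T.vec h (T.rot d))
  next : ∀ d, a (T.next d) = a d - combo W (T.shift d)
  power : ∀ d, T.sitePower h w (T.head d, T.shift d) (a d) = T.sitePower h w (T.tail d, 0) (a d)

namespace IsDual

variable {T} {c : D → ℝ} {h : T.Vertex → ℤ × ℤ → ℂ} {W : ℂ × ℂ} {k : ℝ} {a : D → ℂ}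
  {w : T.Vertex → ℝ}

theorem sitePower_add (V : T.IsDual c h W k a w) (v : T.Vertex) (n m : ℤ × ℤ) (x : ℂ) :
    T.sitePower h w (v, n + m) x = T.sitePower h w (v, n) (x - combo W m) := by
  simp only [sitePower]
  rw [V.tutte.lift, sub_add_eq_sub_sub_swap]

theorem mem_siteCell_add (V : T.IsDual c h W k a w) (v : T.Vertex) (n m : ℤ × ℤ) (x : ℂ) :
    x ∈ T.siteCell h w (v, n + m) ↔ x - combo W m ∈ T.siteCell h w (v, n) := by
  constructor
  · rintro hx ⟨u, i⟩
    rw [← V.sitePower_add, ← V.sitePower_add]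
    exact hx _
  · rintro hx ⟨u, i⟩
    have h1 := hx (u, i - m)
    rwa [← V.sitePower_add, ← V.sitePower_add, sub_add_cancel] at h1

theorem mem_siteCell (V : T.IsDual c h W k a w) (v : T.Vertex) (n : ℤ × ℤ) (x : ℂ) :
    x ∈ T.siteCell h w (v, n) ↔ x - combo W n ∈ T.siteCell h w (v, 0) := by
  rw [← V.mem_siteCell_add, zero_add]

/-- The difference of two powers is affine in `x`, with gradient along the edge, and by `power` it
vanishes at the dual vertex. -/
theorem sitePower_sub (V : T.IsDual c h W k a w) (d : D) (n : ℤ × ℤ) (x : ℂ) :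
    T.sitePower h w (T.head d, n + T.shift d) x - T.sitePower h w (T.tail d, n) x =
      -2 * cdot (T.vec h d) (x - combo W n - a d) := by
  rw [add_comm, V.sitePower_add]
  have h0 := V.sitePower_add (T.tail d) 0 n x
  rw [zero_add] at h0
  rw [h0]
  set y := x - combo W n
  have h1 := V.power d
  have h2 : h (T.head d) (T.shift d) = h (T.tail d) 0 + T.vec h d := by
    rw [vec, dif, zero_add]
    ring
  simp only [sitePower, h2, sq_norm_eq, cdot_def, Complex.sub_re, Complex.sub_im, Complex.add_re,
    Complex.add_im] at h1 ⊢
  linarith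

theorem cdot_nonpos_of_mem_siteCell (V : T.IsDual c h W k a w) {v : T.Vertex} {n : ℤ × ℤ} {x : ℂ}
    (hx : x ∈ T.siteCell h w (v, n)) : x - combo W n ∈ T.localCell h a v := by
  rintro d rfl
  have h1 := V.sitePower_sub d n x
  have h2 := hx (T.head d, n + T.shift d)
  linarith

theorem finite_setOf_norm_le (V : T.IsDual c h W k a w) (x : ℂ) (v : T.Vertex) (R : ℝ) :
    {n | ‖x - h v n‖ ≤ R}.Finite := by
  set B := (R + ‖x - h v 0‖) * (‖W.1‖ + ‖W.2‖) with hB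
  have hcross : ∀ z w : ℂ, |cross z w| ≤ ‖z‖ * ‖w‖ := by
    intro z w
    rw [cross]
    refine (Complex.abs_im_le_norm _).trans ?_
    rw [norm_mul, RCLike.norm_conj]
  refine (Set.finite_Icc ((-⌈B⌉, -⌈B⌉) : ℤ × ℤ) (⌈B⌉, ⌈B⌉)).subset fun n hn => ?_
  have hn' : ‖x - h v n‖ ≤ R := hn
  have h1 : ‖combo W n‖ ≤ R + ‖x - h v 0‖ := by
    have h2 : combo W n = (x - h v 0) - (x - h v n) := by
      have := V.tutte.lift v 0 n
      rw [zero_add] at this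
      rw [this]
      ring
    rw [h2]
    refine (norm_sub_le _ _).trans ?_
    linarith
  have hR : 0 ≤ R + ‖x - h v 0‖ := (norm_nonneg _).trans h1
  have e1 : (n.1 : ℝ) = cross (combo W n) W.2 := by
    have : cross (combo W n) W.2 = n.1 * cross W.1 W.2 := by
      simp [cross_def, combo]
      ring
    rw [this, V.cross_eq_one, mul_one]
  have e2 : (n.2 : ℝ) = cross W.1 (combo W n) := by
    have : cross W.1 (combo W n) = n.2 * cross W.1 W.2 := by
      simp [cross_def, combo]
      ring
    rw [this, V.cross_eq_one, mul_one]
  have b1 : |(n.1 : ℝ)| ≤ B := by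
    rw [e1]
    refine (hcross _ _).trans (mul_le_mul h1 ?_ (norm_nonneg _) hR)
    linarith [norm_nonneg W.1]
  have b2 : |(n.2 : ℝ)| ≤ B := by
    rw [e2, hB, mul_comm (R + _)]
    refine (hcross _ _).trans (mul_le_mul ?_ h1 (norm_nonneg _) (by positivity))
    linarith [norm_nonneg W.2]
  rw [abs_le] at b1 b2
  have hceil := Int.le_ceil B
  refine ⟨⟨?_, ?_⟩, ⟨?_, ?_⟩⟩
  · have : (-(⌈B⌉ : ℝ)) ≤ n.1 := by linarith
    exact_mod_cast this
  · have : (-(⌈B⌉ : ℝ)) ≤ n.2 := by linarith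
    exact_mod_cast this
  · have : (n.1 : ℝ) ≤ ⌈B⌉ := by linarith
    exact_mod_cast this
  · have : (n.2 : ℝ) ≤ ⌈B⌉ := by linarith
    exact_mod_cast this

/-- Only finitely many sites have power at most a given bound, because the lattice is discrete and
the weights are periodic. -/
theorem exists_mem_siteCell (V : T.IsDual c h W k a w) (x : ℂ) : ∃ s, x ∈ T.siteCell h w s := by
  obtain ⟨d0⟩ := T.nonempty_dart
  set s0 : T.Vertex × (ℤ × ℤ) := (T.tail d0, 0) with hs0
  have hfin : {s | T.sitePower h w s x ≤ T.sitePower h w s0 x}.Finite := by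
    have h1 : ∀ v : T.Vertex, {n | T.sitePower h w (v, n) x ≤ T.sitePower h w s0 x}.Finite := by
      intro v
      refine (V.finite_setOf_norm_le x v (T.sitePower h w s0 x + w v + 1)).subset fun n hn => ?_
      have h2 : ‖x - h v n‖ ^ 2 - w v ≤ T.sitePower h w s0 x := hn
      have h3 : ‖x - h v n‖ ≤ T.sitePower h w s0 x + w v + 1 := by
        nlinarith [sq_nonneg (‖x - h v n‖ - 1), norm_nonneg (x - h v n)]
      exact h3
    refine (Set.finite_iUnion fun v => (h1 v).image (fun n => (v, n))).subset ?_
    rintro ⟨v, n⟩ hs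
    exact Set.mem_iUnion.2 ⟨v, n, hs, rfl⟩
  obtain ⟨s, hs, hmin⟩ := Set.exists_min_image _ (fun s => T.sitePower h w s x) hfin
    ⟨s0, le_refl (T.sitePower h w s0 x)⟩
  refine ⟨s, fun u => ?_⟩
  by_cases hu : T.sitePower h w u x ≤ T.sitePower h w s0 x
  · exact hmin u hu
  · exact (hs : T.sitePower h w s x ≤ _).trans (not_le.1 hu).le

/-- The face on the right. -/
theorem sub_right (V : T.IsDual c h W k a w) (d : D) :
    a (T.rot.symm d) = a (T.flip d) + combo W (T.shift d) := by
  have h1 : T.rot.symm d = T.next (T.flip d) := by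
    rw [Equiv.symm_apply_eq, T.rot_next, T.flip_flip]
  rw [h1, V.next, T.shift_flip, combo_neg, sub_neg_eq_add]

theorem rot_symm (V : T.IsDual c h W k a w) (d : D) :
    a d = a (T.rot.symm d) + Complex.I * (((c d / k : ℝ) : ℂ) * T.vec h d) := by
  have := V.rot (T.rot.symm d)
  rwa [Equiv.apply_symm_apply] at this

/-- Both ends of a dual edge have the same component along the edge, so exchanging `d` and `flip d`
turns the sum into its negative plus `∑ c * cdot e (combo W shift)`. By harmonicity the latter is `∑
c * ‖e‖ ^ 2 = 4 * k`. Divided by `2 * k`, the sum is the total signed area of the local polygons. -/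
theorem sum_cdot (V : T.IsDual c h W k a w) : ∑ d, c d * cdot (T.vec h d) (a d) = 2 * k := by
  classical
  set e := T.vec h with he
  have h1 : ∀ d, c d * cdot (e d) (a d) =
      - (c (T.flip d) * cdot (e (T.flip d)) (a (T.flip d)))
        + c d * cdot (e d) (combo W (T.shift d)) := by
    intro d
    simp only [he]
    rw [V.rot_symm d, cdot_add, cdot_I_mul_right, cross_real_mul, cross_same, V.sub_right,
      cdot_add, V.symm, V.tutte.vec_flip, cdot_neg_left]
    ring
  have h2 : ∑ d, c d * cdot (e d) (a d) = - ∑ d, c d * cdot (e d) (a d) +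
      ∑ d, c d * cdot (e d) (combo W (T.shift d)) := by
    conv_lhs => rw [Finset.sum_congr rfl fun d _ => h1 d]
    rw [Finset.sum_add_distrib, Finset.sum_neg_distrib,
      T.sum_flip (fun d => c d * cdot (e d) (a d))]
  have h3 : ∀ d, c d * cdot (e d) (combo W (T.shift d)) =
      c d * ‖e d‖ ^ 2 - (((c d : ℂ) * e d) * T.grad (fun v => (starRingEnd ℂ) (h v 0)) d).re := by
    intro d
    have h4 : e d = T.grad (fun v => h v 0) d + combo W (T.shift d) := by
      have := V.tutte.lift (T.head d) 0 (T.shift d)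
      rw [he, vec, dif, grad]
      simp only [this]
      ring
    have h5 : combo W (T.shift d) = e d - T.grad (fun v => h v 0) d := by
      rw [h4]
      ring
    rw [h5, cdot_sub, sq_norm_eq, cdot_def, cdot_def, mul_assoc, Complex.re_ofReal_mul]
    simp only [grad, Complex.mul_re, Complex.sub_re, Complex.sub_im, Complex.conj_re,
      Complex.conj_im]
    ring
  have h4 : T.Coclosed (fun d => (c d : ℂ) * e d) := by
    intro v
    have := V.tutte.harmonic v 0
    convert this
    rfl
  have h5 := h4.sum_mul_grad (fun d => by rw [V.symm, he, V.tutte.vec_flip, mul_neg])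
    (fun v => (starRingEnd ℂ) (h v 0))
  simp only [h3, Finset.sum_sub_distrib, ← Complex.re_sum] at h2
  rw [h5, V.energy] at h2
  simp only [Complex.zero_re] at h2
  linarith

theorem sum_mul_vec (V : T.IsDual c h W k a w) [DecidableEq T.Vertex] (v : T.Vertex) :
    ∑ d ∈ Finset.univ.filter (fun d => T.tail d = v), (c d : ℂ) * T.vec h d = 0 := by
  have := V.tutte.harmonic v 0
  convert this
  rfl

theorem sum_cdot_sub (V : T.IsDual c h W k a w) [DecidableEq T.Vertex] (v : T.Vertex) (o : ℂ) :
    ∑ d ∈ Finset.univ.filter (fun d => T.tail d = v), c d * cdot (T.vec h d) (a d - o) =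
      ∑ d ∈ Finset.univ.filter (fun d => T.tail d = v), c d * cdot (T.vec h d) (a d) := by
  have h1 := congrArg (fun z => cdot z o) (V.sum_mul_vec v)
  rw [cdot_comm, cdot_sum, cdot_comm, cdot_zero] at h1
  rw [← sub_eq_zero, ← Finset.sum_sub_distrib, ← neg_eq_zero, ← h1, ← Finset.sum_neg_distrib]
  refine Finset.sum_congr rfl fun d _ => ?_
  rw [cdot_sub, cdot_real_mul, cdot_comm o]
  ring

/-- If all corners turned the other way, every local polygon would contribute a nonpositive amount
to the positive sum in `sum_cdot`. -/
theorem cross_pos (V : T.IsDual c h W k a w) (d : D) :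
    0 < cross (T.vec h d) (T.vec h (T.rot d)) := by
  classical
  have := Fintype.ofFinite T.Vertex
  rcases V.tutte.cross_pos_or_neg with h1 | h1
  · exact h1 d
  · exfalso
    have h2 : ∑ d, c d * cdot (T.vec h d) (a d) ≤ 0 := by
      rw [← Finset.sum_fiberwise (s := Finset.univ) (g := T.tail)]
      refine Finset.sum_nonpos fun v _ => ?_
      obtain ⟨d', rfl⟩ := T.tail_surjective v
      rw [← V.sum_cdot_sub _ (a d')]
      refine Finset.sum_nonpos fun d hd => ?_
      have h3 := V.tutte.balancedCycles.1.cdot_corner_nonneg h1 V.pos V.rot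
        (T.tail_eq_iff.1 (Finset.mem_filter.1 hd).2)
      rw [← neg_sub, cdot_neg_right]
      nlinarith [V.tutte.pos d]
    rw [V.sum_cdot] at h2
    linarith [V.pos]

theorem isOpen_strictCell (h : T.Vertex → ℤ × ℤ → ℂ) (a : D → ℂ) (v : T.Vertex) :
    IsOpen (T.strictCell h a v) := by
  have h1 : T.strictCell h a v =
      ⋂ d : {d : D // T.tail d = v}, {x | cdot (T.vec h d) (x - a d) < 0} := by
    ext x
    simp [strictCell]
  rw [h1]
  refine isOpen_iInter_of_finite fun d => isOpen_lt ?_ continuous_const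
  simp only [cdot_def]
  fun_prop

theorem continuous_sitePower (h : T.Vertex → ℤ × ℤ → ℂ) (w : T.Vertex → ℝ)
    (s : T.Vertex × (ℤ × ℤ)) : Continuous (T.sitePower h w s) := by
  unfold sitePower
  fun_prop

theorem isClosed_siteCell (h : T.Vertex → ℤ × ℤ → ℂ) (w : T.Vertex → ℝ)
    (s : T.Vertex × (ℤ × ℤ)) : IsClosed (T.siteCell h w s) := by
  have h1 : T.siteCell h w s = ⋂ u, {x | T.sitePower h w s x ≤ T.sitePower h w u x} := by
    ext x
    simp [siteCell]
  rw [h1]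
  exact isClosed_iInter fun u =>
    isClosed_le (continuous_sitePower h w s) (continuous_sitePower h w u)

theorem strictCell_subset (h : T.Vertex → ℤ × ℤ → ℂ) (a : D → ℂ) (v : T.Vertex) :
    T.strictCell h a v ⊆ T.localCell h a v := fun _ hx d hd => (hx d hd).le

/-- The triangulation of the local cell. -/
theorem exists_center (V : T.IsDual c h W k a w) (v : T.Vertex) :
    ∃ o ∈ convexHull ℝ (a '' {d | T.tail d = v}), o ∈ T.strictCell h a v ∧
      ∀ x ∈ T.localCell h a v, ∃ d, T.tail d = v ∧ ∃ s t : ℝ, 0 ≤ s ∧ 0 ≤ t ∧ s + t ≤ 1 ∧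
        x = o + ((s : ℂ) * (a d - o) + (t : ℂ) * (a (T.rot d) - o)) := by
  obtain ⟨d0, rfl⟩ := T.tail_surjective v
  obtain ⟨o, h1, h2, h3⟩ :=
    V.tutte.balancedCycles.1.exists_center V.cross_pos V.pos V.rot d0
  have h4 : ∀ d, T.tail d = T.tail d0 ↔ T.rot.SameCycle d0 d := fun d => by
    rw [eq_comm, T.tail_eq_iff]
  simp only [strictCell, localCell, h4]
  exact ⟨o, h1, h2, h3⟩

theorem mem_strictCell_of_mem {v : T.Vertex} {x o : ℂ}
    (hx : x ∈ T.localCell h a v) (ho : o ∈ T.strictCell h a v) {ε : ℝ} (h0 : 0 < ε)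
    (h1 : ε ≤ 1) : x + (ε : ℂ) * (o - x) ∈ T.strictCell h a v := by
  intro d hd
  have e1 := hx d hd
  have e2 := ho d hd
  have e3 : x + (ε : ℂ) * (o - x) - a d =
      ((1 - ε : ℝ) : ℂ) * (x - a d) + (ε : ℂ) * (o - a d) := by
    push_cast
    ring
  rw [e3, cdot_add, cdot_real_mul, cdot_real_mul]
  nlinarith

open MeasureTheory

/-- The triangles from an interior point `o` to the dual edges have areas linear in `c * cdot e (a -
o)`. Equilibrium at the vertex removes `o` from their sum. -/
theorem volume_localCell_le (V : T.IsDual c h W k a w) [DecidableEq T.Vertex] (v : T.Vertex) :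
    volume (T.localCell h a v) ≤ ENNReal.ofReal (1 / (2 * k) *
      ∑ d ∈ Finset.univ.filter (fun d => T.tail d = v), c d * cdot (T.vec h d) (a d)) := by
  obtain ⟨o, -, ho, htri⟩ := V.exists_center v
  have hcr : ∀ d, T.tail d = v → cross (a d - o) (a (T.rot d) - o) =
      c (T.rot d) / k * cdot (T.vec h (T.rot d)) (a (T.rot d) - o) := by
    intro d _
    have h1 : a d - o = (a (T.rot d) - o) -
        Complex.I * (((c (T.rot d) / k : ℝ) : ℂ) * T.vec h (T.rot d)) := by
      rw [V.rot]
      ring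
    rw [h1, ← neg_neg (cross _ _), ← cross_comm, cross_sub, cross_same, cross_I_mul_right,
      cdot_comm, cdot_real_mul_left]
    ring
  have hnn : ∀ d, T.tail d = v → 0 ≤ cross (a d - o) (a (T.rot d) - o) := by
    intro d hd
    rw [hcr d hd]
    have h1 := ho (T.rot d) ((T.tail_rot d).trans hd)
    rw [← neg_sub, cdot_neg_right]
    have h2 : 0 < c (T.rot d) / k := div_pos (V.tutte.pos _) V.pos
    nlinarith
  have hsub : T.localCell h a v ⊆ ⋃ d ∈ Finset.univ.filter (fun d => T.tail d = v),
      {x : ℂ | ∃ s t : ℝ, 0 ≤ s ∧ 0 ≤ t ∧ s + t ≤ 1 ∧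
        x = o + ((s : ℂ) * (a d - o) + (t : ℂ) * (a (T.rot d) - o))} := by
    intro x hx
    obtain ⟨d, hd, hx'⟩ := htri x hx
    exact Set.mem_biUnion (Finset.mem_coe.2 (Finset.mem_filter.2 ⟨Finset.mem_univ d, hd⟩)) hx'
  refine (measure_mono hsub).trans ((measure_biUnion_finset_le _ _).trans ?_)
  refine (Finset.sum_le_sum fun d hd =>
    volume_triangle_le o _ _ (hnn d (Finset.mem_filter.1 hd).2)).trans ?_
  rw [← ENNReal.ofReal_sum_of_nonneg fun d hd =>
    div_nonneg (hnn d (Finset.mem_filter.1 hd).2) zero_le_two]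
  apply ENNReal.ofReal_le_ofReal
  apply le_of_eq
  rw [← V.sum_cdot_sub v o, Finset.mul_sum]
  have hre : ∀ F : D → ℝ, ∑ d ∈ Finset.univ.filter (fun d => T.tail d = v), F (T.rot d) =
      ∑ d ∈ Finset.univ.filter (fun d => T.tail d = v), F d := by
    intro F
    refine Finset.sum_equiv T.rot (fun d => ?_) fun d _ => rfl
    simp only [Finset.mem_filter, Finset.mem_univ, true_and, T.tail_rot]
  rw [← hre (fun d => 1 / (2 * k) * (c d * cdot (T.vec h d) (a d - o)))]
  refine Finset.sum_congr rfl fun d hd => ?_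
  rw [hcr d (Finset.mem_filter.1 hd).2]
  have := V.pos.ne'
  field_simp

theorem sum_volume_localCell_le (V : T.IsDual c h W k a w) [Fintype T.Vertex] :
    ∑ v, volume (T.localCell h a v) ≤ 1 := by
  classical
  have hnn : ∀ v, 0 ≤ 1 / (2 * k) *
      ∑ d ∈ Finset.univ.filter (fun d => T.tail d = v), c d * cdot (T.vec h d) (a d) := by
    intro v
    obtain ⟨o, -, ho, -⟩ := V.exists_center v
    rw [← V.sum_cdot_sub v o]
    have := V.pos
    refine mul_nonneg (by positivity) (Finset.sum_nonneg fun d hd => ?_)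
    have h1 := ho d (Finset.mem_filter.1 hd).2
    rw [← neg_sub, cdot_neg_right]
    nlinarith [V.tutte.pos d]
  refine (Finset.sum_le_sum fun v _ => V.volume_localCell_le v).trans ?_
  rw [← ENNReal.ofReal_sum_of_nonneg fun v _ => hnn v, ← Finset.mul_sum,
    Finset.sum_fiberwise (s := Finset.univ) (g := T.tail), V.sum_cdot]
  have := V.pos
  rw [one_div_mul_cancel (by positivity), ENNReal.ofReal_one]

/-- A covering has total area at least one per period and the local polygons have at most one, so
nothing of positive measure is left over. -/
theorem eq_empty_of_covering (V : T.IsDual c h W k a w) {A : T.Vertex → Set ℂ}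
    (hA : ∀ v, MeasurableSet (A v)) (hAP : ∀ v, A v ⊆ T.localCell h a v)
    (hcov : ∀ x, ∃ v n, x - combo W n ∈ A v) {v : T.Vertex} {B : Set ℂ} (hB : IsOpen B)
    (hBP : B ⊆ T.localCell h a v) (hAB : Disjoint (A v) B) : B = ∅ := by
  classical
  have := Fintype.ofFinite T.Vertex
  by_contra hne
  have hpos := hB.measure_pos volume (Set.nonempty_iff_ne_empty.2 hne)
  have h1 := one_le_sum_volume V.cross_eq_one hA hcov
  have h2 := V.sum_volume_localCell_le
  rw [← Finset.add_sum_erase _ _ (Finset.mem_univ v)] at h1 h2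
  have h3 : volume (A v) + volume B ≤ volume (T.localCell h a v) := by
    rw [← measure_union hAB hB.measurableSet]
    exact measure_mono (Set.union_subset (hAP v) hBP)
  have h4 : ∑ u ∈ Finset.univ.erase v, volume (A u) ≤
      ∑ u ∈ Finset.univ.erase v, volume (T.localCell h a u) :=
    Finset.sum_le_sum fun u _ => measure_mono (hAP u)
  have h5 : 1 + volume B ≤ 1 + 0 := by
    calc 1 + volume B ≤ (volume (A v) + ∑ u ∈ Finset.univ.erase v, volume (A u)) + volume B :=
          add_le_add_left h1 _
      _ = (volume (A v) + volume B) + ∑ u ∈ Finset.univ.erase v, volume (A u) := by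
          rw [add_right_comm]
      _ ≤ volume (T.localCell h a v) + ∑ u ∈ Finset.univ.erase v, volume (T.localCell h a u) :=
          add_le_add h3 h4
      _ ≤ 1 + 0 := by rwa [add_zero]
  rw [ENNReal.add_le_add_iff_left ENNReal.one_ne_top] at h5
  exact hpos.not_ge h5

theorem exists_sub_mem_siteCell (V : T.IsDual c h W k a w) (x : ℂ) :
    ∃ v n, x - combo W n ∈ T.siteCell h w (v, 0) := by
  obtain ⟨⟨v, n⟩, hs⟩ := V.exists_mem_siteCell x
  exact ⟨v, n, (V.mem_siteCell v n x).1 hs⟩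

/-- The power cells are cut out by the dual edges. -/
theorem siteCell_eq (V : T.IsDual c h W k a w) (v : T.Vertex) :
    T.siteCell h w (v, 0) = T.localCell h a v := by
  have hsub : ∀ v, T.siteCell h w (v, 0) ⊆ T.localCell h a v := by
    intro v x hx
    have := V.cdot_nonpos_of_mem_siteCell hx
    rwa [combo_zero, sub_zero] at this
  refine Set.Subset.antisymm (hsub v) fun x hx => ?_
  by_contra hx'
  obtain ⟨o, -, ho, -⟩ := V.exists_center v
  have hB : IsOpen ((T.siteCell h w (v, 0))ᶜ ∩ T.strictCell h a v) :=
    (isClosed_siteCell h w _).isOpen_compl.inter (isOpen_strictCell h a v)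
  have h1 := V.eq_empty_of_covering (A := fun v => T.siteCell h w (v, 0))
    (fun v => (isClosed_siteCell h w _).measurableSet) hsub V.exists_sub_mem_siteCell hB
    (Set.inter_subset_right.trans (strictCell_subset h a v))
    (Set.disjoint_left.2 fun y hy hy' => hy'.1 hy)
  have h2 : ∀ᶠ ε : ℝ in nhdsWithin 0 (Set.Ioi 0),
      x + (ε : ℂ) * (o - x) ∈ (T.siteCell h w (v, 0))ᶜ := by
    have hc : Continuous fun ε : ℝ => x + (ε : ℂ) * (o - x) := by fun_prop
    apply Filter.Eventually.filter_mono nhdsWithin_le_nhds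
    apply hc.continuousAt.eventually_mem
    apply (isClosed_siteCell h w _).isOpen_compl.mem_nhds
    simpa using hx'
  obtain ⟨ε, e1, e2, e3⟩ := (h2.and (Ioo_mem_nhdsGT (zero_lt_one' ℝ))).exists
  have h3 : x + (ε : ℂ) * (o - x) ∈ (T.siteCell h w (v, 0))ᶜ ∩ T.strictCell h a v :=
    ⟨e1, mem_strictCell_of_mem hx ho e2 e3.le⟩
  rw [h1] at h3
  exact h3

theorem mem_siteCell_iff (V : T.IsDual c h W k a w) {v : T.Vertex} {n : ℤ × ℤ} {x : ℂ} :
    x ∈ T.siteCell h w (v, n) ↔ x - combo W n ∈ T.localCell h a v := by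
  rw [V.mem_siteCell, V.siteCell_eq]

/-- The interiors of different cells are disjoint. -/
theorem eq_of_mem_strictCell (V : T.IsDual c h W k a w) {u v : T.Vertex} {m n : ℤ × ℤ} {x : ℂ}
    (hu : x - combo W m ∈ T.strictCell h a u) (hv : x - combo W n ∈ T.strictCell h a v) :
    (u, m) = (v, n) := by
  by_contra hne
  set y := x - combo W m with hy
  set j := n - m with hj
  have hyv : y - combo W j ∈ T.strictCell h a v := by
    have : y - combo W j = x - combo W n := by
      rw [hy, hj, combo_sub]
      ring
    rwa [this]
  -- The overlap `B` can be removed from the cell of `u` because the cell of `v` still covers it.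
  -- When `u = v`, the radius ensures that `B` does not meet its own translate, so the removal does
  -- not undo this.
  obtain ⟨r, hr, hr'⟩ : ∃ r : ℝ, 0 < r ∧ (u = v → 2 * r < ‖combo W j‖) := by
    by_cases huv : u = v
    · have hj0 : combo W j ≠ 0 := by
        intro h0
        have := V.tutte.inj _ h0
        rw [hj, sub_eq_zero] at this
        exact hne (by rw [huv, this])
      have := norm_pos_iff.2 hj0
      exact ⟨‖combo W j‖ / 3, by positivity, fun _ => by linarith⟩
    · exact ⟨1, one_pos, fun h0 => absurd h0 huv⟩
  set B : Set ℂ := Metric.ball y r ∩ (T.strictCell h a u ∩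
    (fun z => z - combo W j) ⁻¹' T.strictCell h a v) with hB
  have hBopen : IsOpen B := Metric.isOpen_ball.inter ((isOpen_strictCell h a u).inter
    ((isOpen_strictCell h a v).preimage (by fun_prop)))
  classical
  have h1 := V.eq_empty_of_covering
    (A := fun t => if t = u then T.siteCell h w (t, 0) \ B else T.siteCell h w (t, 0))
    (v := u) (B := B) (fun t => ?_) (fun t => ?_) (fun z => ?_) hBopen
    (fun z hz => strictCell_subset h a u hz.2.1) ?_
  · have h2 : y ∈ B := ⟨Metric.mem_ball_self hr, hu, hyv⟩
    rw [h1] at h2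
    exact h2
  · split_ifs
    · exact (isClosed_siteCell h w _).measurableSet.diff hBopen.measurableSet
    · exact (isClosed_siteCell h w _).measurableSet
  · split_ifs
    · rw [V.siteCell_eq]
      exact Set.sdiff_subset
    · rw [V.siteCell_eq]
  · obtain ⟨t, i, hti⟩ := V.exists_sub_mem_siteCell z
    by_cases hB' : t = u ∧ z - combo W i ∈ B
    · refine ⟨v, i + j, ?_⟩
      have h3 : z - combo W (i + j) = z - combo W i - combo W j := by
        rw [combo_add, sub_add_eq_sub_sub]
      have h4 : z - combo W (i + j) ∈ T.siteCell h w (v, 0) := by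
        rw [V.siteCell_eq, h3]
        exact strictCell_subset h a v hB'.2.2.2
      split_ifs with hvu
      · refine ⟨h4, fun h5 => ?_⟩
        have h6 := hB'.2.1
        have h7 := h5.1
        rw [Metric.mem_ball] at h6 h7
        rw [h3] at h7
        have h8 := dist_triangle_right (z - combo W i) (z - combo W i - combo W j) y
        rw [dist_eq_norm (z - combo W i), sub_sub_cancel] at h8
        have h9 := hr' hvu.symm
        linarith
      · exact h4
    · refine ⟨t, i, ?_⟩
      split_ifs with htu
      · exact ⟨hti, fun h3 => hB' ⟨htu, h3⟩⟩
      · exact hti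
  · simp only [if_true]
    exact Set.disjoint_sdiff_left

/-- A small step toward the center of the cell of `v` reaches its interior without leaving the
interior of the cell of `u`. -/
theorem eq_of_mem_strictCell_of_mem_localCell (V : T.IsDual c h W k a w) {u v : T.Vertex}
    {m n : ℤ × ℤ} {x : ℂ} (hu : x - combo W m ∈ T.strictCell h a u)
    (hv : x - combo W n ∈ T.localCell h a v) : (u, m) = (v, n) := by
  obtain ⟨o, -, ho, -⟩ := V.exists_center v
  have h2 : ∀ᶠ ε : ℝ in nhdsWithin 0 (Set.Ioi 0),
      x + (ε : ℂ) * (o - (x - combo W n)) - combo W m ∈ T.strictCell h a u := by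
    have hc : Continuous fun ε : ℝ => x + (ε : ℂ) * (o - (x - combo W n)) - combo W m := by fun_prop
    apply Filter.Eventually.filter_mono nhdsWithin_le_nhds
    apply hc.continuousAt.eventually_mem
    apply (isOpen_strictCell h a u).mem_nhds
    simpa using hu
  obtain ⟨ε, e1, e2, e3⟩ := (h2.and (Ioo_mem_nhdsGT (zero_lt_one' ℝ))).exists
  refine V.eq_of_mem_strictCell e1 (n := n) ?_
  have h3 := mem_strictCell_of_mem hv ho e2 e3.le
  rwa [add_sub_right_comm]

/-- If a cell contains `x`, then it is the cell into which one moves from `x` in the direction of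
its center. -/
theorem eq_of_forall_cdot_nonpos (V : T.IsDual c h W k a w) {u v : T.Vertex} {m n : ℤ × ℤ}
    {x o : ℂ} (hu : x - combo W m ∈ T.localCell h a u) (ho : o ∈ T.strictCell h a u)
    (hv : x - combo W n ∈ T.localCell h a v)
    (hdir : ∀ d, T.tail d = v → cdot (T.vec h d) (x - combo W n - a d) = 0 →
      cdot (T.vec h d) (o - (x - combo W m)) ≤ 0) : (u, m) = (v, n) := by
  set η := o - (x - combo W m) with hη
  have h1 : ∀ᶠ ε : ℝ in nhdsWithin 0 (Set.Ioi 0), ∀ d, T.tail d = v →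
      cdot (T.vec h d) (x + (ε : ℂ) * η - combo W n - a d) ≤ 0 := by
    rw [Filter.eventually_all]
    intro d
    by_cases hd : T.tail d = v
    · have hexp : ∀ ε : ℝ, cdot (T.vec h d) (x + (ε : ℂ) * η - combo W n - a d) =
          cdot (T.vec h d) (x - combo W n - a d) + ε * cdot (T.vec h d) η := by
        intro ε
        rw [← cdot_real_mul, ← cdot_add]
        congr 1
        ring
      rcases (hv d hd).eq_or_lt with h0 | h0
      · filter_upwards [self_mem_nhdsWithin] with ε hε _
        rw [hexp, h0, zero_add]
        exact mul_nonpos_of_nonneg_of_nonpos (le_of_lt hε) (hdir d hd h0)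
      · have hc : Continuous fun ε : ℝ =>
            cdot (T.vec h d) (x - combo W n - a d) + ε * cdot (T.vec h d) η := by fun_prop
        have h2 : ∀ᶠ ε : ℝ in nhdsWithin 0 (Set.Ioi 0),
            cdot (T.vec h d) (x - combo W n - a d) + ε * cdot (T.vec h d) η < 0 := by
          apply Filter.Eventually.filter_mono nhdsWithin_le_nhds
          apply hc.continuousAt.eventually_lt continuousAt_const
          simpa using h0
        filter_upwards [h2] with ε hε _
        rw [hexp]
        exact hε.le
    · exact Filter.Eventually.of_forall fun ε h0 => absurd h0 hd
  obtain ⟨ε, e1, e2, e3⟩ := (h1.and (Ioo_mem_nhdsGT (zero_lt_one' ℝ))).exists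
  refine V.eq_of_mem_strictCell_of_mem_localCell (x := x + (ε : ℂ) * η) ?_ e1
  have h3 := mem_strictCell_of_mem hu ho e2 e3.le
  rwa [← hη, ← add_sub_right_comm] at h3

end IsDual

end MarkedTorus

/-! ### From the tiling to the weighted Delaunay and dual Voronoi decompositions. -/

namespace MarkedTorus

variable {D : Type*} [Fintype D] (T : MarkedTorus D)

theorem mem_powerCell_iff (h : T.Vertex → ℤ × ℤ → ℂ) (w : T.Vertex → ℝ) (v : T.cover.Vertex)
    (x : ℂ) : x ∈ T.cover.powerCell (T.onVertices h) (fun v => w (T.vtx v).1) v ↔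
      x ∈ T.siteCell h w (T.vtx v) := by
  constructor
  · intro hx u
    obtain ⟨u, rfl⟩ := T.vtx_surjective u
    exact hx u
  · intro hx u
    exact hx (T.vtx u)

theorem exists_iterate_of_left_eq {x y : D × (ℤ × ℤ)}
    (hxy : T.cover.left y = T.cover.left x) :
    ∃ i < Function.minimalPeriod T.cover.next x, T.cover.next^[i] x = y := by
  obtain ⟨d, n⟩ := x
  obtain ⟨d', n'⟩ := y
  have h1 := congrArg T.fce hxy
  rw [fce_left, fce_left] at h1
  obtain ⟨i, hi, hi'⟩ := exists_iterate_lt_minimalPeriod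
    (T.left_eq_iff.1 (Prod.mk.inj h1).1.symm)
  refine ⟨i, by rwa [cover_next_minimalPeriod], ?_⟩
  have h2 := congrArg T.fce ((T.cover.left_iterate (d, n) i).trans hxy.symm)
  rw [cover_next_iterate, hi', fce_left, fce_left] at h2
  rw [cover_next_iterate, hi', sub_left_injective (Prod.mk.inj h2).2]

theorem _root_.Convex.sum_three_mem {E : Type*} [AddCommGroup E] [Module ℝ E] {s : Set E}
    (hs : Convex ℝ s) {x y z : E} (hx : x ∈ s) (hy : y ∈ s) (hz : z ∈ s) {a b c : ℝ} (ha : 0 ≤ a)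
    (hb : 0 ≤ b) (hc : 0 ≤ c) (habc : a + b + c = 1) : a • x + b • y + c • z ∈ s := by
  have h1 := hs.sum_mem (t := Finset.univ) (w := ![a, b, c]) (z := ![x, y, z])
    (fun i _ => by fin_cases i <;> assumption) (by simpa [Fin.sum_univ_three] using habc)
    (fun i _ => by fin_cases i <;> assumption)
  simpa [Fin.sum_univ_three] using h1

theorem convex_localCell (h : T.Vertex → ℤ × ℤ → ℂ) (a : D → ℂ) (v : T.Vertex) :
    Convex ℝ (T.localCell h a v) := by
  intro y hy z hz s t hs ht hst d hd
  have e1 : s • y + t • z - a d = (s : ℂ) * (y - a d) + (t : ℂ) * (z - a d) := by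
    have : (t : ℂ) = 1 - s := by
      rw [eq_sub_iff_add_eq', ← Complex.ofReal_add, hst, Complex.ofReal_one]
    rw [Complex.real_smul, Complex.real_smul, this]
    ring
  rw [e1, cdot_add, cdot_real_mul, cdot_real_mul]
  nlinarith [hy d hd, hz d hd]

namespace IsDual

variable {T} {c : D → ℝ} {h : T.Vertex → ℤ × ℤ → ℂ} {W : ℂ × ℂ} {k : ℝ} {a : D → ℂ}
  {w : T.Vertex → ℝ}

/-- The position of the face on the left of a dart of the cover. -/
def corner (a : D → ℂ) (W : ℂ × ℂ) (x : D × (ℤ × ℤ)) : ℂ := a x.1 + combo W x.2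

theorem corner_eq_of_left_eq (V : T.IsDual c h W k a w) {x y : D × (ℤ × ℤ)}
    (hxy : T.cover.left x = T.cover.left y) : corner a W x = corner a W y := by
  refine sameCycle_invariant (fun x => ?_) (T.cover.left_eq_iff.1 hxy)
  obtain ⟨d, n⟩ := x
  rw [cover_next, corner, corner, V.next, combo_add]
  ring

theorem corner_mem_localCell (V : T.IsDual c h W k a w) {d : D} {v : T.Vertex}
    (hd : T.tail d = v) : a d ∈ T.localCell h a v := by
  intro d' hd'
  exact V.tutte.balancedCycles.1.cdot_corner_nonpos V.cross_pos V.pos V.rot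
    (T.tail_eq_iff.1 (hd'.trans hd.symm))

theorem corner_injective (V : T.IsDual c h W k a w) {d d' : D} (hd : T.tail d = T.tail d')
    (h1 : a d = a d') : d = d' := by
  by_contra hne
  by_cases h2 : T.rot d' = d
  · have h3 := V.rot d'
    rw [h2, ← h1, left_eq_add, mul_eq_zero, mul_eq_zero] at h3
    have hk := V.pos
    have hc := V.tutte.pos d
    have h4 : ((c d / k : ℝ) : ℂ) ≠ 0 := by
      exact_mod_cast (div_pos hc hk).ne'
    rcases h3 with h3 | h3 | h3
    · exact Complex.I_ne_zero h3
    · exact h4 h3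
    · exact V.tutte.vec_ne_zero d h3
  · have h3 := V.tutte.balancedCycles.1.cdot_corner_neg V.cross_pos V.pos V.rot
      (T.tail_eq_iff.1 hd) (Ne.symm hne) h2
    rw [h1, sub_self, cdot_zero] at h3
    exact lt_irrefl _ h3

/-- The cells that contain the position of a face are those of the vertices of the face. -/
theorem exists_left_eq_of_corner_mem (V : T.IsDual c h W k a w) {x : D × (ℤ × ℤ)} {u : T.Vertex}
    {m : ℤ × ℤ} (hu : corner a W x - combo W m ∈ T.localCell h a u) :
    ∃ y, T.cover.left y = T.cover.left x ∧ (T.tail y.1, y.2) = (u, m) := by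
  obtain ⟨o, -, ho, -⟩ := V.exists_center u
  set η := o - (corner a W x - combo W m) with hη
  set N := Function.minimalPeriod T.cover.next x with hN
  have hNpos : 0 < N := T.minimalPeriod_next_pos x
  set f : ℕ → ℝ := fun i =>
    cdot η (h (T.tail (T.cover.next^[i] x).1) (T.cover.next^[i] x).2) with hf
  -- The candidate is the vertex of the face farthest in the direction `η` toward the center of the
  -- given cell. At the corner, only the two sides of the face at this vertex are active constraints
  -- of its cell. By maximality both allow the direction `η`, so the two cells coincide.
  obtain ⟨i, -, hi⟩ := Finset.exists_max_image (Finset.range N) f ⟨0, Finset.mem_range.2 hNpos⟩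
  have hmax : ∀ j, f j ≤ f i := by
    intro j
    have h1 := hi (j % N) (Finset.mem_range.2 (Nat.mod_lt _ hNpos))
    simp only [hf, hN, Function.iterate_mod_minimalPeriod_eq] at h1
    exact h1
  set y := T.cover.next^[i] x with hy
  have hleft : T.cover.left y = T.cover.left x := T.cover.left_iterate x i
  have hvec : ∀ j, cdot (T.vec h (T.cover.next^[j] x).1) η = f (j + 1) - f j := by
    intro j
    have h1 := T.dif_next_iterate h x j
    rw [← Prod.mk.eta (p := T.cover.next^[j] x), V.tutte.dif_eq] at h1
    rw [h1, cdot_comm, cdot_sub]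
  refine ⟨y, hleft, Eq.symm ?_⟩
  have hcorner : corner a W x - combo W y.2 = a y.1 := by
    rw [← V.corner_eq_of_left_eq hleft, corner, add_sub_cancel_right]
  refine V.eq_of_forall_cdot_nonpos hu ho ?_ fun d hd h0 => ?_
  · rw [hcorner]
    exact V.corner_mem_localCell rfl
  · rw [hcorner] at h0
    by_cases h1 : y.1 = d
    · rw [← h1, hvec i]
      linarith [hmax (i + 1)]
    · by_cases h2 : T.rot y.1 = d
      · have h3 := T.iterate_pred_minimalPeriod y
        rw [hy, ← Function.iterate_add_apply, ← hy] at h3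
        have h4 := hvec (Function.minimalPeriod T.cover.next y - 1 + i)
        have h5 : Function.minimalPeriod T.cover.next y - 1 + i + 1 =
            Function.minimalPeriod T.cover.next y + i := by
          have := T.minimalPeriod_next_pos y
          omega
        have h6 : f (Function.minimalPeriod T.cover.next y + i) = f i := by
          simp only [hf]
          rw [Function.iterate_add_apply, ← hy, Function.iterate_minimalPeriod]
        rw [h5, h6, h3, ← Prod.mk.eta (p := y), cover_rot, cover_flip, V.tutte.vec_flip,
          cdot_neg_left, h2] at h4
        have := hmax (Function.minimalPeriod T.cover.next y - 1 + i)
        change cdot (T.vec h d) η ≤ 0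
        linarith
      · have h3 := V.tutte.balancedCycles.1.cdot_corner_neg V.cross_pos V.pos V.rot
          (T.tail_eq_iff.1 hd) h1 h2
        exact absurd h0 h3.ne

/-- The conditions at a point in the interior of a dual edge. -/
theorem edge_conditions (V : T.IsDual c h W k a w) {d : D} {y : ℂ} {t : ℝ} (ht0 : 0 < t)
    (ht1 : t < 1) (hy : y = a (T.rot.symm d) + (t : ℂ) * (a d - a (T.rot.symm d))) :
    y ∈ T.localCell h a (T.tail d) ∧
      ∀ d', T.tail d' = T.tail d → cdot (T.vec h d') (y - a d') = 0 → d' = d := by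
  obtain ⟨δ, rfl⟩ := T.rot.surjective d
  rw [Equiv.symm_apply_apply] at hy
  have B := V.tutte.balancedCycles.1
  have hexp : ∀ d', cdot (T.vec h d') (y - a d') = (1 - t) * cdot (T.vec h d') (a δ - a d') +
      t * cdot (T.vec h d') (a (T.rot δ) - a d') := by
    intro d'
    rw [← cdot_real_mul, ← cdot_real_mul, ← cdot_add, hy]
    congr 1
    push_cast
    ring
  have e1 : ∀ d', T.tail d' = T.tail (T.rot δ) → cdot (T.vec h d') (a δ - a d') ≤ 0 :=
    fun d' hd' => V.corner_mem_localCell (T.tail_rot δ).symm d' hd'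
  have e2 : ∀ d', T.tail d' = T.tail (T.rot δ) → cdot (T.vec h d') (a (T.rot δ) - a d') ≤ 0 :=
    fun d' hd' => V.corner_mem_localCell rfl d' hd'
  refine ⟨fun d' hd' => ?_, fun d' hd' h0 => ?_⟩
  · rw [hexp]
    nlinarith [e1 d' hd', e2 d' hd']
  · by_contra hne
    have hcyc := T.tail_eq_iff.1 hd'
    rw [hexp] at h0
    by_cases h2 : T.rot (T.rot δ) = d'
    · have h3 : δ ≠ d' := by
        rintro rfl
        exact (BalancedCycles.apply_ne V.cross_pos δ).2 h2
      have h4 := B.cdot_corner_neg V.cross_pos V.pos V.rot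
        (T.tail_eq_iff.1 (hd'.trans (T.tail_rot δ))) h3 (Ne.symm hne)
      nlinarith [e2 d' hd']
    · have h4 := B.cdot_corner_neg V.cross_pos V.pos V.rot hcyc (Ne.symm hne) h2
      nlinarith [e1 d' hd']

theorem edge_reverse (V : T.IsDual c h W k a w) {d : D} {y : ℂ} {t : ℝ}
    (hy : y = a (T.rot.symm d) + (t : ℂ) * (a d - a (T.rot.symm d))) :
    y - combo W (T.shift d) = a (T.rot.symm (T.flip d)) +
      ((1 - t : ℝ) : ℂ) * (a (T.flip d) - a (T.rot.symm (T.flip d))) := by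
  have h1 : T.rot.symm (T.flip d) = T.next d := rfl
  have h2 := V.sub_right d
  rw [h1, V.next, hy, h2]
  push_cast
  ring

/-- Inside a dual edge each of the two adjacent cells has a single active constraint, with opposite
normals. The direction toward the center of any cell containing `x` satisfies one of them. -/
theorem mem_localCell_edge_iff (V : T.IsDual c h W k a w) {d : D} {n : ℤ × ℤ} {x : ℂ} {t : ℝ}
    (ht0 : 0 < t) (ht1 : t < 1)
    (hx : x - combo W n = a (T.rot.symm d) + (t : ℂ) * (a d - a (T.rot.symm d))) {u : T.Vertex}
    {m : ℤ × ℤ} : x - combo W m ∈ T.localCell h a u ↔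
      (u, m) = (T.tail d, n) ∨ (u, m) = (T.head d, n + T.shift d) := by
  obtain ⟨e1, e2⟩ := V.edge_conditions ht0 ht1 hx
  have hx' := V.edge_reverse hx
  rw [← sub_add_eq_sub_sub, ← combo_add] at hx'
  obtain ⟨f1, f2⟩ := V.edge_conditions (by linarith) (by linarith) hx'
  constructor
  · intro hu
    obtain ⟨o, -, ho, -⟩ := V.exists_center u
    rcases le_total (cdot (T.vec h d) (o - (x - combo W m))) 0 with h1 | h1
    · left
      refine V.eq_of_forall_cdot_nonpos hu ho e1 fun d' hd' h0 => ?_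
      rw [e2 d' hd' h0]
      exact h1
    · right
      refine V.eq_of_forall_cdot_nonpos hu ho f1 fun d' hd' h0 => ?_
      rw [f2 d' hd' h0, V.tutte.vec_flip, cdot_neg_left]
      linarith
  · rintro (h1 | h1)
    · obtain ⟨rfl, rfl⟩ := Prod.mk.inj h1
      exact e1
    · obtain ⟨rfl, rfl⟩ := Prod.mk.inj h1
      exact f1

theorem mem_nearest_iff (V : T.IsDual c h W k a w) {x : ℂ} {v : T.cover.Vertex} :
    v ∈ T.cover.nearest (T.onVertices h) (fun v => w (T.vtx v).1) x ↔
      x - combo W (T.vtx v).2 ∈ T.localCell h a (T.vtx v).1 := by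
  rw [← V.mem_siteCell_iff]
  exact T.mem_powerCell_iff h w v x

theorem nearest_of_mem_strictCell (V : T.IsDual c h W k a w) {x : ℂ} {v : T.cover.Vertex}
    (hx : x - combo W (T.vtx v).2 ∈ T.strictCell h a (T.vtx v).1) :
    T.cover.nearest (T.onVertices h) (fun v => w (T.vtx v).1) x = {v} := by
  ext u
  rw [V.mem_nearest_iff, Set.mem_singleton_iff]
  constructor
  · intro hu
    exact (T.vtx_injective (V.eq_of_mem_strictCell_of_mem_localCell hx hu)).symm
  · rintro rfl
    exact strictCell_subset h a _ hx

theorem nearest_edge (V : T.IsDual c h W k a w) {d : D} {n : ℤ × ℤ} {x : ℂ} {t : ℝ}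
    (ht0 : 0 < t) (ht1 : t < 1)
    (hx : x - combo W n = a (T.rot.symm d) + (t : ℂ) * (a d - a (T.rot.symm d))) :
    T.cover.nearest (T.onVertices h) (fun v => w (T.vtx v).1) x =
      {T.cover.tail (d, n), T.cover.head (d, n)} := by
  ext u
  rw [V.mem_nearest_iff, V.mem_localCell_edge_iff ht0 ht1 hx, Set.mem_insert_iff,
    Set.mem_singleton_iff, Prod.mk.eta, ← T.vtx_tail, ← T.vtx_head, T.vtx_injective.eq_iff,
    T.vtx_injective.eq_iff]

theorem nearest_corner (V : T.IsDual c h W k a w) (x : D × (ℤ × ℤ)) :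
    T.cover.nearest (T.onVertices h) (fun v => w (T.vtx v).1) (corner a W x) =
      T.cover.faceVertices (T.cover.left x) := by
  ext u
  rw [V.mem_nearest_iff, CombinatorialMap.faceVertices, Set.mem_ofPred_eq]
  constructor
  · intro hu
    obtain ⟨y, hy1, hy2⟩ := V.exists_left_eq_of_corner_mem hu
    exact ⟨y, T.vtx_injective hy2, hy1⟩
  · rintro ⟨⟨d, n⟩, rfl, hd⟩
    rw [← V.corner_eq_of_left_eq hd, T.vtx_tail, corner, add_sub_cancel_right]
    exact V.corner_mem_localCell rfl

theorem exists_of_not_mem_strictCell (V : T.IsDual c h W k a w) {v : T.Vertex} {y : ℂ}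
    (hy : y ∈ T.localCell h a v) {d : D} (hd : T.tail d = v)
    (h0 : cdot (T.vec h d) (y - a d) = 0) : ∃ t : ℝ, 0 ≤ t ∧ t ≤ 1 ∧
      y = a (T.rot.symm d) + (t : ℂ) * (a d - a (T.rot.symm d)) := by
  obtain ⟨δ, rfl⟩ := T.rot.surjective d
  rw [Equiv.symm_apply_apply]
  refine V.tutte.balancedCycles.1.mem_segment_of_cdot_eq_zero V.cross_pos V.pos V.rot
    (fun d' hd' => hy d' ?_) h0
  rw [← T.tail_eq_iff.2 hd', ← hd, T.tail_rot]

theorem isWeightedDelaunay (V : T.IsDual c h W k a w) :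
    T.cover.IsWeightedDelaunay (T.onVertices h) (fun v => w (T.vtx v).1) where
  vertex v := by
    obtain ⟨o, -, ho, -⟩ := V.exists_center (T.vtx v).1
    refine ⟨o + combo W (T.vtx v).2, V.nearest_of_mem_strictCell ?_⟩
    rwa [add_sub_cancel_right]
  edge := by
    rintro ⟨d, n⟩
    refine ⟨a (T.rot.symm d) + ((1 / 2 : ℝ) : ℂ) * (a d - a (T.rot.symm d)) + combo W n,
      V.nearest_edge (t := 1 / 2) (by norm_num) (by norm_num) ?_⟩
    rw [add_sub_cancel_right]
  face f := by
    obtain ⟨x, rfl⟩ := T.cover.left_surjective f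
    exact ⟨_, V.nearest_corner x⟩
  exhaust x := by
    obtain ⟨⟨v, n⟩, hs⟩ := V.exists_mem_siteCell x
    rw [V.mem_siteCell_iff] at hs
    by_cases hst : x - combo W n ∈ T.strictCell h a v
    · left
      obtain ⟨v', hv'⟩ := T.vtx_surjective (v, n)
      refine ⟨v', V.nearest_of_mem_strictCell ?_⟩
      rwa [hv']
    · right
      obtain ⟨d, rfl, h0⟩ : ∃ d, T.tail d = v ∧ cdot (T.vec h d) (x - combo W n - a d) = 0 := by
        by_contra! hcon
        exact hst fun d hd => lt_of_le_of_ne (hs d hd) (hcon d hd)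
      -- A point on no interior of a cell lies on a side: the ends of the side are faces and its
      -- relative interior is an edge.
      obtain ⟨t, ht0, ht1, ht⟩ := V.exists_of_not_mem_strictCell hs rfl h0
      rcases ht0.eq_or_lt with rfl | ht0
      · right
        refine ⟨T.cover.left (T.rot.symm d, n), ?_⟩
        rw [← V.nearest_corner, corner]
        congr 1
        rw [← sub_eq_iff_eq_add, ht]
        simp
      · rcases ht1.eq_or_lt with rfl | ht1
        · right
          refine ⟨T.cover.left (d, n), ?_⟩
          rw [← V.nearest_corner, corner]
          congr 1
          rw [← sub_eq_iff_eq_add, ht]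
          simp
        · left
          exact ⟨(d, n), V.nearest_edge ht0 ht1 ht⟩
  convex := by
    rintro ⟨d, n⟩
    have h0 := T.onVertices_head_sub_tail h (d, n)
    rw [V.tutte.dif_eq] at h0
    refine ⟨sub_ne_zero.1 (by rw [h0]; exact V.tutte.vec_ne_zero d), ?_⟩
    rintro v ⟨y, rfl, hy⟩ hv1 hv2
    rw [h0, mul_comm]
    change 0 < cross _ _
    obtain ⟨i, hi, rfl⟩ := T.exists_iterate_of_left_eq hy
    rw [cover_next_minimalPeriod] at hi
    have h1 : T.onVertices h (T.cover.tail (T.cover.next^[i] (d, n))) -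
        T.onVertices h (T.cover.tail (d, n)) = ∑ j ∈ Finset.range i, T.vec h (T.next^[j] d) := by
      have h2 := T.sum_dif_next h (d, n) i
      simp only [cover_next_iterate, V.tutte.dif_eq] at h2 ⊢
      rw [h2]
      rfl
    have hi0 : i ≠ 0 := by
      rintro rfl
      exact hv1 rfl
    have hi1 : i ≠ 1 := by
      rintro rfl
      exact hv2 (T.cover.tail_next _)
    obtain ⟨l, rfl⟩ : ∃ l, i = l + 1 := ⟨i - 1, by omega⟩
    have h3 := V.tutte.balancedCycles.2.cross_sum_pos (V.tutte.cross_next_pos V.cross_pos) d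
      (l := l) (by omega) (by omega)
    rw [h1, Finset.sum_range_succ', cross_add, cross_sum, Function.iterate_zero, id, cross_same,
      add_zero]
    simpa only [one_mul] using h3

theorem isDualVoronoi (V : T.IsDual c h W k a w) {hd : T.cover.Face → ℂ}
    (hhd : ∀ x, hd (T.cover.left x) = corner a W x) :
    T.cover.IsDualVoronoi (T.onVertices h) (fun v => w (T.vtx v).1) hd where
  injective f f' hff' := by
    obtain ⟨x, rfl⟩ := T.cover.left_surjective f
    obtain ⟨x', rfl⟩ := T.cover.left_surjective f'
    rw [hhd, hhd] at hff'
    have h1 : corner a W x' - combo W x.2 ∈ T.localCell h a (T.tail x.1) := by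
      rw [← hff', corner, add_sub_cancel_right]
      exact V.corner_mem_localCell rfl
    obtain ⟨y, hy, hy'⟩ := V.exists_left_eq_of_corner_mem h1
    rw [← hy]
    rw [← V.corner_eq_of_left_eq hy] at hff'
    obtain ⟨d, n⟩ := x
    obtain ⟨d', n'⟩ := y
    obtain ⟨h2, rfl⟩ := Prod.mk.inj hy'
    rw [corner, corner] at hff'
    have h4 : d = d' := V.corner_injective h2.symm (add_right_cancel hff')
    subst h4
    rfl
  face f := by
    obtain ⟨x, rfl⟩ := T.cover.left_surjective f
    rw [hhd, V.nearest_corner]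
  edge := by
    rintro ⟨d, n⟩
    have hr : hd (T.cover.right (d, n)) = a (T.rot.symm d) + combo W n := by
      rw [CombinatorialMap.right, hhd, cover_flip, corner, V.sub_right, combo_add]
      ring
    have hl : hd (T.cover.left (d, n)) = a d + combo W n := hhd _
    have hrot : T.tail (T.rot.symm d) = T.tail d := by
      rw [← T.tail_rot (T.rot.symm d), Equiv.apply_symm_apply]
    have hmem : ∀ (v : T.cover.Vertex) x,
        x ∈ T.cover.powerCell (T.onVertices h) (fun v => w (T.vtx v).1) v ↔
          x - combo W (T.vtx v).2 ∈ T.localCell h a (T.vtx v).1 := fun v x => V.mem_nearest_iff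
    have hflip : ∀ x, cdot (T.vec h (T.flip d)) (x - combo W (n + T.shift d) - a (T.flip d)) =
        - cdot (T.vec h d) (x - combo W n - a (T.rot.symm d)) := by
      intro x
      rw [V.tutte.vec_flip, cdot_neg_left, V.sub_right, combo_add]
      congr 2
      ring
    have hside : ∀ x, cdot (T.vec h d) (x - combo W n - a (T.rot.symm d)) =
        cdot (T.vec h d) (x - combo W n - a d) := by
      intro x
      have h1 := BalancedCycles.cdot_side_sub V.rot (T.rot.symm d)
      rw [Equiv.apply_symm_apply, cdot_sub] at h1
      rw [cdot_sub, cdot_sub _ _ (a d)]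
      linarith
    have hsymm : a (T.rot.symm (T.flip d)) = a d - combo W (T.shift d) := V.next d
    ext x
    rw [Set.mem_inter_iff, hmem, hmem, T.vtx_tail, T.vtx_head, hl, hr]
    constructor
    · rintro ⟨h1, h2⟩
      have h3 := h1 d rfl
      have h4 := h2 (T.flip d) rfl
      rw [hflip, hside] at h4
      obtain ⟨t, ht0, ht1, ht⟩ := V.exists_of_not_mem_strictCell h1 rfl
        (le_antisymm h3 (by linarith))
      refine ⟨t, 1 - t, ht0, by linarith, by ring, ?_⟩
      rw [sub_eq_iff_eq_add] at ht
      rw [ht, Complex.real_smul, Complex.real_smul]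
      push_cast
      ring
    · rintro ⟨s, t, hs, ht, hst, rfl⟩
      have hconv : ∀ v (y z : ℂ), y ∈ T.localCell h a v → z ∈ T.localCell h a v →
          s • y + t • z ∈ T.localCell h a v :=
        fun v y z hy hz => T.convex_localCell h a v hy hz hs ht hst
      have htr : ∀ m y z, s • y + t • z - combo W m =
          s • (y - combo W m) + t • (z - combo W m) := by
        intro m y z
        have : combo W m = (s + t) • combo W m := by rw [hst, one_smul]
        conv_lhs => rw [this]
        rw [add_smul, smul_sub, smul_sub]
        ring
      rw [htr, htr]
      refine ⟨hconv _ _ _ ?_ ?_, hconv _ _ _ ?_ ?_⟩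
      · rw [add_sub_cancel_right]
        exact V.corner_mem_localCell rfl
      · rw [add_sub_cancel_right]
        exact V.corner_mem_localCell hrot
      · rw [combo_add, sub_add_eq_sub_sub, add_sub_cancel_right, ← hsymm]
        refine V.corner_mem_localCell ?_
        rw [← T.tail_rot, Equiv.apply_symm_apply]
        rfl
      · rw [combo_add, sub_add_eq_sub_sub, add_sub_cancel_right, V.sub_right, add_sub_cancel_right]
        exact V.corner_mem_localCell rfl
  vertex v := by
    obtain ⟨⟨d0, n⟩, rfl⟩ := T.cover.tail_surjective v
    have himg : hd '' T.cover.vertexFaces (T.cover.tail (d0, n)) =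
        (fun z => z + combo W n) '' (a '' {d | T.tail d = T.tail d0}) := by
      ext z
      constructor
      · rintro ⟨f, ⟨⟨d, m⟩, h1, rfl⟩, rfl⟩
        have h2 := congrArg T.vtx h1
        rw [T.vtx_tail, T.vtx_tail] at h2
        obtain ⟨h3, rfl⟩ := Prod.mk.inj h2
        exact ⟨a d, ⟨d, h3, rfl⟩, (hhd (d, _)).symm⟩
      · rintro ⟨y, ⟨d, h3, rfl⟩, rfl⟩
        exact ⟨T.cover.left (d, n), ⟨(d, n), T.vtx_injective (Prod.ext h3 rfl), rfl⟩, hhd _⟩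
    have hhull : convexHull ℝ (hd '' T.cover.vertexFaces (T.cover.tail (d0, n))) =
        (fun z => z + combo W n) '' convexHull ℝ (a '' {d | T.tail d = T.tail d0}) := by
      rw [himg]
      have := (AffineEquiv.constVAdd ℝ ℂ (combo W n)).toAffineMap.image_convexHull
        (a '' {d | T.tail d = T.tail d0})
      have h2 : ⇑(AffineEquiv.constVAdd ℝ ℂ (combo W n)).toAffineMap = fun z => z + combo W n := by
        funext z
        simp [add_comm]
      rw [h2] at this
      exact this.symm
    -- The triangulation from an interior point turns the intersection of half-planes into the hull
    -- of its corners.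
    have hcell : T.localCell h a (T.tail d0) = convexHull ℝ (a '' {d | T.tail d = T.tail d0}) := by
      apply Set.Subset.antisymm
      · intro x hx
        obtain ⟨o, ho, -, htri⟩ := V.exists_center (T.tail d0)
        obtain ⟨d, hd, s, t, hs, ht, hst, rfl⟩ := htri x hx
        have h1 : o + ((s : ℂ) * (a d - o) + (t : ℂ) * (a (T.rot d) - o)) =
            (1 - s - t) • o + s • a d + t • a (T.rot d) := by
          simp only [Complex.real_smul]
          push_cast
          ring
        have h2 : a d ∈ convexHull ℝ (a '' {d | T.tail d = T.tail d0}) :=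
          subset_convexHull ℝ _ ⟨d, hd, rfl⟩
        have h3 : a (T.rot d) ∈ convexHull ℝ (a '' {d | T.tail d = T.tail d0}) :=
          subset_convexHull ℝ _ ⟨T.rot d, (T.tail_rot d).trans hd, rfl⟩
        rw [h1]
        exact (convex_convexHull ℝ _).sum_three_mem ho h2 h3 (by linarith) hs ht (by ring)
      · apply convexHull_min
        · rintro _ ⟨d, hd, rfl⟩
          exact V.corner_mem_localCell hd
        · exact T.convex_localCell h a _
    rw [hhull, ← hcell]
    ext x
    have h1 : x ∈ T.cover.powerCell (T.onVertices h) (fun v => w (T.vtx v).1)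
        (T.cover.tail (d0, n)) ↔ x - combo W n ∈ T.localCell h a (T.tail d0) := V.mem_nearest_iff
    rw [h1]
    constructor
    · intro hx
      exact ⟨_, hx, sub_add_cancel _ _⟩
    · rintro ⟨y, hy, rfl⟩
      simpa using hy

end IsDual

end MarkedTorus

/-! ### Periods of a dual Voronoi decomposition and the choice of weights. -/

namespace MarkedTorus

variable {D : Type*} [Fintype D] (T : MarkedTorus D)

/-- The component in the direction `b - c` attains a maximum on `K`, which the translation would
exceed. -/
theorem eq_of_translate_mem_compact {K : Set ℂ} (hK : IsCompact K) (hne : K.Nonempty) {b c : ℂ}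
    (h : ∀ x ∈ K, x + b - c ∈ K) : b = c := by
  by_contra hbc
  have hc : ContinuousOn (fun x => cdot (b - c) x) K := by
    simp only [cdot_def]
    fun_prop
  obtain ⟨x, hx, hmax⟩ := hK.exists_isMaxOn hne hc
  have h1 : cdot (b - c) (x + b - c) ≤ cdot (b - c) x := hmax (h x hx)
  rw [add_sub_assoc, cdot_add] at h1
  have := cdot_self_pos (sub_ne_zero.2 hbc)
  linarith

theorem powerCell_translate {p : T.Vertex → ℂ} {W : ℂ × ℂ} {w : T.cover.Vertex → ℝ}
    (hw : T.IsPeriodicWeight w) (d : D) (n : ℤ × ℤ) {x : ℂ}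
    (hx : x ∈ T.cover.powerCell (T.onVertices (T.ofPeriods p W)) w (T.cover.tail (d, 0))) :
    x + combo W n ∈ T.cover.powerCell (T.onVertices (T.ofPeriods p W)) w (T.cover.tail (d, n)) := by
  have hpow : ∀ (d : D) (m : ℤ × ℤ),
      T.cover.power (T.onVertices (T.ofPeriods p W)) w (T.cover.tail (d, m + n)) (x + combo W n) =
        T.cover.power (T.onVertices (T.ofPeriods p W)) w (T.cover.tail (d, m)) x := by
    intro d m
    rw [CombinatorialMap.power, CombinatorialMap.power, hw, onVertices, onVertices, T.vtx_tail,
      T.vtx_tail, ofPeriods_add, add_sub_add_right_eq_sub]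
  intro u
  obtain ⟨⟨d', m⟩, rfl⟩ := T.cover.tail_surjective u
  have h1 := hpow d 0
  have h2 := hpow d' (m - n)
  rw [zero_add] at h1
  rw [sub_add_cancel] at h2
  rw [h1, h2]
  exact hx _

/-- The dual of a Voronoi decomposition has the same periods. -/
theorem periods_eq_of_isDualVoronoi {p : T.Vertex → ℂ} {W : ℂ × ℂ} {w : T.cover.Vertex → ℝ}
    (hw : T.IsPeriodicWeight w) {q : T.Face → ℂ} {P : ℂ × ℂ} {k : ℝ} (hk : k ≠ 0)
    (hdual : T.cover.IsDualVoronoi (T.onVertices (T.ofPeriods p W)) w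
      (fun f => T.onFaces (fun f n => q f + combo P n) f / (k : ℂ))) (n : ℤ × ℤ) :
    combo P n = k * combo W n := by
  obtain ⟨d⟩ := T.nonempty_dart
  have hkc : (k : ℂ) ≠ 0 := by exact_mod_cast hk
  set hd : T.cover.Face → ℂ := fun f => T.onFaces (fun f n => q f + combo P n) f / (k : ℂ) with hhd
  set VF := fun m : ℤ × ℤ => hd '' T.cover.vertexFaces (T.cover.tail (d, m)) with hVF
  have hfaces : VF 0 = (fun x => x + - (combo P n / k)) '' VF n := by
    have hval : ∀ d' m, hd (T.cover.left (d', m + n)) = hd (T.cover.left (d', m)) + combo P n / k := by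
      intro d' m
      simp only [hhd, onFaces, T.fce_left]
      rw [add_sub_right_comm, combo_add]
      ring
    ext z
    constructor
    · rintro ⟨f, ⟨⟨d', m⟩, h1, rfl⟩, rfl⟩
      have h2 := congrArg T.vtx h1
      rw [T.vtx_tail, T.vtx_tail] at h2
      obtain ⟨h3, rfl⟩ := Prod.mk.inj h2
      refine ⟨_, ⟨T.cover.left (d', n), ⟨(d', n), T.vtx_injective (Prod.ext h3 rfl), rfl⟩, rfl⟩, ?_⟩
      have h4 := hval d' 0
      rw [zero_add] at h4
      simp only [h4, add_neg_cancel_right]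
    · rintro ⟨y, ⟨f, ⟨⟨d', m⟩, h1, rfl⟩, rfl⟩, rfl⟩
      have h2 := congrArg T.vtx h1
      rw [T.vtx_tail, T.vtx_tail] at h2
      obtain ⟨h3, rfl⟩ := Prod.mk.inj h2
      refine ⟨T.cover.left (d', 0), ⟨(d', 0), T.vtx_injective (Prod.ext h3 rfl), rfl⟩, ?_⟩
      have h4 := hval d' 0
      rw [zero_add] at h4
      simp only [h4, add_neg_cancel_right]
  have hhull : convexHull ℝ (VF 0) = (fun x => x + - (combo P n / k)) '' convexHull ℝ (VF n) := by
    rw [hfaces]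
    have := (AffineEquiv.constVAdd ℝ ℂ (- (combo P n / k))).toAffineMap.image_convexHull (VF n)
    have h2 : ⇑(AffineEquiv.constVAdd ℝ ℂ (- (combo P n / k))).toAffineMap =
        fun z => z + - (combo P n / k) := by
      funext z
      simp [add_comm]
    rw [h2] at this
    exact this.symm
  have hfin : (VF 0).Finite := by
    refine (Set.finite_range fun d' : D => hd (T.cover.left (d', 0))).subset ?_
    rintro z ⟨f, ⟨⟨d', m⟩, h1, rfl⟩, rfl⟩
    have h2 := congrArg T.vtx h1
    rw [T.vtx_tail, T.vtx_tail] at h2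
    obtain ⟨-, rfl⟩ := Prod.mk.inj h2
    exact ⟨d', rfl⟩
  -- The same cell is displaced by `combo W n` as a power cell and by `combo P n / k` as a hull of
  -- dual vertices.
  have h1 := eq_of_translate_mem_compact (hfin.isCompact_convexHull ℝ) (b := combo W n)
    (c := combo P n / k) ⟨_, subset_convexHull ℝ _ ⟨T.cover.left (d, 0), ⟨(d, 0), rfl, rfl⟩, rfl⟩⟩
    (fun x hx => by
      rw [← hdual.vertex] at hx
      have h2 := T.powerCell_translate hw d n hx
      rw [hdual.vertex] at h2
      rw [hhull]
      exact ⟨_, h2, (sub_eq_add_neg _ _).symm⟩)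
  rw [h1]
  field_simp

/-- The dual graph can be translated such that it is the dual of the graph for some weights. -/
theorem exists_isDual {c : D → ℝ} {h : T.Vertex → ℤ × ℤ → ℂ} {W : ℂ × ℂ} {k : ℝ} {a : D → ℂ}
    (H : T.IsTutte c h (combo W)) (hW : cross W.1 W.2 = 1) (hk : 0 < k)
    (hc : ∀ d, c (T.flip d) = c d) (hE : ∑ d, c d * ‖T.vec h d‖ ^ 2 = 4 * k)
    (hrot : ∀ d, a (T.rot d) =
      a d + Complex.I * (((c (T.rot d) / k : ℝ) : ℂ) * T.vec h (T.rot d)))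
    (hnext : ∀ d, a (T.next d) = a d - combo W (T.shift d)) :
    ∃ t w, T.IsDual c h W k (fun d => a d - t) w := by
  have hhead : ∀ d n, h (T.head d) (n + T.shift d) = h (T.tail d) n + T.vec h d := by
    intro d n
    rw [← H.dif_eq d n, dif]
    ring
  have hlift : ∀ v n, h v n = h v 0 + combo W n := by
    intro v n
    have := H.lift v 0 n
    rwa [zero_add] at this
  -- Half the defect of the powers of the two ends of `d` before weights and translation are chosen.
  -- Orthogonality makes `f` odd under `flip`, and it is closed because both terms telescope around
  -- a face. Its potential goes into the weights and its periods into the translation.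
  set f : D → ℝ := fun d => cdot (T.vec h d) (a d) -
    1 / 2 * (‖h (T.tail d) 0 + T.vec h d‖ ^ 2 - ‖h (T.tail d) 0‖ ^ 2) with hf
  have hflip : ∀ d, f (T.flip d) = - f d := by
    intro d
    have e1 : a (T.flip d) = a (T.rot.symm d) - combo W (T.shift d) := by
      have h1 : T.rot.symm d = T.next (T.flip d) := by
        rw [Equiv.symm_apply_eq, T.rot_next, T.flip_flip]
      rw [h1, hnext, T.shift_flip, combo_neg]
      ring
    have e2 : a d = a (T.rot.symm d) + Complex.I * (((c d / k : ℝ) : ℂ) * T.vec h d) := by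
      have := hrot (T.rot.symm d)
      rwa [Equiv.apply_symm_apply] at this
    have e3 : cdot (T.vec h d) (a d) = cdot (T.vec h d) (a (T.rot.symm d)) := by
      rw [e2, cdot_add, cdot_I_mul_right, cross_real_mul, cross_same]
      ring
    have e4 : T.tail (T.flip d) = T.head d := rfl
    have e5 : h (T.head d) 0 = h (T.tail d) 0 + T.vec h d - combo W (T.shift d) := by
      have h1 := hhead d 0
      rw [zero_add, hlift] at h1
      rw [← h1]
      ring
    simp only [hf, e3, H.vec_flip, e1, e4, e5]
    simp only [cdot_def, sq_norm_eq, Complex.add_re, Complex.add_im, Complex.sub_re,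
      Complex.sub_im, Complex.neg_re, Complex.neg_im]
    ring
  have hclosed : T.Closed f := by
    intro d
    have e1 : ∀ d n, f d = cdot (T.vec h d) (a d + combo W n) -
        1 / 2 * T.dif (fun v n => ‖h v n‖ ^ 2) (d, n) := by
      intro d n
      rw [dif]
      simp only [hhead, hf, hlift (T.tail d) n]
      simp only [cdot_def, sq_norm_eq, Complex.add_re, Complex.add_im]
      ring
    have e2 : ∀ i, f (T.next^[i] d) = cdot (a d) (T.dif h (T.cover.next^[i] (d, 0))) -
        1 / 2 * T.dif (fun v n => ‖h v n‖ ^ 2) (T.cover.next^[i] (d, 0)) := by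
      intro i
      have e3 : ∀ x : D × (ℤ × ℤ), a (T.cover.next x).1 + combo W (T.cover.next x).2 =
          a x.1 + combo W x.2 := by
        rintro ⟨d, n⟩
        rw [cover_next, hnext, combo_add]
        ring
      have e4 := iterate_invariant (f := fun x : D × (ℤ × ℤ) => a x.1 + combo W x.2) e3
        ((d, 0) : D × (ℤ × ℤ)) i
      rw [combo_zero, add_zero] at e4
      have e5 : (T.cover.next^[i] (d, 0)).1 = T.next^[i] d := by rw [cover_next_iterate]
      rw [← Prod.mk.eta (p := T.cover.next^[i] (d, 0)), H.dif_eq, e5,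
        e1 _ (T.cover.next^[i] (d, 0)).2, cdot_comm, ← e5, e4]
    simp only [e2]
    rw [Finset.sum_sub_distrib, ← Finset.mul_sum, ← cdot_sum, ← T.cover_next_minimalPeriod d 0,
      sum_dif_face, sum_dif_face, cdot_zero, mul_zero, sub_zero]
  obtain ⟨p, P, hp⟩ := hclosed.exists_eq hflip
  -- The vector whose components along `W.1` and `W.2` are `P.1` and `P.2`, by `cross W.1 W.2 = 1`.
  set t : ℂ := ((-P.1 : ℝ) : ℂ) * (Complex.I * W.2) + (P.2 : ℂ) * (Complex.I * W.1) with ht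
  have htW : ∀ n, cdot t (combo W n) = combo P n := by
    intro n
    have e1 : cdot t (combo W n) = (n.1 * P.1 + n.2 * P.2) * cross W.1 W.2 := by
      simp [ht, cdot_def, cross_def, combo]
      ring
    rw [e1, hW, mul_one, combo]
  refine ⟨t, fun v => -2 * (p v - cdot t (h v 0)), H, hW, hk, hc, hE, fun d => ?_, fun d => ?_,
    fun d => ?_⟩
  · rw [hrot]
    ring
  · rw [hnext]
    ring
  · have e1 := hp d
    have e2 := hhead d 0
    rw [zero_add] at e2
    have e3 : cdot t (h (T.head d) 0) = cdot t (h (T.tail d) 0) + cdot t (T.vec h d) -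
        combo P (T.shift d) := by
      rw [← htW, ← cdot_add, ← cdot_sub]
      congr 1
      rw [← e2, hlift (T.head d) (T.shift d)]
      ring
    simp only [sitePower, e2, e3]
    simp only [hf, grad] at e1
    have e4 : ∀ y : ℂ, ‖a d - t - (y + T.vec h d)‖ ^ 2 - ‖a d - t - y‖ ^ 2 =
        2 * cdot t (T.vec h d) - 2 * (cdot (T.vec h d) (a d) -
          1 / 2 * (‖y + T.vec h d‖ ^ 2 - ‖y‖ ^ 2)) := by
      intro y
      simp only [cdot_def, sq_norm_eq, Complex.add_re, Complex.add_im, Complex.sub_re,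
        Complex.sub_im]
      ring
    have e5 := e4 (h (T.tail d) 0)
    rw [e1] at e5
    linarith

end MarkedTorus

/-! ### Both directions of the equivalence. -/

namespace MarkedTorus

variable {D : Type*} [Fintype D] {T : MarkedTorus D}

theorem eq_zero_of_combo_eq_zero {W : ℂ × ℂ} (hW : cross W.1 W.2 = 1) {n : ℤ × ℤ}
    (hn : combo W n = 0) : n = 0 := by
  have h1 : cross (combo W n) W.2 = n.1 * cross W.1 W.2 := by
    simp [cross_def, combo]
    ring
  have h2 : cross W.1 (combo W n) = n.2 * cross W.1 W.2 := by
    simp [cross_def, combo]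
    ring
  rw [hn, hW, mul_one, cross_def] at h1 h2
  refine Prod.ext ?_ ?_
  · exact_mod_cast (by simpa using h1.symm : (n.1 : ℝ) = 0)
  · exact_mod_cast (by simpa using h2.symm : (n.2 : ℝ) = 0)

theorem exists_cdot_combo_ne_zero {W : ℂ × ℂ} (hW : cross W.1 W.2 = 1) {e : ℂ} (he : e ≠ 0) :
    ∃ n, cdot e (combo W n) ≠ 0 := by
  by_contra! h
  have h1 : cdot e W.1 = 0 := by simpa [combo] using h (1, 0)
  have h2 : cdot e W.2 = 0 := by simpa [combo] using h (0, 1)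
  have h3 : cdot e e * cross W.1 W.2 =
      cross e W.2 * cdot e W.1 + cross W.1 e * cdot e W.2 := by
    simp only [cdot_def, cross_def]
    ring
  rw [h1, h2, hW] at h3
  linarith [cdot_self_pos he]

theorem Coclosed.isTutte (hsimple : T.cover.IsSimple) (hconn : T.cover.IsThreeConnected)
    {c : D → ℝ} (hc : ∀ d, 0 < c d) {p : T.Vertex → ℂ} {W : ℂ × ℂ} (hW : cross W.1 W.2 = 1)
    (hp : T.Coclosed (fun d => (c d : ℂ) * T.vec (T.ofPeriods p W) d)) :
    T.IsTutte c (T.ofPeriods p W) (combo W) where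
  simple := hsimple
  conn := hconn
  pos := hc
  lift := T.ofPeriods_add p W
  inj _ := eq_zero_of_combo_eq_zero hW
  indep _ := exists_cdot_combo_ne_zero hW
  harmonic v n := by
    have h1 := hp v
    simp only [vec_ofPeriods] at h1
    simp only [dif_ofPeriods]
    convert h1

theorem IsConjugate.sub_const {c : D → ℝ} {h : T.cover.Vertex → ℂ} {hs : T.cover.Face → ℂ}
    (H : T.IsConjugate c h hs) (z : ℂ) : T.IsConjugate c h (fun f => hs f - z) := by
  intro x
  rw [sub_sub_sub_cancel_right]
  exact H x

theorem IsMinimizer.exists_dual (hsimple : T.cover.IsSimple) (hconn : T.cover.IsThreeConnected)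
    {c : D → ℝ} (hc_symm : ∀ d, c (T.flip d) = c d) (hc_pos : ∀ d, 0 < c d)
    {τ : UpperHalfPlane} {p : T.Vertex → ℂ}
    (hp : T.Coclosed (fun d => (c d : ℂ) * T.vec (T.ofPeriods p (periods τ)) d)) {k : ℝ}
    (hmin : T.IsMinimizer c τ (T.onVertices (T.ofPeriods p (periods τ))))
    (hk : T.energy c (T.onVertices (T.ofPeriods p (periods τ))) = k) :
    0 < k ∧ ∃ hs : T.cover.Face → ℂ,
      T.IsConjugate c (T.onVertices (T.ofPeriods p (periods τ))) hs ∧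
      ∃ w : T.cover.Vertex → ℝ, T.IsPeriodicWeight w ∧
        T.cover.IsWeightedDelaunay (T.onVertices (T.ofPeriods p (periods τ))) w ∧
        T.cover.IsDualVoronoi (T.onVertices (T.ofPeriods p (periods τ))) w
          (fun f => hs f / (k : ℂ)) := by
  have hW := cross_periods τ
  have hT := hp.isTutte hsimple hconn hc_pos hW
  have hmin' : ∀ p' W', cross W'.1 W'.2 = 1 →
      ∑ d, c d * ‖T.vec (T.ofPeriods p (periods τ)) d‖ ^ 2 ≤
        ∑ d, c d * ‖T.vec (T.ofPeriods p' W') d‖ ^ 2 := by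
    intro p' W' hW'
    -- A rotation preserves the energy, so minimality over `τ` extends to all pairs of periods of
    -- signed area one.
    obtain ⟨u, τ', hu, hτ'⟩ := exists_rotation hW'
    have h1 := hmin.2 τ' _ (T.isLift_iff.2 ⟨fun v => u * p' v, rfl⟩)
    rw [energy_onVertices, energy_onVertices, hτ'] at h1
    simp only [norm_vec_smul, norm_mul, hu, one_mul] at h1
    linarith
  have hZ := T.sum_sq_eq_zero_of_forall_le hW hmin'
  obtain ⟨hs, hhs⟩ := exists_isConjugate hc_symm hp
  obtain ⟨q, P, hsq, hq⟩ := IsConjugate.exists_eq hconn hc_symm hp hhs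
  rw [energy_onVertices] at hk
  obtain ⟨h1, h2⟩ := periods_eq_of_sum_sq_eq_zero hq hW hZ
  rw [hk] at h1 h2
  have hkpos : 0 < k := by
    obtain ⟨d⟩ := T.nonempty_dart
    rw [← hk]
    refine mul_pos (by norm_num) (Finset.sum_pos (fun d _ => mul_pos (hc_pos d)
      (pow_pos (norm_pos_iff.2 (hT.vec_ne_zero d)) 2)) ⟨d, Finset.mem_univ d⟩)
  have hk0 : (k : ℂ) ≠ 0 := by exact_mod_cast hkpos.ne'
  have hP : ∀ n, combo P n = k * combo (periods τ) n := by
    intro n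
    rw [combo, combo, h1, h2]
    ring
  obtain ⟨t, w, V⟩ := T.exists_isDual hT hW hkpos hc_symm (by rw [← hk]; ring)
    -- The lift of `d` at the origin has on its left the face labelled `-off d`, whence the sign.
    (a := fun d => q (T.left d) / k - combo (periods τ) (T.off d))
    (fun d => by
      have h3 := hq (T.rot d)
      rw [hP, cograd, CombinatorialMap.right, T.left_flip_rot, coshift, Equiv.symm_apply_apply,
        combo_sub] at h3
      push_cast
      field_simp
      linear_combination - h3)
    (fun d => by
      rw [T.left_next, off_next, combo_add]
      ring)
  -- The freedom of translating a conjugate map absorbs the translation required by the weights.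
  refine ⟨hkpos, fun f => hs f - k * t, hhs.sub_const _, fun v => w (T.vtx v).1, fun d m n => rfl,
    V.isWeightedDelaunay, V.isDualVoronoi ?_⟩
  rintro ⟨d, n⟩
  simp only [hsq, onFaces, fce_left, IsDual.corner, hP, combo_sub]
  field_simp
  ring

theorem IsConjugate.isMinimizer (hconn : T.cover.IsThreeConnected)
    {c : D → ℝ} (hc_symm : ∀ d, c (T.flip d) = c d) (hc_pos : ∀ d, 0 < c d)
    {τ : UpperHalfPlane} {p : T.Vertex → ℂ}
    (hp : T.Coclosed (fun d => (c d : ℂ) * T.vec (T.ofPeriods p (periods τ)) d)) {k : ℝ}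
    (hk : 0 < k) {hs : T.cover.Face → ℂ}
    (hhs : T.IsConjugate c (T.onVertices (T.ofPeriods p (periods τ))) hs)
    {w : T.cover.Vertex → ℝ} (hw : T.IsPeriodicWeight w)
    (hdual : T.cover.IsDualVoronoi (T.onVertices (T.ofPeriods p (periods τ))) w
      (fun f => hs f / (k : ℂ))) :
    T.IsMinimizer c τ (T.onVertices (T.ofPeriods p (periods τ))) ∧
      T.energy c (T.onVertices (T.ofPeriods p (periods τ))) = k := by
  obtain ⟨q, P, rfl, hq⟩ := hhs.exists_eq hconn hc_symm hp
  have hP := T.periods_eq_of_isDualVoronoi hw hk.ne' hdual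
  have h1 : P.1 = k * (periods τ).1 := by simpa [combo] using hP (1, 0)
  have h2 : P.2 = k * (periods τ).2 := by simpa [combo] using hP (0, 1)
  refine ⟨⟨T.isLift_iff.2 ⟨p, rfl⟩, fun τ' h' hh' => ?_⟩, ?_⟩
  · obtain ⟨p', rfl⟩ := T.isLift_iff.1 hh'
    rw [energy_onVertices, energy_onVertices]
    linarith [le_of_periods hc_pos hq hk h1 h2 p' τ']
  · rw [energy_onVertices]
    exact_mod_cast (energy_eq_of_periods hq (cross_periods τ) h1 h2).symm

end MarkedTorus

theorem corollary2 {D : Type*} [Fintype D] (T : MarkedTorus D)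
    (hsimple : T.cover.IsSimple) (hconn : T.cover.IsThreeConnected)
    (c : D → ℝ) (hc_symm : ∀ d, c (T.flip d) = c d) (hc_pos : ∀ d, 0 < c d)
    (τ : UpperHalfPlane) (h : T.cover.Vertex → ℂ) (hh : T.IsMinimizerAt c τ h) (k : ℝ) :
    ((T.IsMinimizer c τ h ∧ T.energy c h = k) ↔
      (0 < k ∧ ∃ hs : T.cover.Face → ℂ, T.IsConjugate c h hs ∧
        ∃ w : T.cover.Vertex → ℝ, T.IsPeriodicWeight w ∧
          T.cover.IsWeightedDelaunay h w ∧
          T.cover.IsDualVoronoi h w (fun f => hs f / (k : ℂ)))) ∧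
    ((T.IsMinimizer c τ h ∧ T.energy c h = k) →
      ∀ hd : T.cover.Face → ℂ, T.IsConjugate c h (fun f => (k : ℂ) * hd f) →
        ∀ x : D × (ℤ × ℤ),
          h (T.cover.head x) - h (T.cover.tail x) ≠ 0 ∧
          (c x.1 : ℂ) = (k : ℂ) / Complex.I * ((hd (T.cover.left x) - hd (T.cover.right x))
            / (h (T.cover.head x) - h (T.cover.tail x))) ∧
          0 < ((k : ℂ) / Complex.I * ((hd (T.cover.left x) - hd (T.cover.right x))
            / (h (T.cover.head x) - h (T.cover.tail x)))).re) := by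
  obtain ⟨p, rfl⟩ := T.isLift_iff.1 hh.1
  have hp : T.Coclosed
      (fun d => (c d : ℂ) * T.vec (T.ofPeriods p (MarkedTorus.periods τ)) d) := by
    refine T.coclosed_of_forall_le (fun p' => ?_) hc_symm
    have h1 := hh.2 _ (T.isLift_iff.2 ⟨p', rfl⟩)
    rw [T.energy_onVertices, T.energy_onVertices] at h1
    linarith
  have hT := hp.isTutte hsimple hconn hc_pos (MarkedTorus.cross_periods τ)
  refine ⟨⟨fun ⟨hmin, hk⟩ => hmin.exists_dual hsimple hconn hc_symm hc_pos hp hk, ?_⟩, ?_⟩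
  · rintro ⟨hk, hs, hhs, w, hw, -, hdual⟩
    exact hhs.isMinimizer hconn hc_symm hc_pos hp hk hw hdual
  · intro _ hd hconj x
    have h1 : T.onVertices (T.ofPeriods p (MarkedTorus.periods τ)) (T.cover.head x) -
        T.onVertices (T.ofPeriods p (MarkedTorus.periods τ)) (T.cover.tail x) ≠ 0 := by
      rw [T.onVertices_head_sub_tail, T.dif_ofPeriods, ← T.vec_ofPeriods]
      exact hT.vec_ne_zero x.1
    have h2 : (c x.1 : ℂ) = (k : ℂ) / Complex.I *
        ((hd (T.cover.left x) - hd (T.cover.right x)) /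
          (T.onVertices (T.ofPeriods p (MarkedTorus.periods τ)) (T.cover.head x) -
            T.onVertices (T.ofPeriods p (MarkedTorus.periods τ)) (T.cover.tail x))) := by
      rw [div_mul_div_comm, eq_div_iff (mul_ne_zero Complex.I_ne_zero h1)]
      linear_combination - hconj x
    refine ⟨h1, h2, ?_⟩
    rw [← h2]
    exact hc_pos x.1
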